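/- Let $N\ge 1$ and let $G:\mathbb R^N\times(0,\infty)\to\mathbb R$ satisfy, for some integer $\gamma\ge 1$ and constants $d,L>0$: $G\in C^\gamma(\mathbb R^N\times(0,\infty))$; $G(x,t)=t^{-N/d}G(t^{-1/d}x,1)$ for all $x\in\mathbb R^N$, $t>0$; $\sup_{x}(1+|x|)^{N+L+j}|\nabla_x^jG(x,1)|<\infty$ for $j=0,\dots,\gamma$; and $G(x,t)=\int_{\mathbb R^N}G(x-y,t-s)G(y,s)\,dy$ for all $x\in\mathbb R^N$, $t>s>0$. For $k\ge 0$ write $|||f|||_k=\int_{\mathbb R^N}|f(x)|(1+|x|^k)\,dx$, and let $\|\cdot\|_q$ be the norm of $L^q(\mathbb R^N)$. Let $0\le K<L$ with $\lfloor K\rfloor+1\le\gamma$, and let $\varphi\in L^\infty(\mathbb R^N)$ with $|||\varphi|||_K<\infty$. Let $F:\mathbb R^N\times(0,\infty)\times\mathbb R\to\mathbb R$ be such that $F(\cdot,\cdot,v)$ is Lebesgue measurable for every $v\in\mathbb R$, $F(x,t,0)=0$, and $$|F(x,t,v_1)-F(x,t,v_2)|\le C_*(1+t)^A\max\{|v_1|^{p-1},|v_2|^{p-1}\}\,|v_1-v_2|$$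 for all $x\in\mathbb R^N$, $t>0$, $v_1,v_2\in\mathbb R$, where $C_*>0$, $A\in\mathbb R$, $p\ge1$. Assume $$A_p:=-A+\frac{N(p-1)}{d}-1>0 .$$ Let $u$ be a measurable function on $\mathbb R^N\times(0,\infty)$ such that, for every $t>0$ and almost every $x\in\mathbb R^N$, $$u(x,t)=\int_{\mathbb R^N}G(x-y,t)\varphi(y)\,dy+\int_0^t\!\int_{\mathbb R^N}G(x-y,t-s)F(y,s,u(y,s))\,dy\,ds,$$ and such that, for all $q\in[1,\infty]$ and $\ell\in[0,K]$, $$\sup_{t>0}(1+t)^{\frac Nd(1-\frac1q)}\|u(t)\|_q+\sup_{t>0}(1+t)^{-\frac{\ell}{d}}|||u(t)|||_\ell<\infty .$$ Put $g(x,t)=G(x,t+1)$. Then $u(\cdot,t)$ is integrable for every $t>0$, the limit $M:=\lim_{t\to\infty}\int_{\mathbb R^N}u(x,t)\,dx$ exists, $F(x,t,u(x,t))$ is integrable on $\mathbb R^N\times(0,\infty)$, and, unless $G\equiv0$, $$M=\int_{\mathbb R^N}\varphi\,dx+\int_0^\infty\!\int_{\mathbb R^N}F(x,t,u(x,t))\,dx\,dt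 .$$ For $1\le q\le\infty$ and $0\le\ell\le K$ put $$D_{q,\ell}(t):=t^{\frac Nd(1-\frac1q)}\|u(t)-Mg(t)\|_q+t^{-\frac{\ell}{d}}|||u(t)-Mg(t)|||_\ell .$$ (i) For all $1\le q\le\infty$ and $0\le\ell\le K$, as $t\to\infty$, $$D_{q,\ell}(t)=\begin{cases} o(t^{-K/d})+O(t^{-A_p}) & \text{if } 0\le K<1 \text{ and } A_p\ne K/d,\\ O(t^{-K/d}\log t) & \text{if } 0\le K<1 \text{ and } A_p=K/d,\\ O(t^{-1/d})+O(t^{-A_p}) & \text{if } K\ge1 \text{ and } A_p\ne1/d,\\ O(t^{-1/d}\log t) & \text{if } K\ge1 \text{ and } A_p=1/d. \end{cases}$$ (ii) Let $K\ge1$ and put $f_M(x,t)=F(x,t,Mg(x,t))$. For a multi-index $\alpha$ with $|\alpha|=1$ put $$M_\alpha(f,t)=\int_{\mathbb R^N}x^\alpha f(x)\,dx-\Big(\int_{\mathbb R^N}f(x)\,dx\Big)\int_{\mathbb R^N}x^\alpha g(x,t)\,dx .$$ If $\int_0^\infty|M_\alpha(f_M(\cdot,t),t)|\,dt<\infty$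 for every $\alpha$ with $|\alpha|=1$, then for all $1\le q\le\infty$ and $0\le\ell\le K$, as $t\to\infty$, $$D_{q,\ell}(t)=O(t^{-1/d})+O(t^{-A_p}) .$$ -/

import Mathlib

open MeasureTheory Set Filter Asymptotics
open scoped ENNReal Topology

noncomputable section

namespace IntegralAsymptotics

/-- `ℝ^N` with its Euclidean norm. -/
abbrev E (N : ℕ) : Type := EuclideanSpace ℝ (Fin N)

/-- Condition (G) on an integral kernel `G = G(x,t)`, `x ∈ ℝ^N`, `t > 0`, with parameters
`γ`, `d`, `L`.  (Only the values of `G` at positive times matter.) -/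
structure KernelCondition {N : ℕ} (G : E N → ℝ → ℝ) (γ : ℕ) (d L : ℝ) : Prop where
  gamma_pos : 1 ≤ γ
  d_pos : 0 < d
  L_pos : 0 < L
  contDiff : ContDiffOn ℝ (γ : ℕ∞) (fun z : E N × ℝ => G z.1 z.2) (univ ×ˢ Ioi (0 : ℝ))
  scaling : ∀ (x : E N) (t : ℝ), 0 < t →
    G x t = t ^ (-((N : ℝ) / d)) * G ((t ^ (1 / d))⁻¹ • x) 1
  decay : ∀ j : ℕ, j ≤ γ → ∃ C : ℝ, ∀ x : E N,
    (1 + ‖x‖) ^ ((N : ℝ) + L + j) * ‖iteratedFDeriv ℝ j (fun y : E N => G y 1) x‖ ≤ C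
  semigroup : ∀ (x : E N) (s t : ℝ), 0 < s → s < t →
    G x t = ∫ y : E N, G (x - y) (t - s) * G y s

/-- The norm `|||f|||_k = ∫ |f(x)| (1 + |x|^k) dx` of `L^1(ℝ^N, (1 + |x|^k) dx)`, with values
in `[0, ∞]`. -/
def weightedNorm {N : ℕ} (k : ℝ) (f : E N → ℝ) : ℝ≥0∞ :=
  ∫⁻ x : E N, ‖f x‖ₑ * ENNReal.ofReal (1 + ‖x‖ ^ k)

/-- The exponent `(N/d) (1 - 1/q)`, where `1/∞ = 0`. -/
def lpExponent (N : ℕ) (d : ℝ) (q : ℝ≥0∞) : ℝ := (N : ℝ) / d * (1 - (q⁻¹).toReal)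

/-- `g(x,t) = G(x,t+1)`. -/
def shiftedKernel {N : ℕ} (G : E N → ℝ → ℝ) (x : E N) (t : ℝ) : ℝ := G x (t + 1)

/-- The partial derivative `∂f/∂x_i`. -/
def partialDeriv {N : ℕ} (i : Fin N) (f : E N → ℝ) : E N → ℝ :=
  fun x => fderiv ℝ f x (EuclideanSpace.single i (1 : ℝ))

/-- `∂^α f` for a multi-index `α`. -/
def multiDeriv {N : ℕ} (α : Fin N → ℕ) (f : E N → ℝ) : E N → ℝ :=
  (List.finRange N).foldr (fun i h => (partialDeriv i)^[α i] h) f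

/-- `g_α(x,t) = ((-1)^|α| / α!) ∂_x^α g(x,t)`. -/
def kernelDeriv {N : ℕ} (G : E N → ℝ → ℝ) (α : Fin N → ℕ) (x : E N) (t : ℝ) : ℝ :=
  (-1 : ℝ) ^ (∑ i, α i) / ((∏ i, (α i).factorial : ℕ) : ℝ) *
    multiDeriv α (fun y => shiftedKernel G y t) x

/-- The monomial `x^α`. -/
def monomialFun {N : ℕ} (α : Fin N → ℕ) (x : E N) : ℝ := ∏ i, x i ^ α i

/-- The modified moments `M_α(f,t)`, defined by recursion on the multi-index `α`:
`M_α(f,t) = ∫ x^α f(x) dx - ∑_{β ≤ α, β ≠ α} M_β(f,t) ∫ x^α g_β(x,t) dx`;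
for `α = 0` the sum is empty and `M_0(f,t) = ∫ f(x) dx`. -/
def modifiedMoment {N : ℕ} (G : E N → ℝ → ℝ) (f : E N → ℝ) (t : ℝ) (α : Fin N → ℕ) : ℝ :=
  (∫ x : E N, monomialFun α x * f x) -
    ∑ β ∈ (Finset.Iio α).attach,
      modifiedMoment G f t β.1 * ∫ x : E N, monomialFun α x * kernelDeriv G β.1 x t
termination_by ∑ i, α i
decreasing_by exact Fintype.sum_strictMono (Finset.mem_Iio.mp β.2)

/-- The structure conditions on the nonlinearity `F = F(x,t,v)` on `ℝ^N × (0,∞) × ℝ`: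
measurability in `(x,t)`, `F(x,t,0) = 0`, and the weighted local Lipschitz bound in `v`. -/
structure NonlinearityCondition {N : ℕ} (F : E N → ℝ → ℝ → ℝ) (Cs A p : ℝ) : Prop where
  Cs_pos : 0 < Cs
  one_le_p : 1 ≤ p
  measurable : ∀ v : ℝ, AEStronglyMeasurable (fun z : E N × ℝ => F z.1 z.2 v)
    (volume.restrict (univ ×ˢ Ioi (0 : ℝ)))
  zero : ∀ (x : E N) (t : ℝ), 0 < t → F x t 0 = 0
  lipschitz : ∀ (x : E N) (t : ℝ), 0 < t → ∀ v₁ v₂ : ℝ,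
    |F x t v₁ - F x t v₂| ≤
      Cs * (1 + t) ^ A * max (|v₁| ^ (p - 1)) (|v₂| ^ (p - 1)) * |v₁ - v₂|

/-- `u` is a global-in-time solution of
`u(x,t) = ∫ G(x-y,t) φ(y) dy + ∫_0^t ∫ G(x-y,t-s) F(y,s,u(y,s)) dy ds`:
a measurable function on `ℝ^N × (0,∞)` which satisfies the equation for every `t > 0` and almost
every `x`. -/
structure IsGlobalSolution {N : ℕ} (G : E N → ℝ → ℝ) (F : E N → ℝ → ℝ → ℝ) (φ : E N → ℝ)
    (u : E N → ℝ → ℝ) : Prop where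
  measurable : AEStronglyMeasurable (fun z : E N × ℝ => u z.1 z.2)
    (volume.restrict (univ ×ˢ Ioi (0 : ℝ)))
  equation : ∀ t : ℝ, 0 < t → ∀ᵐ x : E N,
    u x t = (∫ y : E N, G (x - y) t * φ y) +
      ∫ s in (0 : ℝ)..t, ∫ y : E N, G (x - y) (t - s) * F y s (u y s)

/-- The bound
`sup_{t>0} (1+t)^{(N/d)(1-1/q)} ‖u(t)‖_q + sup_{t>0} (1+t)^{-ℓ/d} |||u(t)|||_ℓ < ∞`
for every `q ∈ [1,∞]` and `ℓ ∈ [0,K]`. -/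
def HasDecayBound {N : ℕ} (d K : ℝ) (u : E N → ℝ → ℝ) : Prop :=
  ∀ (q : ℝ≥0∞) (ℓ : ℝ), 1 ≤ q → 0 ≤ ℓ → ℓ ≤ K →
    (⨆ t ∈ Ioi (0 : ℝ),
        ENNReal.ofReal ((1 + t) ^ lpExponent N d q) * eLpNorm (fun x => u x t) q volume) +
      (⨆ t ∈ Ioi (0 : ℝ),
        ENNReal.ofReal ((1 + t) ^ (-(ℓ / d))) * weightedNorm ℓ (fun x => u x t)) < ∞

/-- The rescaled distance
`t^{(N/d)(1-1/q)} ‖u(t) - M g(t)‖_q + t^{-ℓ/d} |||u(t) - M g(t)|||_ℓ`, with values in `[0,∞]`. -/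
def rescaledDist {N : ℕ} (G : E N → ℝ → ℝ) (d : ℝ) (u : E N → ℝ → ℝ) (M : ℝ) (q : ℝ≥0∞) (ℓ : ℝ)
    (t : ℝ) : ℝ≥0∞ :=
  ENNReal.ofReal (t ^ lpExponent N d q) *
      eLpNorm (fun x => u x t - M * shiftedKernel G x t) q volume +
    ENNReal.ofReal (t ^ (-(ℓ / d))) * weightedNorm ℓ (fun x => u x t - M * shiftedKernel G x t)

/-- `D = O(h)` as `t → ∞`, for a `[0,∞]`-valued `D` that has to be finite for all large `t`. -/
def IsBigORate (D : ℝ → ℝ≥0∞) (h : ℝ → ℝ) : Prop :=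
  (∀ᶠ t in atTop, D t < ∞) ∧ (fun t => (D t).toReal) =O[atTop] h

/-- `D = O(h₁) + O(h₂)` as `t → ∞`, with the same convention. -/
def IsBigOAddBigORate (D : ℝ → ℝ≥0∞) (h₁ h₂ : ℝ → ℝ) : Prop :=
  (∀ᶠ t in atTop, D t < ∞) ∧
    ∃ r₁ r₂ : ℝ → ℝ, r₁ =O[atTop] h₁ ∧ r₂ =O[atTop] h₂ ∧
      ∀ᶠ t in atTop, (D t).toReal = r₁ t + r₂ t

/-- `D = o(h₁) + O(h₂)` as `t → ∞`, with the same convention. -/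
def IsLittleOAddBigORate (D : ℝ → ℝ≥0∞) (h₁ h₂ : ℝ → ℝ) : Prop :=
  (∀ᶠ t in atTop, D t < ∞) ∧
    ∃ r₁ r₂ : ℝ → ℝ, r₁ =o[atTop] h₁ ∧ r₂ =O[atTop] h₂ ∧
      ∀ᶠ t in atTop, (D t).toReal = r₁ t + r₂ t

end IntegralAsymptotics

end

/-! Since `g(t) = G(t-s) * g(s)`, propagating data `φ` from time `s` to time `t` and subtracting `(∫
φ) g(t)` amounts to convolving the centred part `φ - (∫ φ) g(s)` with `G(t-s)`. The centred part has
mean zero, because the semigroup law forces `∫ G(·,t) = 1` unless `G` vanishes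
(`KernelCondition.profile_mul_eq_zero`). Hence `q(x)` may be subtracted from `q(x-y)` under the
integral, and a power of the ratio between the scale `(1+s)^(1/d)` of the data and the scale
`t^(1/d)` of the kernel is gained: for `s ≤ t/2` the error is at most `C ((1+s)/t)^(κ/d)` times the
weighted norm of `φ`, for every `κ ≤ min 1 K` (`IsSemigroupProfile.exists_scaleNorm_error_le`).

Subtracting `M g` from Duhamel's formula leaves the error of the initial data, the errors of the
source slices, and the mass emitted after time `t` times `g(t)`
(`IsSemigroupProfile.exists_profileDist_le`). The decay of `u` and the Lipschitz bound make the
source `F(·,s,u(s))` of size `(1+s)^(-A_p-1)` at scale `(1+s)^(1/d)`. Slices with `s ≥ t/2` and the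
tail therefore give `O(t^(-A_p))` without any cancellation. Slices with `s < t/2` give `t^(-κ/d)
∫_0^{t/2} (1+s)^(κ/d-A_p-1) ds`, a sum of two powers, or a logarithm when `A_p = κ/d`; here `κ = K`
if `K < 1` and `κ = 1` otherwise. For `K < 1 `, `A_p > K/d` the improvement to `o(t^(-K/d))` is
dominated convergence, since the modulus `min(r,1)(1+r^K)` is `o(r^K)` as `r → 0`.

Part (ii) only differs from (i) at resonance `A_p = 1/d`. There `F(u)` is replaced by `f_M = F(M
g)`: by the logarithmic rate already known, `F(u) - f_M` has extra decay, which makes its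
contribution `O(t^(-1/d))`. The source `f_M` inherits the moments of `G`, hence has moments of some
order `κ > 1`. A second-order Taylor expansion of the kernel then leaves a remainder without
logarithm and a first-moment term, whose size is `t^(-1/d)` times the integral of the modified
moments (`SourceRepresentation.exists_profileDist_le_of_moment`).

All estimates are made in one norm, the `L^1` norm with weight `1 + (|x|/l)^K` plus `l^N` times the
supremum, at `l = t^(1/d)`; it controls every `q` and `ℓ` (`rescaledDist_le`). `scaleNorm` takes the
true supremum of a `[0,∞]`-valued majorant, so that Tonelli needs no integrability; `profileDist`
takes the essential supremum, since the equation holds almost everywhere only. -/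

noncomputable section

namespace IntegralAsymptotics

variable {N : ℕ}

/-! ### Weighted norms at a given length scale -/

/-- The weight `1 + (|x| / l) ^ K`. -/
def scaledWeight (K l : ℝ) (x : E N) : ℝ := 1 + (l⁻¹ * ‖x‖) ^ K

/-- `∫ f(x) (1 + (|x| / l) ^ K) dx`. -/
def scaledL1 (K l : ℝ) (f : E N → ℝ≥0∞) : ℝ≥0∞ :=
  ∫⁻ x, f x * ENNReal.ofReal (scaledWeight K l x)

/-- `∫ f(x) (1 + (|x| / l) ^ K) dx + l ^ N sup f`. -/
def scaleNorm (K l : ℝ) (f : E N → ℝ≥0∞) : ℝ≥0∞ :=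
  scaledL1 K l f + ENNReal.ofReal (l ^ N) * ⨆ x, f x

lemma scaledWeight_nonneg {K l : ℝ} (hl : 0 ≤ l) (x : E N) : 0 ≤ scaledWeight K l x := by
  unfold scaledWeight; positivity

lemma one_le_scaledWeight {K l : ℝ} (hl : 0 ≤ l) (x : E N) : 1 ≤ scaledWeight K l x := by
  unfold scaledWeight
  have : 0 ≤ (l⁻¹ * ‖x‖) ^ K := by positivity
  linarith

lemma measurable_scaledWeight (K l : ℝ) : Measurable (scaledWeight K l : E N → ℝ) := by
  unfold scaledWeight; fun_prop

lemma scaledL1_mono {K l : ℝ} {f g : E N → ℝ≥0∞} (h : ∀ᵐ x, f x ≤ g x) :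
    scaledL1 K l f ≤ scaledL1 K l g :=
  lintegral_mono_ae (h.mono fun _ hx => mul_le_mul_left hx _)

lemma scaleNorm_mono {K l : ℝ} {f g : E N → ℝ≥0∞} (h : ∀ x, f x ≤ g x) :
    scaleNorm K l f ≤ scaleNorm K l g :=
  add_le_add (scaledL1_mono (.of_forall h)) (mul_le_mul_right (iSup_mono h) _)

lemma scaledL1_add {K l : ℝ} {f g : E N → ℝ≥0∞} (hf : Measurable f) :
    scaledL1 K l (fun x => f x + g x) = scaledL1 K l f + scaledL1 K l g := by
  unfold scaledL1
  simp_rw [add_mul]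
  exact lintegral_add_left (hf.mul (measurable_scaledWeight K l).ennreal_ofReal) _

lemma scaleNorm_add_le {K l : ℝ} {f g : E N → ℝ≥0∞} (hf : Measurable f) :
    scaleNorm K l (fun x => f x + g x) ≤ scaleNorm K l f + scaleNorm K l g := by
  unfold scaleNorm
  rw [scaledL1_add hf, add_add_add_comm, ← mul_add]
  gcongr
  exact iSup_le fun x => add_le_add (le_iSup f x) (le_iSup g x)

lemma scaledL1_const_mul {K l : ℝ} {f : E N → ℝ≥0∞} (c : ℝ≥0∞) (hf : Measurable f) :
    scaledL1 K l (fun x => c * f x) = c * scaledL1 K l f := by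
  unfold scaledL1
  simp_rw [mul_assoc]
  exact lintegral_const_mul _ (hf.mul (measurable_scaledWeight K l).ennreal_ofReal)

lemma scaleNorm_const_mul {K l : ℝ} {f : E N → ℝ≥0∞} (c : ℝ≥0∞) (hf : Measurable f) :
    scaleNorm K l (fun x => c * f x) = c * scaleNorm K l f := by
  unfold scaleNorm
  rw [scaledL1_const_mul c hf, mul_add, ← ENNReal.mul_iSup]
  ring

/-- Minkowski's integral inequality for `scaledL1`. -/
lemma scaledL1_lintegral {α : Type*} [MeasurableSpace α] (ν : Measure α) [SFinite ν] {K l : ℝ}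
    {f : E N → α → ℝ≥0∞} (hf : Measurable (Function.uncurry f)) :
    scaledL1 K l (fun x => ∫⁻ s, f x s ∂ν) = ∫⁻ s, scaledL1 K l (fun x => f x s) ∂ν := by
  unfold scaledL1
  have h1 : ∀ x, (∫⁻ s, f x s ∂ν) * ENNReal.ofReal (scaledWeight K l x) =
      ∫⁻ s, f x s * ENNReal.ofReal (scaledWeight K l x) ∂ν := fun x =>
    (lintegral_mul_const _ (hf.comp measurable_prodMk_left)).symm
  simp_rw [h1]
  refine lintegral_lintegral_swap (Measurable.aemeasurable ?_)
  exact hf.mul ((measurable_scaledWeight K l).ennreal_ofReal.comp measurable_fst)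

/-- Minkowski's integral inequality for `scaleNorm`. -/
lemma scaleNorm_lintegral_le {α : Type*} [MeasurableSpace α] (ν : Measure α) [SFinite ν] {K l : ℝ}
    {f : E N → α → ℝ≥0∞} (hf : Measurable (Function.uncurry f)) :
    scaleNorm K l (fun x => ∫⁻ s, f x s ∂ν) ≤ ∫⁻ s, scaleNorm K l (fun x => f x s) ∂ν := by
  have hm : Measurable fun s => scaledL1 K l (fun x => f x s) := by
    unfold scaledL1
    refine Measurable.lintegral_prod_right' (f := fun z : α × E N =>
      f z.2 z.1 * ENNReal.ofReal (scaledWeight K l z.2)) ?_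
    exact (hf.comp measurable_swap).mul
      ((measurable_scaledWeight K l).ennreal_ofReal.comp measurable_snd)
  unfold scaleNorm
  rw [lintegral_add_left hm, scaledL1_lintegral ν hf]
  gcongr
  rw [lintegral_const_mul' _ _ ENNReal.ofReal_ne_top]
  gcongr
  exact iSup_lintegral_le _

lemma lintegral_comp_inv_smul {l : ℝ} (hl : 0 < l) {f : E N → ℝ≥0∞} (hf : Measurable f) :
    ∫⁻ x, f (l⁻¹ • x) = ENNReal.ofReal (l ^ N) * ∫⁻ x, f x := by
  have h := Measure.map_addHaar_smul (volume : Measure (E N)) (inv_ne_zero hl.ne')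
  rw [← lintegral_map hf (measurable_const_smul l⁻¹), h, lintegral_smul_measure,
    finrank_euclideanSpace_fin, inv_pow, inv_inv, abs_of_nonneg (by positivity), smul_eq_mul]

lemma scaledWeight_smul (K l : ℝ) (hl : 0 < l) (x : E N) :
    scaledWeight K l x = scaledWeight K 1 (l⁻¹ • x) := by
  unfold scaledWeight
  rw [norm_smul, norm_inv, Real.norm_of_nonneg hl.le]; simp

lemma scaledL1_dilate {K l : ℝ} (hl : 0 < l) {f : E N → ℝ≥0∞} (hf : Measurable f) :
    scaledL1 K l (fun x => ENNReal.ofReal ((l ^ N)⁻¹) * f (l⁻¹ • x)) = scaledL1 K 1 f := by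
  unfold scaledL1
  simp_rw [scaledWeight_smul K l hl, mul_assoc]
  rw [lintegral_const_mul' _ _ ENNReal.ofReal_ne_top,
    lintegral_comp_inv_smul hl (f := fun x => f x * ENNReal.ofReal (scaledWeight K 1 x))
      (hf.mul (measurable_scaledWeight K 1).ennreal_ofReal), ← mul_assoc,
    ← ENNReal.ofReal_mul (by positivity), inv_mul_cancel₀ (by positivity)]
  simp

/-- The factor `l ^ N` in front of the supremum in `scaleNorm` is the one that makes both summands
invariant under mass-preserving dilation. Every kernel estimate thereby reduces to scale one. -/
lemma scaleNorm_dilate {K l : ℝ} (hl : 0 < l) {f : E N → ℝ≥0∞} (hf : Measurable f) :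
    scaleNorm K l (fun x => ENNReal.ofReal ((l ^ N)⁻¹) * f (l⁻¹ • x)) = scaleNorm K 1 f := by
  unfold scaleNorm
  rw [scaledL1_dilate hl hf, ← ENNReal.mul_iSup, ← mul_assoc,
    ← ENNReal.ofReal_mul (by positivity), mul_inv_cancel₀ (by positivity)]
  have : ⨆ x : E N, f (l⁻¹ • x) = ⨆ x, f x :=
    (Homeomorph.smulOfNeZero l⁻¹ (inv_ne_zero hl.ne')).surjective.iSup_comp f
  rw [this]; simp

lemma scaledWeight_anti {K l r : ℝ} (hK : 0 ≤ K) (hl : 0 < l) (hlr : l ≤ r) (x : E N) :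
    scaledWeight K r x ≤ scaledWeight K l x := by
  unfold scaledWeight
  have : 0 < r := hl.trans_le hlr
  gcongr

lemma scaledL1_anti {K l r : ℝ} (hK : 0 ≤ K) (hl : 0 < l) (hlr : l ≤ r) (f : E N → ℝ≥0∞) :
    scaledL1 K r f ≤ scaledL1 K l f := by
  unfold scaledL1
  gcongr
  exact scaledWeight_anti hK hl hlr _

lemma scaledL1_le_of_le {K l m c : ℝ} (hK : 0 ≤ K) (hl : 0 < l) (hm : 0 < m) (hc : 1 ≤ c)
    (hmc : m ≤ c * l) (f : E N → ℝ≥0∞) :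
    scaledL1 K l f ≤ ENNReal.ofReal (c ^ K) * scaledL1 K m f := by
  unfold scaledL1
  rw [← lintegral_const_mul' _ _ ENNReal.ofReal_ne_top]
  refine lintegral_mono fun x => ?_
  simp only
  rw [mul_left_comm, ← ENNReal.ofReal_mul (by positivity)]
  refine mul_le_mul_right (ENNReal.ofReal_le_ofReal ?_) _
  have h1 : l⁻¹ * ‖x‖ ≤ c * (m⁻¹ * ‖x‖) := by
    rw [← mul_assoc]
    gcongr
    rw [inv_le_iff_one_le_mul₀ hl, ← div_eq_mul_inv, div_mul_eq_mul_div, one_le_div hm]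
    exact hmc
  have h2 : 1 ≤ c ^ K := Real.one_le_rpow hc hK
  unfold scaledWeight
  calc 1 + (l⁻¹ * ‖x‖) ^ K ≤ c ^ K + (c * (m⁻¹ * ‖x‖)) ^ K := by gcongr
    _ = _ := by rw [Real.mul_rpow (by linarith) (by positivity)]; ring

/-- Comparison of `scaleNorm` at two comparable scales. -/
lemma scaleNorm_le_of_le {K l m c : ℝ} (hK : 0 ≤ K) (hl : 0 < l) (hm : 0 < m) (hc : 1 ≤ c)
    (hmc : m ≤ c * l) (hlc : l ≤ c * m) (f : E N → ℝ≥0∞) :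
    scaleNorm K l f ≤ ENNReal.ofReal (c ^ K * c ^ N) * scaleNorm K m f := by
  unfold scaleNorm
  have h1 : 1 ≤ c ^ N := one_le_pow₀ hc
  have h2 : 1 ≤ c ^ K := Real.one_le_rpow hc hK
  rw [mul_add, ← mul_assoc, ← ENNReal.ofReal_mul (by positivity)]
  gcongr
  · refine (scaledL1_le_of_le hK hl hm hc hmc f).trans ?_
    gcongr
    exact le_mul_of_one_le_right (by positivity) h1
  · calc l ^ N ≤ (c * m) ^ N := by gcongr
      _ = 1 * (c ^ N * m ^ N) := by rw [mul_pow, one_mul]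
      _ ≤ c ^ K * (c ^ N * m ^ N) := by gcongr
      _ = _ := by ring

lemma lintegral_le_scaledL1 {K l : ℝ} (hl : 0 ≤ l) (f : E N → ℝ≥0∞) :
    ∫⁻ x, f x ≤ scaledL1 K l f := by
  unfold scaledL1
  refine lintegral_mono fun x => le_mul_of_one_le_right (zero_le) ?_
  rw [ENNReal.one_le_ofReal]
  exact one_le_scaledWeight hl x

lemma weightedNorm_eq_scaledL1 (K : ℝ) (f : E N → ℝ) :
    weightedNorm K f = scaledL1 K 1 (fun x => ‖f x‖ₑ) := by
  simp [weightedNorm, scaledL1, scaledWeight]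


/-! ### Profiles with polynomial decay -/

/-- `|q(x)| ≤ C (1 + |x|) ^ (-r)`. -/
def PolyDecay {F : Type*} [NormedAddCommGroup F] (r : ℝ) (q : E N → F) : Prop :=
  ∃ C : ℝ, 0 ≤ C ∧ ∀ x, ‖q x‖ ≤ C * (1 + ‖x‖) ^ (-r)

lemma measurable_japanese (r : ℝ) : Measurable fun x : E N => (1 + ‖x‖) ^ (-r) := by fun_prop

/-- The weight uses up `K` of the powers, and the remaining `N + (L - K)` exceed the dimension
because `K < L`. -/
lemma exists_scaleNorm_japanese {K L : ℝ} (hK : 0 ≤ K) (hKL : K < L) :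
    ∃ B : ℝ, 0 ≤ B ∧ scaleNorm K 1
      (fun x : E N => ENNReal.ofReal ((1 + ‖x‖) ^ (-((N : ℝ) + L)))) ≤ ENNReal.ofReal B := by
  have hint : Integrable (fun x : E N => (1 + ‖x‖) ^ (-((N : ℝ) + (L - K)))) :=
    integrable_one_add_norm (by rw [finrank_euclideanSpace_fin]; linarith)
  have h1 : scaledL1 K 1 (fun x : E N => ENNReal.ofReal ((1 + ‖x‖) ^ (-((N : ℝ) + L)))) < ∞ := by
    have h2 : scaledL1 K 1 (fun x : E N => ENNReal.ofReal ((1 + ‖x‖) ^ (-((N : ℝ) + L)))) ≤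
        ∫⁻ x : E N, ENNReal.ofReal 2 * ENNReal.ofReal ((1 + ‖x‖) ^ (-((N : ℝ) + (L - K)))) := by
      unfold scaledL1
      refine lintegral_mono fun x => ?_
      simp only
      rw [← ENNReal.ofReal_mul (by positivity), ← ENNReal.ofReal_mul (by positivity)]
      apply ENNReal.ofReal_le_ofReal
      have hx : 0 < 1 + ‖x‖ := by positivity
      have h3 : scaledWeight K 1 x ≤ 2 * (1 + ‖x‖) ^ K := by
        unfold scaledWeight
        have h4 : (1 : ℝ) ≤ (1 + ‖x‖) ^ K :=
          Real.one_le_rpow (by linarith [norm_nonneg x]) hK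
        have h5 : (1⁻¹ * ‖x‖) ^ K ≤ (1 + ‖x‖) ^ K :=
          Real.rpow_le_rpow (by positivity) (by simp) hK
        linarith
      calc _ ≤ (1 + ‖x‖) ^ (-((N : ℝ) + L)) * (2 * (1 + ‖x‖) ^ K) := by gcongr
        _ = 2 * ((1 + ‖x‖) ^ (-((N : ℝ) + L)) * (1 + ‖x‖) ^ K) := by ring
        _ = _ := by rw [← Real.rpow_add hx]; congr 2; ring
    refine h2.trans_lt ?_
    rw [lintegral_const_mul' _ _ (by simp)]
    exact ENNReal.mul_lt_top (by simp) hint.lintegral_lt_top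
  have h2 : (⨆ x : E N, ENNReal.ofReal ((1 + ‖x‖) ^ (-((N : ℝ) + L)))) ≤ 1 := by
    refine iSup_le fun x => ?_
    rw [ENNReal.ofReal_le_one]
    exact Real.rpow_le_one_of_one_le_of_nonpos (by linarith [norm_nonneg x])
      (by have := Nat.cast_nonneg (α := ℝ) N; linarith)
  have h3 : scaleNorm K 1
      (fun x : E N => ENNReal.ofReal ((1 + ‖x‖) ^ (-((N : ℝ) + L)))) ≠ ∞ := by
    unfold scaleNorm
    exact (ENNReal.add_lt_top.2 ⟨h1, ENNReal.mul_lt_top ENNReal.ofReal_lt_top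
      (h2.trans_lt ENNReal.one_lt_top)⟩).ne
  exact ⟨_, ENNReal.toReal_nonneg, (ENNReal.ofReal_toReal h3).ge⟩

/-- The constant `B` depends neither on the profile nor on its target space, so the bound applies to
increments `q(x-y) - q(x)` with `C` proportional to a power of `|y|`, and to derivatives. -/
lemma exists_scaleNorm_le_of_decay {K L : ℝ} (hK : 0 ≤ K) (hKL : K < L) :
    ∃ B : ℝ, 0 ≤ B ∧ ∀ (F : Type) [NormedAddCommGroup F] (q : E N → F) (C : ℝ), 0 ≤ C →
      (∀ x, ‖q x‖ ≤ C * (1 + ‖x‖) ^ (-((N : ℝ) + L))) →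
      scaleNorm K 1 (fun x => ‖q x‖ₑ) ≤ ENNReal.ofReal (C * B) := by
  obtain ⟨B, hB, h⟩ := exists_scaleNorm_japanese (N := N) hK hKL
  refine ⟨B, hB, fun F _ q C hC hq => ?_⟩
  calc scaleNorm K 1 (fun x => ‖q x‖ₑ)
      ≤ scaleNorm K 1 (fun x : E N => ENNReal.ofReal C *
          ENNReal.ofReal ((1 + ‖x‖) ^ (-((N : ℝ) + L)))) := by
        refine scaleNorm_mono fun x => ?_
        rw [← ENNReal.ofReal_mul hC, ← ofReal_norm]
        exact ENNReal.ofReal_le_ofReal (hq x)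
    _ = ENNReal.ofReal C * scaleNorm K 1 _ :=
        scaleNorm_const_mul _ (measurable_japanese _).ennreal_ofReal
    _ ≤ _ := by rw [ENNReal.ofReal_mul hC]; gcongr

lemma PolyDecay.exists_scaleNorm_le {K L : ℝ} (hK : 0 ≤ K) (hKL : K < L) {F : Type}
    [NormedAddCommGroup F] {q : E N → F} (hq : PolyDecay (N + L) q) :
    ∃ B : ℝ, 0 ≤ B ∧ scaleNorm K 1 (fun x => ‖q x‖ₑ) ≤ ENNReal.ofReal B := by
  obtain ⟨C, hC, h⟩ := hq
  obtain ⟨B, hB, h'⟩ := exists_scaleNorm_le_of_decay (N := N) hK hKL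
  exact ⟨C * B, by positivity, h' F q C hC h⟩

/-- Submultiplicativity up to a constant, from `(a+b)^K ≤ 2^K (a^K + b^K)`; this is how the weight
passes through a translation or a convolution. -/
lemma scaledWeight_add_le {K l : ℝ} (hK : 0 ≤ K) (hl : 0 ≤ l) (x y : E N) :
    scaledWeight K l (x + y) ≤ (1 + 2 ^ K) * (scaledWeight K l x * scaledWeight K l y) := by
  unfold scaledWeight
  set a := l⁻¹ * ‖x‖
  set b := l⁻¹ * ‖y‖
  have ha : 0 ≤ a := by positivity
  have hb : 0 ≤ b := by positivity
  have h1 : l⁻¹ * ‖x + y‖ ≤ 2 * max a b := by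
    have : l⁻¹ * ‖x + y‖ ≤ a + b := by
      rw [← mul_add]; gcongr; exact norm_add_le x y
    linarith [le_max_left a b, le_max_right a b]
  have h2 : (l⁻¹ * ‖x + y‖) ^ K ≤ 2 ^ K * (a ^ K + b ^ K) := by
    calc _ ≤ (2 * max a b) ^ K := Real.rpow_le_rpow (by positivity) h1 hK
      _ = 2 ^ K * (max a b) ^ K := Real.mul_rpow (by norm_num) (by positivity)
      _ ≤ _ := by
        gcongr
        rcases max_cases a b with h | h <;> rw [h.1]
        · linarith [Real.rpow_nonneg hb K]
        · linarith [Real.rpow_nonneg ha K]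
  have hA : 0 ≤ a ^ K := by positivity
  have hB : 0 ≤ b ^ K := by positivity
  have h2K : (0 : ℝ) < 2 ^ K := by positivity
  nlinarith [mul_nonneg hA hB, mul_nonneg h2K.le (mul_nonneg hA hB)]

/-- Effect of a translation on `scaledL1`. -/
lemma scaledL1_comp_sub_le {K l : ℝ} (hK : 0 ≤ K) (hl : 0 ≤ l)
    (f : E N → ℝ≥0∞) (y : E N) :
    scaledL1 K l (fun x => f (x - y)) ≤
      ENNReal.ofReal ((1 + 2 ^ K) * scaledWeight K l y) * scaledL1 K l f := by
  unfold scaledL1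
  rw [← lintegral_add_right_eq_self
    (fun x => f (x - y) * ENNReal.ofReal (scaledWeight K l x)) y,
    ← lintegral_const_mul' _ _ ENNReal.ofReal_ne_top]
  refine lintegral_mono fun x => ?_
  simp only [add_sub_cancel_right]
  rw [mul_left_comm, ← ENNReal.ofReal_mul (by have := scaledWeight_nonneg (K := K) hl y; positivity)]
  gcongr
  refine (scaledWeight_add_le hK hl x y).trans (le_of_eq ?_)
  ring

lemma iSup_comp_sub (f : E N → ℝ≥0∞) (y : E N) : ⨆ x, f (x - y) = ⨆ x, f x :=
  (Equiv.subRight y).surjective.iSup_comp f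

lemma scaleNorm_comp_sub_le {K l : ℝ} (hK : 0 ≤ K) (hl : 0 ≤ l) (f : E N → ℝ≥0∞)
    (y : E N) :
    scaleNorm K l (fun x => f (x - y)) ≤
      ENNReal.ofReal ((1 + 2 ^ K) * scaledWeight K l y) * scaleNorm K l f := by
  unfold scaleNorm
  rw [iSup_comp_sub, mul_add]
  refine add_le_add (scaledL1_comp_sub_le hK hl f y) ?_
  · refine le_mul_of_one_le_left (zero_le) ?_
    rw [ENNReal.one_le_ofReal]
    have h1 := one_le_scaledWeight (K := K) hl y
    have h2 : (0 : ℝ) < 2 ^ K := by positivity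
    nlinarith

/-- The modulus `min(r^j, 1) (1 + r^K)`. -/
def modulus (j : ℕ) (K r : ℝ) : ℝ := min (r ^ j) 1 * (1 + r ^ K)

lemma modulus_nonneg (j : ℕ) (K : ℝ) {r : ℝ} (hr : 0 ≤ r) : 0 ≤ modulus j K r := by
  unfold modulus; positivity

/-- Brings the decay of a derivative at an intermediate point back to the base point `x`. -/
lemma japanese_le_of_mem_ball {r : ℝ} (hr : 0 ≤ r) {x z : E N} (hz : ‖z - x‖ ≤ 1) :
    (1 + ‖z‖) ^ (-r) ≤ 2 ^ r * (1 + ‖x‖) ^ (-r) := by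
  have h1 : (1 + ‖x‖) / 2 ≤ 1 + ‖z‖ := by
    have : ‖x‖ ≤ ‖z‖ + ‖z - x‖ := by
      calc ‖x‖ = ‖z - (z - x)‖ := by congr 1; abel
        _ ≤ _ := norm_sub_le _ _
    linarith [norm_nonneg z]
  calc (1 + ‖z‖) ^ (-r) ≤ ((1 + ‖x‖) / 2) ^ (-r) :=
        Real.rpow_le_rpow_of_nonpos (by positivity) h1 (by linarith)
    _ = _ := by
      rw [Real.div_rpow (by positivity) (by norm_num), Real.rpow_neg (by norm_num : (0:ℝ) ≤ 2)]
      field_simp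

lemma PolyDecay.norm_sub_le {F : Type*} [NormedAddCommGroup F] [NormedSpace ℝ F] {r C : ℝ}
    (hr : 0 ≤ r) {q : E N → F} (hq : Differentiable ℝ q) (hC : 0 ≤ C)
    (h : ∀ x, ‖fderiv ℝ q x‖ ≤ C * (1 + ‖x‖) ^ (-r)) (x y : E N) (hy : ‖y‖ ≤ 1) :
    ‖q (x - y) - q x‖ ≤ C * 2 ^ r * ‖y‖ * (1 + ‖x‖) ^ (-r) := by
  have := Convex.norm_image_sub_le_of_norm_fderiv_le (𝕜 := ℝ) (f := q)
    (s := Metric.closedBall x 1) (x := x) (y := x - y) (C := C * (2 ^ r * (1 + ‖x‖) ^ (-r)))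
    (fun z _ => hq z) (fun z hz => (h z).trans ?_) (convex_closedBall x 1) (by simp) (by simpa)
  · refine this.trans (le_of_eq ?_)
    rw [sub_sub_cancel_left, norm_neg]; ring
  · gcongr
    exact japanese_le_of_mem_ball hr (by simpa [dist_eq_norm] using hz)

/-- The mean value inequality for `q - Dq(x)` on the ball of radius `|y|`, where `Dq` itself varies
by at most `C 2^r |y| (1+|x|)^(-r)` according to the first-order estimate. -/
lemma PolyDecay.norm_taylor_le {r C : ℝ}
    (hr : 0 ≤ r) {q : E N → ℝ} (hq : Differentiable ℝ q) (hq' : Differentiable ℝ (fderiv ℝ q))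
    (hC : 0 ≤ C) (h : ∀ x, ‖fderiv ℝ (fderiv ℝ q) x‖ ≤ C * (1 + ‖x‖) ^ (-r)) (x y : E N)
    (hy : ‖y‖ ≤ 1) :
    ‖q (x - y) - q x + fderiv ℝ q x y‖ ≤ C * 2 ^ r * ‖y‖ ^ 2 * (1 + ‖x‖) ^ (-r) := by
  have := Convex.norm_image_sub_le_of_norm_fderiv_le' (𝕜 := ℝ) (f := q)
    (s := Metric.closedBall x ‖y‖) (x := x) (y := x - y) (φ := fderiv ℝ q x)
    (C := C * 2 ^ r * ‖y‖ * (1 + ‖x‖) ^ (-r))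
    (fun z _ => hq z) (fun z hz => ?_) (convex_closedBall x _) (by simp) (by simp)
  · rw [sub_sub_cancel_left, map_neg, sub_neg_eq_add, norm_neg] at this
    refine this.trans (le_of_eq ?_)
    ring
  · have hz' : ‖x - z‖ ≤ ‖y‖ := by simpa [dist_eq_norm, norm_sub_rev] using hz
    have h1 := PolyDecay.norm_sub_le hr hq' hC h x (x - z) (hz'.trans hy)
    rw [sub_sub_cancel] at h1
    refine h1.trans ?_
    gcongr

lemma exists_scaleNorm_comp_sub_le {K L : ℝ} (hK : 0 ≤ K) (hKL : K < L) {q : E N → ℝ}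
    (hq : PolyDecay (N + L) q) :
    ∃ C : ℝ, 0 ≤ C ∧ ∀ y, scaleNorm K 1 (fun x => ‖q (x - y)‖ₑ) ≤
      ENNReal.ofReal (C * (1 + ‖y‖ ^ K)) := by
  obtain ⟨B, hB, h⟩ := hq.exists_scaleNorm_le hK hKL
  refine ⟨(1 + 2 ^ K) * B, by positivity, fun y => ?_⟩
  refine (scaleNorm_comp_sub_le hK zero_le_one (fun x => ‖q x‖ₑ) y).trans ?_
  have : scaledWeight K 1 y = 1 + ‖y‖ ^ K := by simp [scaledWeight]
  rw [this, mul_right_comm (1 + 2 ^ K) B, ENNReal.ofReal_mul (q := B) (by positivity)]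
  gcongr

/-- First-order difference estimate at scale one. -/
lemma exists_scaleNorm_sub_le {K L : ℝ} (hK : 0 ≤ K) (hKL : K < L) {q : E N → ℝ}
    (hd : Differentiable ℝ q) (hq : PolyDecay (N + L) q) (hq' : PolyDecay (N + L) (fderiv ℝ q)) :
    ∃ C : ℝ, 0 ≤ C ∧ ∀ y, scaleNorm K 1 (fun x => ‖q (x - y) - q x‖ₑ) ≤
      ENNReal.ofReal (C * modulus 1 K ‖y‖) := by
  obtain ⟨C₁, hC₁, h₁⟩ := exists_scaleNorm_comp_sub_le hK hKL hq
  obtain ⟨C₀, hC₀, h₀⟩ := hq.exists_scaleNorm_le hK hKL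
  obtain ⟨B, hB, hB'⟩ := exists_scaleNorm_le_of_decay (N := N) hK hKL
  obtain ⟨C₂, hC₂, h₂⟩ := hq'
  have hL : 0 ≤ (N : ℝ) + L := by positivity [hK.trans hKL.le]
  refine ⟨C₁ + C₀ + C₂ * 2 ^ ((N : ℝ) + L) * B, by positivity, fun y => ?_⟩
  have hyK : 0 ≤ ‖y‖ ^ K := by positivity
  -- Small translations use the derivative; for large ones the triangle inequality suffices, and the
  -- translated profile costs the weight `1 + |y|^K`.
  rcases le_total ‖y‖ 1 with hy | hy
  · refine (hB' ℝ _ _ (by positivity)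
      (fun x => PolyDecay.norm_sub_le hL hd hC₂ h₂ x y hy)).trans ?_
    apply ENNReal.ofReal_le_ofReal
    have : ‖y‖ ≤ modulus 1 K ‖y‖ := by
      unfold modulus
      rw [pow_one, min_eq_left hy]
      nlinarith [norm_nonneg y]
    calc _ = (C₂ * 2 ^ ((N : ℝ) + L) * B) * ‖y‖ := by ring
      _ ≤ (C₁ + C₀ + C₂ * 2 ^ ((N : ℝ) + L) * B) * modulus 1 K ‖y‖ := by
        gcongr; linarith
  · have hm : modulus 1 K ‖y‖ = 1 + ‖y‖ ^ K := by
      unfold modulus; rw [min_eq_right (by simpa using hy), one_mul]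
    calc _ ≤ scaleNorm K 1 (fun x => ‖q (x - y)‖ₑ + ‖q x‖ₑ) :=
          scaleNorm_mono fun x => enorm_sub_le
      _ ≤ _ := scaleNorm_add_le (by have := hd.continuous.measurable; fun_prop)
      _ ≤ ENNReal.ofReal (C₁ * (1 + ‖y‖ ^ K)) + ENNReal.ofReal C₀ := add_le_add (h₁ y) h₀
      _ = ENNReal.ofReal (C₁ * (1 + ‖y‖ ^ K) + C₀) :=
          (ENNReal.ofReal_add (by positivity) hC₀).symm
      _ ≤ _ := by
        apply ENNReal.ofReal_le_ofReal
        rw [hm, add_mul, add_mul]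
        have : 0 ≤ C₂ * 2 ^ ((N : ℝ) + L) * B * (1 + ‖y‖ ^ K) := by positivity
        nlinarith [mul_nonneg hC₀ hyK]

/-- Second-order difference estimate at scale one. -/
lemma exists_scaleNorm_taylor_le {K L : ℝ} (hK : 1 ≤ K) (hKL : K < L) {q : E N → ℝ}
    (hd : Differentiable ℝ q) (hd' : Differentiable ℝ (fderiv ℝ q)) (hq : PolyDecay (N + L) q)
    (hq' : PolyDecay (N + L) (fderiv ℝ q)) (hq'' : PolyDecay (N + L) (fderiv ℝ (fderiv ℝ q))) :
    ∃ C : ℝ, 0 ≤ C ∧ ∀ y, scaleNorm K 1 (fun x => ‖q (x - y) - q x + fderiv ℝ q x y‖ₑ) ≤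
      ENNReal.ofReal (C * modulus 2 K ‖y‖) := by
  have hK0 : 0 ≤ K := by linarith
  obtain ⟨C₁, hC₁, h₁⟩ := exists_scaleNorm_comp_sub_le hK0 hKL hq
  obtain ⟨C₀, hC₀, h₀⟩ := hq.exists_scaleNorm_le hK0 hKL
  obtain ⟨C₃, hC₃, h₃⟩ := hq'.exists_scaleNorm_le hK0 hKL
  obtain ⟨B, hB, hB'⟩ := exists_scaleNorm_le_of_decay (N := N) hK0 hKL
  obtain ⟨C₂, hC₂, h₂⟩ := hq''
  have hL : 0 ≤ (N : ℝ) + L := by positivity [hK0.trans hKL.le]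
  refine ⟨C₁ + C₀ + C₃ + C₂ * 2 ^ ((N : ℝ) + L) * B, by positivity, fun y => ?_⟩
  have hyK : 0 ≤ ‖y‖ ^ K := by positivity
  rcases le_total ‖y‖ 1 with hy | hy
  · refine (hB' ℝ _ _ (by positivity)
      (fun x => PolyDecay.norm_taylor_le hL hd hd' hC₂ h₂ x y hy)).trans ?_
    apply ENNReal.ofReal_le_ofReal
    have : ‖y‖ ^ 2 ≤ modulus 2 K ‖y‖ := by
      unfold modulus
      rw [min_eq_left (pow_le_one₀ (norm_nonneg y) hy)]
      nlinarith [sq_nonneg ‖y‖]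
    calc _ = (C₂ * 2 ^ ((N : ℝ) + L) * B) * ‖y‖ ^ 2 := by ring
      _ ≤ (C₁ + C₀ + C₃ + C₂ * 2 ^ ((N : ℝ) + L) * B) * modulus 2 K ‖y‖ := by
        gcongr; linarith
  · have hm : modulus 2 K ‖y‖ = 1 + ‖y‖ ^ K := by
      unfold modulus; rw [min_eq_right (one_le_pow₀ hy), one_mul]
    -- The linear Taylor term grows like `|y|`; it fits under the weight because `K ≥ 1`.
    have hyy : ‖y‖ ≤ 1 + ‖y‖ ^ K := by
      have := Real.rpow_le_rpow_of_exponent_le hy hK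
      rw [Real.rpow_one] at this; linarith
    have m1 := hd.continuous.measurable
    have m2 := hd'.continuous.measurable
    calc _ ≤ scaleNorm K 1 (fun x => (‖q (x - y)‖ₑ + ‖q x‖ₑ) + ‖y‖ₑ * ‖fderiv ℝ q x‖ₑ) := by
          refine scaleNorm_mono fun x => (enorm_add_le _ _).trans ?_
          refine add_le_add enorm_sub_le ?_
          rw [mul_comm]
          exact ContinuousLinearMap.le_opENorm _ _
      _ ≤ _ := scaleNorm_add_le (by fun_prop)
      _ ≤ _ := add_le_add (scaleNorm_add_le (by fun_prop)) le_rfl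
      _ = scaleNorm K 1 (fun x => ‖q (x - y)‖ₑ) + scaleNorm K 1 (fun x => ‖q x‖ₑ) +
          ‖y‖ₑ * scaleNorm K 1 (fun x => ‖fderiv ℝ q x‖ₑ) := by
          rw [scaleNorm_const_mul _ m2.enorm]
      _ ≤ ENNReal.ofReal (C₁ * (1 + ‖y‖ ^ K)) + ENNReal.ofReal C₀ +
          ENNReal.ofReal ‖y‖ * ENNReal.ofReal C₃ := by
          rw [ofReal_norm]; gcongr; exact h₁ y
      _ = ENNReal.ofReal (C₁ * (1 + ‖y‖ ^ K) + C₀ + ‖y‖ * C₃) := by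
          rw [ENNReal.ofReal_add (by positivity) (by positivity),
            ENNReal.ofReal_add (by positivity) (by positivity), ENNReal.ofReal_mul (norm_nonneg y)]
      _ ≤ _ := by
        apply ENNReal.ofReal_le_ofReal
        rw [hm, add_mul, add_mul, add_mul]
        have : 0 ≤ C₂ * 2 ^ ((N : ℝ) + L) * B * (1 + ‖y‖ ^ K) := by positivity
        nlinarith [mul_nonneg hC₀ hyK, mul_le_mul_of_nonneg_right hyy hC₃]


/-! ### Dilated profiles and convolution estimates -/

/-- The profile `q` at length scale `l`, normalized to keep its integral. -/
def dilate (l : ℝ) (q : E N → ℝ) (x : E N) : ℝ := (l ^ N)⁻¹ * q (l⁻¹ • x)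

lemma enorm_dilate {l : ℝ} (hl : 0 < l) (a : ℝ) :
    ‖(l ^ N)⁻¹ * a‖ₑ = ENNReal.ofReal ((l ^ N)⁻¹) * ‖a‖ₑ := by
  rw [enorm_mul, Real.enorm_of_nonneg (by positivity)]

lemma scaleNorm_dilate_eq {K l : ℝ} (hl : 0 < l) {q : E N → ℝ} (hq : Measurable q) :
    scaleNorm K l (fun x => ‖dilate l q x‖ₑ) = scaleNorm K 1 (fun x => ‖q x‖ₑ) := by
  rw [← scaleNorm_dilate hl hq.enorm]
  simp_rw [dilate, enorm_dilate hl]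

lemma scaledL1_dilate_eq {K l : ℝ} (hl : 0 < l) {q : E N → ℝ} (hq : Measurable q) :
    scaledL1 K l (fun x => ‖dilate l q x‖ₑ) = scaledL1 K 1 (fun x => ‖q x‖ₑ) := by
  rw [← scaledL1_dilate hl hq.enorm]
  simp_rw [dilate, enorm_dilate hl]

lemma lintegral_dilate_eq {l : ℝ} (hl : 0 < l) {q : E N → ℝ} (hq : Measurable q) :
    ∫⁻ x, ‖dilate l q x‖ₑ = ∫⁻ x, ‖q x‖ₑ := by
  simp_rw [dilate, enorm_dilate hl]
  rw [lintegral_const_mul' _ _ ENNReal.ofReal_ne_top, lintegral_comp_inv_smul hl hq.enorm,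
    ← mul_assoc, ← ENNReal.ofReal_mul (by positivity), inv_mul_cancel₀ (by positivity)]
  simp

lemma scaleNorm_dilate_sub_eq {K l : ℝ} (hl : 0 < l) {q : E N → ℝ} (hq : Measurable q) (y : E N) :
    scaleNorm K l (fun x => ‖dilate l q (x - y) - dilate l q x‖ₑ) =
      scaleNorm K 1 (fun x => ‖q (x - l⁻¹ • y) - q x‖ₑ) := by
  rw [← scaleNorm_dilate hl (by fun_prop)]
  simp_rw [dilate, ← mul_sub, enorm_dilate hl, smul_sub]

lemma scaleNorm_dilate_taylor_eq {K l : ℝ} (hl : 0 < l) {q : E N → ℝ} (hq : Measurable q)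
    (y : E N) :
    scaleNorm K l (fun x => ‖dilate l q (x - y) - dilate l q x +
        (l ^ N)⁻¹ * fderiv ℝ q (l⁻¹ • x) (l⁻¹ • y)‖ₑ) =
      scaleNorm K 1 (fun x => ‖q (x - l⁻¹ • y) - q x + fderiv ℝ q x (l⁻¹ • y)‖ₑ) := by
  have := measurable_fderiv_apply_const ℝ q (l⁻¹ • y)
  rw [← scaleNorm_dilate hl (by fun_prop)]
  simp_rw [dilate, ← mul_sub, ← mul_add, enorm_dilate hl, smul_sub]

lemma continuous_dilate {q : E N → ℝ} (hq : Continuous q) (l : ℝ) : Continuous (dilate l q) := by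
  unfold dilate; fun_prop

lemma PolyDecay.exists_bound {L : ℝ} (hL : 0 ≤ L) {F : Type} [NormedAddCommGroup F] {q : E N → F}
    (hq : PolyDecay (N + L) q) : ∃ C : ℝ, 0 ≤ C ∧ ∀ x, ‖q x‖ ≤ C := by
  obtain ⟨C, hC, h⟩ := hq
  refine ⟨C, hC, fun x => (h x).trans (mul_le_of_le_one_right hC ?_)⟩
  exact Real.rpow_le_one_of_one_le_of_nonpos (by linarith [norm_nonneg x])
    (by have := Nat.cast_nonneg (α := ℝ) N; linarith)

lemma PolyDecay.exists_dilate_bound {L : ℝ} (hL : 0 ≤ L) {q : E N → ℝ}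
    (hq : PolyDecay (N + L) q) {l : ℝ} (hl : 0 < l) :
    ∃ C : ℝ, 0 ≤ C ∧ ∀ x, ‖dilate l q x‖ ≤ C := by
  obtain ⟨C, hC, h⟩ := hq.exists_bound hL
  refine ⟨(l ^ N)⁻¹ * C, by positivity, fun x => ?_⟩
  rw [dilate, norm_mul, Real.norm_of_nonneg (by positivity)]
  gcongr
  exact h _

lemma PolyDecay.integrable_dilate_mul {L : ℝ} (hL : 0 ≤ L) {q : E N → ℝ} (hc : Continuous q)
    (hq : PolyDecay (N + L) q) {l : ℝ} (hl : 0 < l) {h : E N → ℝ} (hh : Integrable h) (x : E N) :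
    Integrable fun y => dilate l q (x - y) * h y := by
  obtain ⟨C, hC, hb⟩ := hq.exists_dilate_bound hL hl
  exact hh.bdd_mul (c := C) (by have := continuous_dilate hc l; fun_prop) (.of_forall fun y => hb _)

/-- Convolution with a function of vanishing mean. -/
lemma scaleNorm_conv_le {K L : ℝ} (hK : 0 ≤ K) (hKL : K < L) {q : E N → ℝ}
    (hd : Differentiable ℝ q) (hq : PolyDecay (N + L) q) (hq' : PolyDecay (N + L) (fderiv ℝ q)) :
    ∃ C : ℝ, 0 ≤ C ∧ ∀ (l : ℝ) (h : E N → ℝ), 0 < l → Measurable h → Integrable h →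
      (∀ x, dilate l q x * ∫ y, h y = 0) →
      scaleNorm K l (fun x => ‖∫ y, dilate l q (x - y) * h y‖ₑ) ≤
        ∫⁻ y, ENNReal.ofReal (C * modulus 1 K (l⁻¹ * ‖y‖)) * ‖h y‖ₑ := by
  obtain ⟨C, hC, hdiff⟩ := exists_scaleNorm_sub_le hK hKL hd hq hq'
  refine ⟨C, hC, fun l h hl hm hi h0 => ?_⟩
  have hcq := continuous_dilate hd.continuous l
  have key : ∀ x, ‖∫ y, dilate l q (x - y) * h y‖ₑ ≤
      ∫⁻ y, ‖dilate l q (x - y) - dilate l q x‖ₑ * ‖h y‖ₑ := by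
    intro x
    -- Subtracting `dilate l q x` is free by `h0`, which covers both a vanishing mean of `h` and a
    -- vanishing kernel.
    have : ∫ y, dilate l q (x - y) * h y = ∫ y, (dilate l q (x - y) - dilate l q x) * h y := by
      simp_rw [sub_mul]
      rw [integral_sub (hq.integrable_dilate_mul (hK.trans hKL.le) hd.continuous hl hi x)
        (hi.const_mul _), integral_const_mul, h0, sub_zero]
    rw [this]
    refine (enorm_integral_le_lintegral_enorm _).trans (le_of_eq ?_)
    simp_rw [enorm_mul]
  refine (scaleNorm_mono key).trans ?_
  refine (scaleNorm_lintegral_le volume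
    (f := fun x y => ‖dilate l q (x - y) - dilate l q x‖ₑ * ‖h y‖ₑ) ?_).trans ?_
  · have := hcq.measurable
    unfold Function.uncurry
    fun_prop
  · refine lintegral_mono fun y => ?_
    have : (fun x => ‖dilate l q (x - y) - dilate l q x‖ₑ * ‖h y‖ₑ) =
      fun x => ‖h y‖ₑ * ‖dilate l q (x - y) - dilate l q x‖ₑ := by ext; rw [mul_comm]
    simp only [this]
    rw [scaleNorm_const_mul _ (by have := hcq.measurable; fun_prop), mul_comm,
      scaleNorm_dilate_sub_eq hl hd.continuous.measurable]
    gcongr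
    refine (hdiff _).trans (le_of_eq ?_)
    rw [norm_smul, norm_inv, Real.norm_of_nonneg hl.le]

/-- Convolution with a function of vanishing mean: the first moment is singled out. -/
lemma scaleNorm_conv_le_of_moment {K L : ℝ} (hK : 1 ≤ K) (hKL : K < L) {q : E N → ℝ}
    (hd : Differentiable ℝ q) (hd' : Differentiable ℝ (fderiv ℝ q)) (hq : PolyDecay (N + L) q)
    (hq' : PolyDecay (N + L) (fderiv ℝ q)) (hq'' : PolyDecay (N + L) (fderiv ℝ (fderiv ℝ q))) :
    ∃ C : ℝ, 0 ≤ C ∧ ∀ (l : ℝ) (h : E N → ℝ), 0 < l → Measurable h → Integrable h →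
      Integrable (fun y => h y • y) → (∀ x, dilate l q x * ∫ y, h y = 0) →
      scaleNorm K l (fun x => ‖∫ y, dilate l q (x - y) * h y‖ₑ) ≤
        (∫⁻ y, ENNReal.ofReal (C * modulus 2 K (l⁻¹ * ‖y‖)) * ‖h y‖ₑ) +
          ENNReal.ofReal (C * l⁻¹) * ‖∫ y, h y • y‖ₑ := by
  have hK0 : 0 ≤ K := by linarith
  obtain ⟨C₁, hC₁, hdiff⟩ := exists_scaleNorm_taylor_le hK hKL hd hd' hq hq' hq''
  obtain ⟨C₂, hC₂, hder⟩ := hq'.exists_scaleNorm_le hK0 hKL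
  refine ⟨max C₁ C₂, by positivity, fun l h hl hm hi hi' h0 => ?_⟩
  have hcq := (continuous_dilate hd.continuous l).measurable
  have hcq' := hd'.continuous
  set V := ∫ y, h y • y with hV
  have hT : ∀ x, Integrable fun y => (l ^ N)⁻¹ * fderiv ℝ q (l⁻¹ • x) (l⁻¹ • y) * h y := by
    intro x
    have := ((fderiv ℝ q (l⁻¹ • x)).integrable_comp hi').const_mul ((l ^ N)⁻¹ * l⁻¹)
    refine this.congr (.of_forall fun y => ?_)
    simp only [map_smul, smul_eq_mul]; ring
  have hTV : ∀ x, ∫ y, (l ^ N)⁻¹ * fderiv ℝ q (l⁻¹ • x) (l⁻¹ • y) * h y =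
      l⁻¹ * ((l ^ N)⁻¹ * fderiv ℝ q (l⁻¹ • x) V) := by
    intro x
    rw [hV, ← ContinuousLinearMap.integral_comp_comm _ hi', ← integral_const_mul,
      ← integral_const_mul]
    refine integral_congr_ae (.of_forall fun y => ?_)
    simp only [map_smul, smul_eq_mul]; ring
  have key : ∀ x, ‖∫ y, dilate l q (x - y) * h y‖ₑ ≤
      (∫⁻ y, ‖dilate l q (x - y) - dilate l q x +
        (l ^ N)⁻¹ * fderiv ℝ q (l⁻¹ • x) (l⁻¹ • y)‖ₑ * ‖h y‖ₑ) +
      (ENNReal.ofReal l⁻¹ * ‖V‖ₑ) *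
        (ENNReal.ofReal ((l ^ N)⁻¹) * ‖fderiv ℝ q (l⁻¹ • x)‖ₑ) := by
    intro x
    have hi1 := hq.integrable_dilate_mul (hK0.trans hKL.le) hd.continuous hl hi x
    -- Zeroth order drops out by `h0`; first order integrates to the moment `V` with one factor
    -- `l⁻¹`; the second-order remainder stays under the integral.
    have : ∫ y, dilate l q (x - y) * h y = (∫ y, (dilate l q (x - y) - dilate l q x +
        (l ^ N)⁻¹ * fderiv ℝ q (l⁻¹ • x) (l⁻¹ • y)) * h y) -
        l⁻¹ * ((l ^ N)⁻¹ * fderiv ℝ q (l⁻¹ • x) V) := by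
      have hi2 : Integrable fun y => dilate l q (x - y) * h y - dilate l q x * h y :=
        hi1.sub (hi.const_mul _)
      simp_rw [add_mul, sub_mul]
      rw [integral_add hi2 (hT x), integral_sub hi1 (hi.const_mul _),
        integral_const_mul, h0, sub_zero, hTV]
      ring
    rw [this]
    refine enorm_sub_le.trans (add_le_add ?_ ?_)
    · refine (enorm_integral_le_lintegral_enorm _).trans (le_of_eq ?_)
      simp_rw [enorm_mul]
    · rw [enorm_mul, enorm_mul, Real.enorm_of_nonneg (by positivity),
        Real.enorm_of_nonneg (by positivity)]
      calc _ ≤ ENNReal.ofReal l⁻¹ * (ENNReal.ofReal ((l ^ N)⁻¹) *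
            (‖fderiv ℝ q (l⁻¹ • x)‖ₑ * ‖V‖ₑ)) := by
            gcongr; exact ContinuousLinearMap.le_opENorm _ _
        _ = _ := by ring
  have hmeas : Measurable (Function.uncurry fun x y => ‖dilate l q (x - y) - dilate l q x +
        (l ^ N)⁻¹ * fderiv ℝ q (l⁻¹ • x) (l⁻¹ • y)‖ₑ * ‖h y‖ₑ) := by
    have h1 : Continuous fun z : E N × E N => fderiv ℝ q (l⁻¹ • z.1) (l⁻¹ • z.2) := by fun_prop
    have := h1.measurable
    unfold Function.uncurry
    fun_prop
  refine (scaleNorm_mono key).trans ((scaleNorm_add_le hmeas.lintegral_prod_right).trans ?_)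
  refine add_le_add ?_ ?_
  · refine (scaleNorm_lintegral_le volume hmeas).trans (lintegral_mono fun y => ?_)
    have : (fun x => ‖dilate l q (x - y) - dilate l q x +
        (l ^ N)⁻¹ * fderiv ℝ q (l⁻¹ • x) (l⁻¹ • y)‖ₑ * ‖h y‖ₑ) =
      fun x => ‖h y‖ₑ * ‖dilate l q (x - y) - dilate l q x +
        (l ^ N)⁻¹ * fderiv ℝ q (l⁻¹ • x) (l⁻¹ • y)‖ₑ := by ext; rw [mul_comm]
    simp only [this]
    rw [scaleNorm_const_mul _ (by fun_prop), mul_comm,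
      scaleNorm_dilate_taylor_eq hl hd.continuous.measurable]
    gcongr
    refine (hdiff _).trans (ENNReal.ofReal_le_ofReal ?_)
    rw [norm_smul, norm_inv, Real.norm_of_nonneg hl.le]
    have := modulus_nonneg 2 K (r := l⁻¹ * ‖y‖) (by positivity)
    gcongr
    exact le_max_left _ _
  · rw [scaleNorm_const_mul _ (by fun_prop), scaleNorm_dilate hl hcq'.measurable.enorm]
    calc _ ≤ ENNReal.ofReal l⁻¹ * ‖V‖ₑ * ENNReal.ofReal (max C₁ C₂) := by
          gcongr; exact hder.trans (ENNReal.ofReal_le_ofReal (le_max_right _ _))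
      _ = _ := by rw [ENNReal.ofReal_mul (by positivity)]; ring

/-- Convolution with a kernel at a smaller scale. -/
lemma scaleNorm_conv_le_of_scale_le {K L : ℝ} (hK : 0 ≤ K) (hKL : K < L) {q : E N → ℝ}
    (hc : Continuous q) (hq : PolyDecay (N + L) q) :
    ∃ C : ℝ, 0 ≤ C ∧ ∀ (r l : ℝ) (f : E N → ℝ) (S : ℝ≥0∞), 0 < r → r ≤ l → Measurable f →
      (∀ᵐ y, ‖f y‖ₑ ≤ S) →
      scaleNorm K l (fun x => ‖∫ y, dilate r q (x - y) * f y‖ₑ) ≤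
        ENNReal.ofReal C * (scaledL1 K l (fun y => ‖f y‖ₑ) + ENNReal.ofReal (l ^ N) * S) := by
  obtain ⟨B, hB, hqB⟩ := hq.exists_scaleNorm_le hK hKL
  refine ⟨(1 + 2 ^ K) * B, by positivity, fun r l f S hr hrl hf hS => ?_⟩
  have hcq := (continuous_dilate hc r).measurable
  have hl : 0 < l := hr.trans_le hrl
  have hB1 : scaledL1 K 1 (fun x => ‖q x‖ₑ) ≤ ENNReal.ofReal B := le_self_add.trans hqB
  have hBC : ENNReal.ofReal B ≤ ENNReal.ofReal ((1 + 2 ^ K) * B) := by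
    apply ENNReal.ofReal_le_ofReal
    have : (0 : ℝ) < 2 ^ K := by positivity
    nlinarith
  rw [scaleNorm, mul_add]
  refine add_le_add ?_ ?_
  · have h1 : scaledL1 K l (fun x => ‖∫ y, dilate r q (x - y) * f y‖ₑ) ≤
        scaledL1 K l (fun x => ∫⁻ y, ‖dilate r q (x - y)‖ₑ * ‖f y‖ₑ) := by
      refine scaledL1_mono (.of_forall fun x => ?_)
      refine (enorm_integral_le_lintegral_enorm _).trans (le_of_eq ?_)
      simp_rw [enorm_mul]
    refine h1.trans ?_
    rw [scaledL1_lintegral volume (f := fun x y => ‖dilate r q (x - y)‖ₑ * ‖f y‖ₑ)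
      (by unfold Function.uncurry; fun_prop)]
    rw [scaledL1, ← lintegral_const_mul' _ _ ENNReal.ofReal_ne_top]
    refine lintegral_mono fun y => ?_
    have : (fun x => ‖dilate r q (x - y)‖ₑ * ‖f y‖ₑ) =
      fun x => ‖f y‖ₑ * ‖dilate r q (x - y)‖ₑ := by ext; rw [mul_comm]
    simp only [this]
    rw [scaledL1_const_mul _ (by fun_prop)]
    have hw := scaledWeight_nonneg (K := K) hl.le y
    calc _ ≤ ‖f y‖ₑ * (ENNReal.ofReal ((1 + 2 ^ K) * scaledWeight K l y) *
          scaledL1 K l (fun x => ‖dilate r q x‖ₑ)) := by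
          gcongr; exact scaledL1_comp_sub_le hK hl.le (fun x => ‖dilate r q x‖ₑ) y
      _ ≤ ‖f y‖ₑ * (ENNReal.ofReal ((1 + 2 ^ K) * scaledWeight K l y) * ENNReal.ofReal B) := by
          gcongr
          -- The kernel has the smaller scale `r ≤ l`, so replacing the weight at scale `l` by the
          -- larger one at scale `r` makes its norm a constant.
          refine (scaledL1_anti hK hr hrl _).trans ?_
          rw [scaledL1_dilate_eq hr hc.measurable]
          exact hB1
      _ = _ := by
          rw [ENNReal.ofReal_mul (by positivity), ENNReal.ofReal_mul (by positivity)]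
          ring
  · rw [mul_left_comm]
    gcongr
    refine iSup_le fun x => (enorm_integral_le_lintegral_enorm _).trans ?_
    calc _ ≤ ∫⁻ y, ‖dilate r q (x - y)‖ₑ * S := by
          refine lintegral_mono_ae (hS.mono fun y hy => ?_)
          rw [enorm_mul]; gcongr
      _ = (∫⁻ y, ‖dilate r q (x - y)‖ₑ) * S := lintegral_mul_const _ (by fun_prop)
      _ = (∫⁻ y, ‖q y‖ₑ) * S := by
          rw [lintegral_sub_left_eq_self (fun y => ‖dilate r q y‖ₑ) x,
            lintegral_dilate_eq hr hc.measurable]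
      _ ≤ _ := by
          gcongr
          exact (lintegral_le_scaledL1 zero_le_one _).trans (hB1.trans hBC)

/-- Extracts the rate `a ^ κ`, with `κ` limited by the order `j` of the difference and by the number
`K'` of moments. If `a r ≤ 1`, the modulus is at most `2 (a r)^j ≤ 2 (a r)^κ`; otherwise it is at
most `2 (a r)^K'`, and the surplus `a^(K'-κ)` is bounded by `Λ^(K'-κ)`. The order `K` belongs to the
norm of the result, `K' ≥ K` to that of the data. -/
lemma modulus_mul_le {j : ℕ} {K K' κ a Λ r : ℝ} (hK : 0 ≤ K) (hKK' : K ≤ K') (hκ : 0 ≤ κ)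
    (hκj : κ ≤ j) (hκK : κ ≤ K') (ha : 0 < a) (haΛ : a ≤ Λ) (hr : 0 ≤ r) :
    modulus j K (a * r) ≤ (2 + 2 * Λ ^ (K' - κ)) * a ^ κ * (1 + r ^ K') := by
  have hΛ : 0 < Λ := ha.trans_le haΛ
  have hrK : 0 ≤ r ^ K' := by positivity
  have h1 : r ^ κ ≤ 1 + r ^ K' := by
    rcases le_total r 1 with h | h
    · exact (Real.rpow_le_one hr h hκ).trans (by linarith)
    · exact (Real.rpow_le_rpow_of_exponent_le h hκK).trans (by linarith)
  have haκ : 0 < a ^ κ := by positivity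
  have hΛκ : 0 < Λ ^ (K' - κ) := by positivity
  rcases le_total (a * r) 1 with h | h
  · have h2 : (a * r) ^ j ≤ a ^ κ * r ^ κ := by
      rw [← Real.mul_rpow ha.le hr]
      rcases eq_or_lt_of_le (show 0 ≤ a * r by positivity) with h0 | h0
      · rcases eq_or_lt_of_le hκ with hk | hk
        · rw [← hk, Real.rpow_zero]; exact pow_le_one₀ (by positivity) h
        · have : j ≠ 0 := by rintro rfl; exact absurd hκj (by simpa using hk)
          rw [← h0, zero_pow this, Real.zero_rpow hk.ne']
      · rw [← Real.rpow_natCast]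
        exact Real.rpow_le_rpow_of_exponent_ge h0 h hκj
    have h3 : (a * r) ^ K ≤ 1 := Real.rpow_le_one (by positivity) h hK
    have h5 : 0 ≤ (a * r) ^ K := by positivity
    have h6 : 0 ≤ (a * r) ^ j := by positivity
    calc modulus j K (a * r) ≤ (a * r) ^ j * (1 + 1) := by
          unfold modulus; gcongr; exact min_le_left _ _
      _ ≤ (a ^ κ * r ^ κ) * 2 := by rw [one_add_one_eq_two]; gcongr
      _ ≤ (a ^ κ * (1 + r ^ K')) * 2 := by gcongr
      _ ≤ _ := by
        have : 0 ≤ Λ ^ (K' - κ) * (a ^ κ * (1 + r ^ K')) := by positivity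
        nlinarith
  · have h2 : (a * r) ^ K ≤ (a * r) ^ K' := Real.rpow_le_rpow_of_exponent_le h hKK'
    have h3 : 1 ≤ (a * r) ^ K' := Real.one_le_rpow h (hK.trans hKK')
    have h4 : (a * r) ^ K' ≤ Λ ^ (K' - κ) * a ^ κ * r ^ K' := by
      rw [Real.mul_rpow ha.le hr]
      gcongr
      calc a ^ K' = a ^ (K' - κ) * a ^ κ := by rw [← Real.rpow_add ha]; congr 1; ring
        _ ≤ _ := by gcongr
    have h6 : 0 ≤ (a * r) ^ K := by positivity
    calc modulus j K (a * r) ≤ 1 * (1 + (a * r) ^ K) := by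
          unfold modulus; gcongr; exact min_le_right _ _
      _ ≤ 2 * (Λ ^ (K' - κ) * a ^ κ * r ^ K') := by linarith
      _ ≤ _ := by
        have : 0 ≤ Λ ^ (K' - κ) * a ^ κ := by positivity
        have : 0 ≤ a ^ κ * r ^ K' := by positivity
        nlinarith

/-- Here `l` is the scale of the kernel and `m` that of the data, so the gain is a power of `m / l`.
-/
lemma lintegral_modulus_le {j : ℕ} {K K' κ Λ C : ℝ} (hC : 0 ≤ C) (hK : 0 ≤ K) (hKK' : K ≤ K')
    (hκ : 0 ≤ κ) (hκj : κ ≤ j) (hκK : κ ≤ K') {l m : ℝ} (hl : 0 < l) (hm : 0 < m)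
    (hml : m / l ≤ Λ) (h : E N → ℝ) :
    ∫⁻ y, ENNReal.ofReal (C * modulus j K (l⁻¹ * ‖y‖)) * ‖h y‖ₑ ≤
      ENNReal.ofReal (C * (2 + 2 * Λ ^ (K' - κ)) * (m / l) ^ κ) *
        scaledL1 K' m (fun y => ‖h y‖ₑ) := by
  have hΛ : 0 < Λ := (div_pos hm hl).trans_le hml
  unfold scaledL1
  rw [← lintegral_const_mul' _ _ ENNReal.ofReal_ne_top]
  refine lintegral_mono fun y => ?_
  simp only
  rw [mul_left_comm, mul_comm, ← ENNReal.ofReal_mul (by positivity)]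
  refine mul_le_mul_right (ENNReal.ofReal_le_ofReal ?_) _
  have h1 : l⁻¹ * ‖y‖ = m / l * (m⁻¹ * ‖y‖) := by field_simp
  rw [h1, scaledWeight, mul_assoc, mul_assoc, ← mul_assoc (2 + _)]
  gcongr
  exact modulus_mul_le hK hKK' hκ hκj hκK (by positivity) hml (by positivity)


/-! ### Self-similar kernels -/

/-- The self-similar kernel `t ^ (-N/d) q(t ^ (-1/d) x)` with profile `q`. -/
def selfSimilar (d : ℝ) (q : E N → ℝ) (x : E N) (t : ℝ) : ℝ := dilate (t ^ (1 / d)) q x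

/-- A profile that generates a self-similar convolution semigroup; the kernel is normalized
unless it vanishes. -/
structure IsSemigroupProfile (d L : ℝ) (q : E N → ℝ) : Prop where
  d_pos : 0 < d
  differentiable : Differentiable ℝ q
  decay : PolyDecay (N + L) q
  decay_fderiv : PolyDecay (N + L) (fderiv ℝ q)
  semigroup : ∀ (x : E N) (s t : ℝ), 0 < s → s < t →
    selfSimilar d q x t = ∫ y, selfSimilar d q (x - y) (t - s) * selfSimilar d q y s
  normalized : ∀ (x : E N) (t : ℝ), 0 < t → selfSimilar d q x t * (1 - ∫ y, q y) = 0

/-- The difference between `∫ G(x-y,t-s) φ(y) dy` and `(∫ φ) G(x,t+1)`. -/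
def propagationError (d : ℝ) (q φ : E N → ℝ) (s t : ℝ) (x : E N) : ℝ :=
  (∫ y, selfSimilar d q (x - y) (t - s) * φ y) - (∫ y, φ y) * selfSimilar d q x (t + 1)

/-- The centred part `φ - (∫ φ) G(·,s+1)`. -/
def centred (d : ℝ) (q φ : E N → ℝ) (s : ℝ) (y : E N) : ℝ :=
  φ y - (∫ z, φ z) * selfSimilar d q y (s + 1)

/-- The modulus of the first difference integrated against the centred part. -/
def modulusIntegral (d K : ℝ) (q φ : E N → ℝ) (s t : ℝ) : ℝ≥0∞ :=
  ∫⁻ y, ENNReal.ofReal (modulus 1 K (((t - s) ^ (1 / d))⁻¹ * ‖y‖)) * ‖centred d q φ s y‖ₑ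

lemma measurable_selfSimilar {q : E N → ℝ} (d : ℝ) (hq : Measurable q) :
    Measurable fun z : E N × ℝ => selfSimilar d q z.1 z.2 := by
  unfold selfSimilar dilate; fun_prop

lemma integrable_of_scaledL1 {K l : ℝ} (hl : 0 ≤ l) {h : E N → ℝ} (hm : Measurable h)
    (hf : scaledL1 K l (fun x => ‖h x‖ₑ) < ∞) : Integrable h :=
  ⟨hm.aestronglyMeasurable, (lintegral_le_scaledL1 hl _).trans_lt hf⟩

lemma integrable_smul_of_scaledL1 {K l : ℝ} (hK : 1 ≤ K) (hl : 0 < l) {h : E N → ℝ}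
    (hm : Measurable h) (hf : scaledL1 K l (fun x => ‖h x‖ₑ) < ∞) :
    Integrable (fun y => h y • y) := by
  refine ⟨(hm.smul measurable_id).aestronglyMeasurable, ?_⟩
  have h3 : ∫⁻ y, ‖h y • y‖ₑ ≤ ENNReal.ofReal l * scaledL1 K l (fun y => ‖h y‖ₑ) := by
    unfold scaledL1
    rw [← lintegral_const_mul' _ _ ENNReal.ofReal_ne_top]
    refine lintegral_mono fun y => ?_
    simp only
    rw [enorm_smul, mul_left_comm, ← ENNReal.ofReal_mul hl.le, ← ofReal_norm y]
    gcongr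
    unfold scaledWeight
    have h4 : l⁻¹ * ‖y‖ ≤ 1 + (l⁻¹ * ‖y‖) ^ K := by
      have h5 : 0 ≤ l⁻¹ * ‖y‖ := by positivity
      rcases le_total (l⁻¹ * ‖y‖) 1 with h | h
      · have := Real.rpow_nonneg h5 K
        linarith
      · have := Real.rpow_le_rpow_of_exponent_le h hK
        rw [Real.rpow_one] at this
        linarith
    calc ‖y‖ = l * (l⁻¹ * ‖y‖) := by field_simp
      _ ≤ _ := by gcongr
  exact h3.trans_lt (ENNReal.mul_lt_top ENNReal.ofReal_lt_top hf)

lemma integral_dilate {l : ℝ} (hl : 0 < l) (q : E N → ℝ) : ∫ x, dilate l q x = ∫ x, q x := by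
  unfold dilate
  rw [integral_const_mul, Measure.integral_comp_inv_smul_of_nonneg _ q hl.le,
    finrank_euclideanSpace_fin, smul_eq_mul, ← mul_assoc, inv_mul_cancel₀ (by positivity), one_mul]

lemma rpow_inv_mul_comparable {d a b c : ℝ} (hd : 0 < d) (ha : 0 < a) (hb : 0 ≤ b) (h : b ≤ c * a)
    (hc : 0 ≤ c) : b ^ (1 / d) ≤ c ^ (1 / d) * a ^ (1 / d) := by
  rw [← Real.mul_rpow hc ha.le]
  gcongr

namespace IsSemigroupProfile

variable {d L : ℝ} {q : E N → ℝ}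

lemma measurable (hq : IsSemigroupProfile d L q) : Measurable q :=
  hq.differentiable.continuous.measurable

lemma integrable (hq : IsSemigroupProfile d L q) (hL : 0 < L) : Integrable q := by
  obtain ⟨B, hB, h⟩ := hq.decay.exists_scaleNorm_le le_rfl hL
  exact integrable_of_scaledL1 zero_le_one hq.measurable
    ((le_self_add.trans h).trans_lt ENNReal.ofReal_lt_top)

lemma integrable_selfSimilar (hq : IsSemigroupProfile d L q) (hL : 0 < L) {t : ℝ} (ht : 0 < t) :
    Integrable fun x => selfSimilar d q x t :=
  ((hq.integrable hL).comp_smul (inv_ne_zero (by positivity : t ^ (1 / d) ≠ 0))).const_mul _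

lemma integral_selfSimilar {t : ℝ} (ht : 0 < t) : ∫ x, selfSimilar d q x t = ∫ x, q x :=
  integral_dilate (by positivity) q

/-- The semigroup law between the times `s + 1` and `t + 1` has increment `t - s`, so `g(t)` is the
propagation of `g(s)` by the same kernel that acts on `φ`. -/
lemma propagationError_eq (hq : IsSemigroupProfile d L q) (hL : 0 < L) {φ : E N → ℝ}
    (hφ : Integrable φ) {s t : ℝ} (hs : 0 ≤ s) (hst : s < t) (x : E N) :
    propagationError d q φ s t x = ∫ y, dilate ((t - s) ^ (1 / d)) q (x - y) * centred d q φ s y := by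
  have hr : 0 < (t - s) ^ (1 / d) := by have := sub_pos.2 hst; positivity
  unfold propagationError centred
  simp_rw [mul_sub]
  rw [integral_sub (hq.decay.integrable_dilate_mul hL.le hq.differentiable.continuous hr hφ x)
    (hq.decay.integrable_dilate_mul hL.le hq.differentiable.continuous hr
      ((hq.integrable_selfSimilar hL (by linarith)).const_mul _) x)]
  have := hq.semigroup x (s + 1) (t + 1) (by linarith) (by linarith)
  rw [this, add_sub_add_right_eq_sub]
  simp_rw [mul_left_comm _ (∫ z, φ z)]
  rw [integral_const_mul]
  rfl

lemma integrable_centred (hq : IsSemigroupProfile d L q) (hL : 0 < L) {φ : E N → ℝ}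
    (hφ : Integrable φ) {s : ℝ} (hs : 0 ≤ s) : Integrable (centred d q φ s) :=
  hφ.sub ((hq.integrable_selfSimilar hL (by linarith)).const_mul _)

lemma measurable_centred (hq : IsSemigroupProfile d L q) {φ : E N → ℝ} (hφ : Measurable φ)
    (s : ℝ) : Measurable (centred d q φ s) := by
  have := (measurable_selfSimilar d hq.measurable).comp
    (measurable_prodMk_right (y := s + 1) : Measurable fun x : E N => (x, s + 1))
  exact hφ.sub (this.const_mul _)

/-- The mean of the centred part is `(∫ φ)(1 - ∫ q)`. The factor `1 - ∫ q` is annihilated by the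
kernel, without distinguishing a normalized kernel from a vanishing one. -/
lemma integral_centred (hq : IsSemigroupProfile d L q) (hL : 0 < L) {φ : E N → ℝ}
    (hφ : Integrable φ) {s r : ℝ} (hs : 0 ≤ s) (hr : 0 < r) (x : E N) :
    dilate (r ^ (1 / d)) q x * ∫ y, centred d q φ s y = 0 := by
  unfold centred
  rw [integral_sub hφ ((hq.integrable_selfSimilar hL (by linarith)).const_mul _),
    integral_const_mul, integral_selfSimilar (by linarith), ← mul_one_sub, mul_left_comm]
  have := hq.normalized x r hr
  rw [selfSimilar] at this
  rw [this, mul_zero]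

/-- The subtracted `g(s)` lives at scale `(1+s)^(1/d)`, so its norm at that scale does not depend on
`s`. -/
lemma exists_scaledL1_centred_le (hq : IsSemigroupProfile d L q) {K : ℝ} (hK : 0 ≤ K)
    (hKL : K < L) : ∃ C : ℝ, 0 ≤ C ∧ ∀ (s : ℝ) (φ : E N → ℝ), 0 ≤ s → Measurable φ →
      scaledL1 K ((1 + s) ^ (1 / d)) (fun y => ‖centred d q φ s y‖ₑ) ≤
        ENNReal.ofReal C * scaledL1 K ((1 + s) ^ (1 / d)) (fun y => ‖φ y‖ₑ) := by
  obtain ⟨B, hB, hqB⟩ := hq.decay.exists_scaleNorm_le hK hKL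
  refine ⟨1 + B, by positivity, fun s φ hs hφ => ?_⟩
  have hm : 0 < (1 + s) ^ (1 / d) := by positivity
  have hqm := (continuous_dilate hq.differentiable.continuous ((1 + s) ^ (1 / d))).measurable
  have h1 : ‖∫ z, φ z‖ₑ ≤ scaledL1 K ((1 + s) ^ (1 / d)) (fun y => ‖φ y‖ₑ) :=
    (enorm_integral_le_lintegral_enorm _).trans (lintegral_le_scaledL1 hm.le _)
  calc _ ≤ scaledL1 K ((1 + s) ^ (1 / d)) (fun y => ‖φ y‖ₑ +
          ‖∫ z, φ z‖ₑ * ‖dilate ((1 + s) ^ (1 / d)) q y‖ₑ) := by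
        refine scaledL1_mono (.of_forall fun y => ?_)
        unfold centred selfSimilar
        rw [add_comm s 1, ← enorm_mul]
        exact enorm_sub_le
    _ = scaledL1 K ((1 + s) ^ (1 / d)) (fun y => ‖φ y‖ₑ) +
          ‖∫ z, φ z‖ₑ * scaledL1 K 1 (fun y => ‖q y‖ₑ) := by
        rw [scaledL1_add hφ.enorm, scaledL1_const_mul _ hqm.enorm,
          scaledL1_dilate_eq hm hq.measurable]
    _ ≤ scaledL1 K ((1 + s) ^ (1 / d)) (fun y => ‖φ y‖ₑ) +
          scaledL1 K ((1 + s) ^ (1 / d)) (fun y => ‖φ y‖ₑ) * ENNReal.ofReal B := by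
        gcongr
        exact le_self_add.trans hqB
    _ = _ := by rw [ENNReal.ofReal_add zero_le_one hB, ENNReal.ofReal_one]; ring

lemma scaleNorm_le_of_half {K : ℝ} (hd : 0 < d) (hK : 0 ≤ K) {s t : ℝ} (hs : 0 ≤ s)
    (hst : s ≤ t / 2) (ht : 0 < t) (f : E N → ℝ≥0∞) :
    scaleNorm K (t ^ (1 / d)) f ≤ ENNReal.ofReal ((2 ^ (1 / d)) ^ K * (2 ^ (1 / d)) ^ N) *
      scaleNorm K ((t - s) ^ (1 / d)) f := by
  have hts : 0 < t - s := by linarith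
  refine scaleNorm_le_of_le hK (by positivity) (by positivity)
    (Real.one_le_rpow (by norm_num) (by positivity)) ?_ ?_ f
  · exact rpow_inv_mul_comparable hd ht hts.le (by linarith) (by norm_num)
  · exact rpow_inv_mul_comparable hd hts ht.le (by linarith) (by norm_num)

/-- The constant `3`: for `s ≤ t/2` and `t ≥ 1` one has `1 + s ≤ 3t/2 ≤ 3 (t - s)`. -/
lemma div_rpow_le (hd : 0 < d) {s t : ℝ} (hs : 0 ≤ s) (hst : s ≤ t / 2) (ht : 1 ≤ t) :
    (1 + s) ^ (1 / d) / (t - s) ^ (1 / d) ≤ 3 ^ (1 / d) := by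
  have hts : 0 < t - s := by linarith
  rw [← Real.div_rpow (by positivity) hts.le]
  gcongr
  rw [div_le_iff₀ hts]; linarith

lemma div_rpow_rpow_le (hd : 0 < d) {s t κ : ℝ} (hκ : 0 ≤ κ) (hs : 0 ≤ s) (hst : s ≤ t / 2)
    (ht : 1 ≤ t) :
    ((1 + s) ^ (1 / d) / (t - s) ^ (1 / d)) ^ κ ≤ 2 ^ (κ / d) * ((1 + s) / t) ^ (κ / d) := by
  have hts : 0 < t - s := by linarith
  rw [← Real.div_rpow (by positivity) hts.le, ← Real.rpow_mul (by positivity),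
    ← Real.mul_rpow (by norm_num) (by positivity), one_div_mul_eq_div]
  gcongr
  rw [← mul_div_assoc, div_le_div_iff₀ hts (by linarith)]
  nlinarith

/-- The propagation error in terms of the centred part. -/
lemma exists_scaleNorm_error_le_modulusIntegral (hq : IsSemigroupProfile d L q) {K : ℝ}
    (hK : 0 ≤ K) (hKL : K < L) :
    ∃ C : ℝ, 0 ≤ C ∧ ∀ (s t : ℝ) (φ : E N → ℝ), 0 ≤ s → s ≤ t / 2 → 0 < t → Measurable φ →
      Integrable φ → scaleNorm K (t ^ (1 / d)) (fun x => ‖propagationError d q φ s t x‖ₑ) ≤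
        ENNReal.ofReal C * modulusIntegral d K q φ s t := by
  have hL : 0 < L := hK.trans_lt hKL
  have hd := hq.d_pos
  obtain ⟨C₁, hC₁, h₁⟩ := scaleNorm_conv_le hK hKL hq.differentiable hq.decay hq.decay_fderiv
  set A : ℝ := (2 ^ (1 / d)) ^ K * (2 ^ (1 / d)) ^ N
  refine ⟨A * C₁, by positivity, fun s t φ hs hst ht0 hm hi => ?_⟩
  have hts : 0 < t - s := by linarith
  simp_rw [hq.propagationError_eq hL hi hs (by linarith : s < t)]
  calc _ ≤ ENNReal.ofReal A * scaleNorm K ((t - s) ^ (1 / d))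
          (fun x => ‖∫ y, dilate ((t - s) ^ (1 / d)) q (x - y) * centred d q φ s y‖ₑ) :=
        scaleNorm_le_of_half hd hK hs hst ht0 _
    _ ≤ ENNReal.ofReal A * ∫⁻ y, ENNReal.ofReal
          (C₁ * modulus 1 K (((t - s) ^ (1 / d))⁻¹ * ‖y‖)) * ‖centred d q φ s y‖ₑ := by
        gcongr
        exact h₁ _ _ (by positivity) (hq.measurable_centred hm s)
          (hq.integrable_centred hL hi hs) (hq.integral_centred hL hi hs hts)
    _ = _ := by
        simp_rw [ENNReal.ofReal_mul hC₁, mul_assoc]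
        rw [lintegral_const_mul' _ _ ENNReal.ofReal_ne_top, ← mul_assoc,
          ← ENNReal.ofReal_mul (by positivity)]
        rfl

/-- The data scale is `(1+s)^(1/d)` and the kernel scale `(t-s)^(1/d)` is comparable with `t^(1/d)`;
the `κ`-th power of their ratio is the rate. -/
lemma exists_modulusIntegral_le (hq : IsSemigroupProfile d L q) {K κ : ℝ} (hK : 0 ≤ K)
    (hKL : K < L) (hκ : 0 ≤ κ) (hκ1 : κ ≤ 1) (hκK : κ ≤ K) :
    ∃ C : ℝ, 0 ≤ C ∧ ∀ (s t : ℝ) (φ : E N → ℝ), 0 ≤ s → s ≤ t / 2 → 1 ≤ t → Measurable φ →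
      modulusIntegral d K q φ s t ≤ ENNReal.ofReal (C * ((1 + s) / t) ^ (κ / d)) *
        scaledL1 K ((1 + s) ^ (1 / d)) (fun y => ‖φ y‖ₑ) := by
  have hd := hq.d_pos
  obtain ⟨C₂, hC₂, h₂⟩ := hq.exists_scaledL1_centred_le hK hKL
  set D : ℝ := 1 * (2 + 2 * (3 ^ (1 / d)) ^ (K - κ))
  refine ⟨D * 2 ^ (κ / d) * C₂, by positivity, fun s t φ hs hst ht hm => ?_⟩
  have hts : 0 < t - s := by linarith
  have ht0 : 0 < t := by linarith
  have h3 := lintegral_modulus_le (j := 1) zero_le_one hK le_rfl hκ (by simpa using hκ1) hκK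
    (by positivity) (by positivity) (div_rpow_le hd hs hst ht) (centred d q φ s)
  simp_rw [one_mul (modulus _ _ _)] at h3
  calc modulusIntegral d K q φ s t ≤ _ := h3
    _ ≤ ENNReal.ofReal (D * (2 ^ (κ / d) * ((1 + s) / t) ^ (κ / d))) *
          (ENNReal.ofReal C₂ * scaledL1 K ((1 + s) ^ (1 / d)) (fun y => ‖φ y‖ₑ)) := by
        gcongr
        · exact div_rpow_rpow_le hd hκ hs hst ht
        · exact h₂ s φ hs hm
    _ = _ := by
        rw [← mul_assoc, ← ENNReal.ofReal_mul (by positivity)]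
        congr 2; ring

/-- Decay of the propagation error for data with moments of order `K`. -/
lemma exists_scaleNorm_error_le (hq : IsSemigroupProfile d L q) {K κ : ℝ} (hK : 0 ≤ K)
    (hKL : K < L) (hκ : 0 ≤ κ) (hκ1 : κ ≤ 1) (hκK : κ ≤ K) :
    ∃ C : ℝ, 0 ≤ C ∧ ∀ (s t : ℝ) (φ : E N → ℝ), 0 ≤ s → s ≤ t / 2 → 1 ≤ t → Measurable φ →
      Integrable φ → scaleNorm K (t ^ (1 / d)) (fun x => ‖propagationError d q φ s t x‖ₑ) ≤
        ENNReal.ofReal (C * ((1 + s) / t) ^ (κ / d)) *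
          scaledL1 K ((1 + s) ^ (1 / d)) (fun y => ‖φ y‖ₑ) := by
  obtain ⟨C₁, hC₁, h₁⟩ := hq.exists_scaleNorm_error_le_modulusIntegral hK hKL
  obtain ⟨C₂, hC₂, h₂⟩ := hq.exists_modulusIntegral_le hK hKL hκ hκ1 hκK
  refine ⟨C₁ * C₂, by positivity, fun s t φ hs hst ht hm hi => ?_⟩
  refine (h₁ s t φ hs hst (by linarith) hm hi).trans ?_
  rw [mul_assoc, ENNReal.ofReal_mul hC₁, mul_assoc]
  gcongr
  exact h₂ s t φ hs hst ht hm

/-- Decay of the propagation error with the first moment of the centred part singled out. -/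
lemma exists_scaleNorm_error_le_of_moment (hq : IsSemigroupProfile d L q)
    (hq2 : Differentiable ℝ (fderiv ℝ q)) (hq2' : PolyDecay (N + L) (fderiv ℝ (fderiv ℝ q)))
    {K K' κ : ℝ} (hK : 1 ≤ K) (hKK' : K ≤ K') (hKL : K' < L) (hκ : 0 ≤ κ) (hκ1 : κ ≤ 2)
    (hκK : κ ≤ K') :
    ∃ C : ℝ, 0 ≤ C ∧ ∀ (s t : ℝ) (φ : E N → ℝ), 0 ≤ s → s ≤ t / 2 → 1 ≤ t → Measurable φ →
      scaledL1 K' ((1 + s) ^ (1 / d)) (fun y => ‖φ y‖ₑ) < ∞ →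
      scaleNorm K (t ^ (1 / d)) (fun x => ‖propagationError d q φ s t x‖ₑ) ≤
        ENNReal.ofReal (C * ((1 + s) / t) ^ (κ / d)) *
          scaledL1 K' ((1 + s) ^ (1 / d)) (fun y => ‖φ y‖ₑ) +
        ENNReal.ofReal (C * t ^ (-(1 / d))) * ‖∫ y, centred d q φ s y • y‖ₑ := by
  have hK0 : 0 ≤ K := by linarith
  have hL : 0 < L := by linarith
  have hd := hq.d_pos
  obtain ⟨C₁, hC₁, h₁⟩ := scaleNorm_conv_le_of_moment hK (hKK'.trans_lt hKL) hq.differentiable hq2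
    hq.decay hq.decay_fderiv hq2'
  obtain ⟨C₂, hC₂, h₂⟩ := hq.exists_scaledL1_centred_le (hK0.trans hKK') hKL
  set A : ℝ := (2 ^ (1 / d)) ^ K * (2 ^ (1 / d)) ^ N
  set D : ℝ := C₁ * (2 + 2 * (3 ^ (1 / d)) ^ (K' - κ))
  refine ⟨max (A * (D * 2 ^ (κ / d)) * C₂) (A * C₁ * 2 ^ (1 / d)), by positivity,
    fun s t φ hs hst ht hm hfin => ?_⟩
  have hts : 0 < t - s := by linarith
  have ht0 : 0 < t := by linarith
  have hm0 : 0 < (1 + s) ^ (1 / d) := by positivity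
  have hi : Integrable φ := integrable_of_scaledL1 hm0.le hm hfin
  have hcm := hq.measurable_centred hm s
  have hci : Integrable (fun y => centred d q φ s y • y) :=
    integrable_smul_of_scaledL1 (hK.trans hKK') hm0 hcm
      ((h₂ s φ hs hm).trans_lt (ENNReal.mul_lt_top ENNReal.ofReal_lt_top hfin))
  simp_rw [hq.propagationError_eq hL hi hs (by linarith : s < t)]
  calc _ ≤ ENNReal.ofReal A * scaleNorm K ((t - s) ^ (1 / d))
          (fun x => ‖∫ y, dilate ((t - s) ^ (1 / d)) q (x - y) * centred d q φ s y‖ₑ) :=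
        scaleNorm_le_of_half hd hK0 hs hst ht0 _
    _ ≤ ENNReal.ofReal A * (ENNReal.ofReal (D * ((1 + s) ^ (1 / d) / (t - s) ^ (1 / d)) ^ κ) *
          scaledL1 K' ((1 + s) ^ (1 / d)) (fun y => ‖centred d q φ s y‖ₑ) +
          ENNReal.ofReal (C₁ * ((t - s) ^ (1 / d))⁻¹) * ‖∫ y, centred d q φ s y • y‖ₑ) := by
        gcongr
        refine (h₁ _ _ (by positivity) hcm
          (hq.integrable_centred hL hi hs) hci (hq.integral_centred hL hi hs hts)).trans ?_
        gcongr
        exact lintegral_modulus_le hC₁ hK0 hKK' hκ (by simpa using hκ1) hκK (by positivity)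
          (by positivity) (div_rpow_le hd hs hst ht) _
    _ ≤ ENNReal.ofReal A * (ENNReal.ofReal (D * (2 ^ (κ / d) * ((1 + s) / t) ^ (κ / d))) *
          (ENNReal.ofReal C₂ * scaledL1 K' ((1 + s) ^ (1 / d)) (fun y => ‖φ y‖ₑ)) +
          ENNReal.ofReal (C₁ * (2 ^ (1 / d) * t ^ (-(1 / d)))) *
            ‖∫ y, centred d q φ s y • y‖ₑ) := by
        gcongr
        · exact div_rpow_rpow_le hd hκ hs hst ht
        · exact h₂ s φ hs hm
        · rw [Real.rpow_neg ht0.le, inv_le_iff_one_le_mul₀ (by positivity), mul_right_comm,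
            ← div_eq_mul_inv, one_le_div (by positivity)]
          exact rpow_inv_mul_comparable hd hts ht0.le (by linarith) (by norm_num)
    _ = ENNReal.ofReal ((A * (D * 2 ^ (κ / d)) * C₂) * ((1 + s) / t) ^ (κ / d)) *
          scaledL1 K' ((1 + s) ^ (1 / d)) (fun y => ‖φ y‖ₑ) +
          ENNReal.ofReal ((A * C₁ * 2 ^ (1 / d)) * t ^ (-(1 / d))) *
            ‖∫ y, centred d q φ s y • y‖ₑ := by
        rw [mul_add, ← mul_assoc, ← mul_assoc, ← ENNReal.ofReal_mul (by positivity),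
          ← ENNReal.ofReal_mul (by positivity), ← mul_assoc (ENNReal.ofReal A),
          ← ENNReal.ofReal_mul (by positivity)]
        congr 3 <;> ring
    _ ≤ _ := by
        gcongr
        · exact le_max_left _ _
        · exact le_max_right _ _

end IsSemigroupProfile


/-! ### Vanishing of the rescaled early error, and errors from late times. -/

namespace IsSemigroupProfile

variable {d L : ℝ} {q : E N → ℝ}

/-- For data with moments of order `K < 1` the modulus integral is `o(t ^ (-K/d))`. -/
lemma tendsto_modulusIntegral (hq : IsSemigroupProfile d L q) {K : ℝ} (hK : 0 ≤ K) (hK1 : K < 1)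
    (hKL : K < L) {s : ℝ} (hs : 0 ≤ s) {φ : E N → ℝ} (hm : Measurable φ)
    (hfin : scaledL1 K ((1 + s) ^ (1 / d)) (fun y => ‖φ y‖ₑ) < ∞) :
    Tendsto (fun t => ENNReal.ofReal (t ^ (K / d)) * modulusIntegral d K q φ s t)
      atTop (𝓝 0) := by
  have hL : 0 < L := hK.trans_lt hKL
  have hd := hq.d_pos
  obtain ⟨C₂, hC₂, h₂⟩ := hq.exists_scaledL1_centred_le hK hKL
  have hm0 : 0 < (1 + s) ^ (1 / d) := by positivity
  set h := centred d q φ s with hh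
  have hhm : Measurable h := hq.measurable_centred hm s
  have hfinh : scaledL1 K 1 (fun y => ‖h y‖ₑ) < ∞ := by
    refine (scaledL1_le_of_le (c := (1 + s) ^ (1 / d)) hK one_pos hm0
      (Real.one_le_rpow (by linarith) (by positivity)) (by simp) _).trans_lt ?_
    exact ENNReal.mul_lt_top ENNReal.ofReal_lt_top
      ((h₂ s φ hs hm).trans_lt (ENNReal.mul_lt_top ENNReal.ofReal_lt_top hfin))
  set J : ℝ → E N → ℝ≥0∞ := fun t y => ENNReal.ofReal
    (t ^ (K / d) * modulus 1 K (((t - s) ^ (1 / d))⁻¹ * ‖y‖)) * ‖h y‖ₑ with hJ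
  have hrate : ∀ t, 2 * s + 1 ≤ t → ∀ κ, 0 ≤ κ →
      (((t - s) ^ (1 / d))⁻¹) ^ κ ≤ 2 ^ (κ / d) * t ^ (-(κ / d)) := by
    intro t ht κ hκ
    have hts : 0 < t - s := by linarith
    have ht0 : 0 < t := by linarith
    rw [← Real.rpow_neg hts.le, ← Real.rpow_mul hts.le, Real.rpow_neg ht0.le, ← div_eq_mul_inv,
      ← Real.div_rpow (by norm_num) ht0.le, show -(1 / d) * κ = -(κ / d) by ring,
      Real.rpow_neg hts.le, ← Real.inv_rpow hts.le]
    gcongr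
    rw [inv_le_comm₀ hts (by positivity), inv_div]
    linarith
  have hlim : Tendsto (fun t => ∫⁻ y, J t y) atTop (𝓝 (∫⁻ _ : E N, 0)) := by
    -- The same modulus is estimated twice: with `κ = K` for an integrable majorant uniform in `t`,
    -- and with `κ = 1 > K` for pointwise decay `t^(-(1-K)/d)` at fixed `y`.
    refine tendsto_lintegral_filter_of_dominated_convergence
      (fun y => ENNReal.ofReal (4 * 2 ^ (K / d)) *
        (‖h y‖ₑ * ENNReal.ofReal (scaledWeight K 1 y)))
      (.of_forall fun t => ?_) ?_ ?_ (.of_forall fun y => ?_)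
    · simp only [hJ]; unfold modulus; fun_prop
    · filter_upwards [eventually_ge_atTop (2 * s + 1)] with t ht
      refine .of_forall fun y => ?_
      have hts : 0 < t - s := by linarith
      have ht0 : 0 < t := by linarith
      rw [mul_comm ‖h y‖ₑ, ← mul_assoc, ← ENNReal.ofReal_mul (by positivity)]
      refine mul_le_mul_left (ENNReal.ofReal_le_ofReal ?_) _
      calc _ ≤ t ^ (K / d) * ((2 + 2 * (((t - s) ^ (1 / d))⁻¹) ^ (K - K)) *
            (((t - s) ^ (1 / d))⁻¹) ^ K * (1 + ‖y‖ ^ K)) := by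
            gcongr
            -- `Λ` is taken equal to `a`, so the surplus factor is `a ^ 0 = 1` and the constant
            -- becomes `4`.
            exact modulus_mul_le hK le_rfl hK (by simpa using hK1.le) le_rfl (by positivity) le_rfl
              (norm_nonneg y)
        _ ≤ t ^ (K / d) * ((2 + 2 * (((t - s) ^ (1 / d))⁻¹) ^ (K - K)) *
            (2 ^ (K / d) * t ^ (-(K / d))) * (1 + ‖y‖ ^ K)) := by
            gcongr
            exact hrate t ht K hK
        _ = (t ^ (K / d) * t ^ (-(K / d))) * (4 * 2 ^ (K / d) * scaledWeight K 1 y) := by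
            rw [sub_self, Real.rpow_zero, scaledWeight, inv_one, one_mul]; ring
        _ = _ := by rw [← Real.rpow_add ht0, add_neg_cancel, Real.rpow_zero, one_mul]
    · rw [lintegral_const_mul' _ _ ENNReal.ofReal_ne_top]
      exact ENNReal.mul_ne_top ENNReal.ofReal_ne_top hfinh.ne
    · have h0 : Tendsto (fun t : ℝ => 4 * 2 ^ (1 / d) * (1 + ‖y‖) * t ^ (-((1 - K) / d)))
          atTop (𝓝 0) := by
        have := (tendsto_rpow_neg_atTop (y := (1 - K) / d) (by
          have := sub_pos.2 hK1; positivity)).const_mul (4 * 2 ^ (1 / d) * (1 + ‖y‖))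
        simpa using this
      have h3 := ENNReal.Tendsto.mul_const (ENNReal.tendsto_ofReal h0) (b := ‖h y‖ₑ)
        (Or.inr enorm_ne_top)
      rw [ENNReal.ofReal_zero, zero_mul] at h3
      refine tendsto_of_tendsto_of_tendsto_of_le_of_le' tendsto_const_nhds h3
        (.of_forall fun _ => zero_le) ?_
      filter_upwards [eventually_ge_atTop (2 * s + 1)] with t ht
      have hts : 0 < t - s := by linarith
      have ht0 : 0 < t := by linarith
      refine mul_le_mul_left (ENNReal.ofReal_le_ofReal ?_) _
      have h4 := hrate t ht 1 zero_le_one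
      rw [Real.rpow_one] at h4
      calc _ ≤ t ^ (K / d) * ((2 + 2 * (((t - s) ^ (1 / d))⁻¹) ^ ((1 : ℝ) - 1)) *
            (((t - s) ^ (1 / d))⁻¹) ^ (1 : ℝ) * (1 + ‖y‖ ^ (1 : ℝ))) := by
            gcongr
            exact modulus_mul_le hK hK1.le zero_le_one (by simp) le_rfl (by positivity) le_rfl
              (norm_nonneg y)
        _ = t ^ (K / d) * (4 * ((t - s) ^ (1 / d))⁻¹ * (1 + ‖y‖)) := by
            rw [sub_self, Real.rpow_zero, Real.rpow_one, Real.rpow_one]; ring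
        _ ≤ t ^ (K / d) * (4 * (2 ^ (1 / d) * t ^ (-(1 / d))) * (1 + ‖y‖)) := by
            gcongr
        _ = 4 * 2 ^ (1 / d) * (1 + ‖y‖) * (t ^ (K / d) * t ^ (-(1 / d))) := by ring
        _ = _ := by rw [← Real.rpow_add ht0]; congr 2; ring
  rw [lintegral_zero] at hlim
  refine hlim.congr' ?_
  filter_upwards [eventually_gt_atTop 0] with t ht
  rw [modulusIntegral, ← lintegral_const_mul' _ _ ENNReal.ofReal_ne_top]
  refine lintegral_congr fun y => ?_
  rw [← mul_assoc, ← ENNReal.ofReal_mul (by positivity)]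

/-- The propagation error for data at a time comparable with `t`. -/
lemma exists_scaleNorm_error_le_of_half_le (hq : IsSemigroupProfile d L q) {K : ℝ} (hK : 0 ≤ K)
    (hKL : K < L) :
    ∃ C : ℝ, 0 ≤ C ∧ ∀ (s t : ℝ) (φ : E N → ℝ) (S : ℝ≥0∞), t / 2 ≤ s → s < t → 1 ≤ t →
      Measurable φ → (∀ᵐ y, ‖φ y‖ₑ ≤ S) →
      scaleNorm K (t ^ (1 / d)) (fun x => ‖propagationError d q φ s t x‖ₑ) ≤
        ENNReal.ofReal C * (scaledL1 K ((1 + s) ^ (1 / d)) (fun y => ‖φ y‖ₑ) +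
          ENNReal.ofReal (((1 + s) ^ (1 / d)) ^ N) * S) := by
  have hL : 0 < L := hK.trans_lt hKL
  have hd := hq.d_pos
  obtain ⟨B, hB, hqB⟩ := hq.decay.exists_scaleNorm_le hK hKL
  obtain ⟨C₁, hC₁, h₁⟩ := scaleNorm_conv_le_of_scale_le hK hKL hq.differentiable.continuous hq.decay
  set c : ℝ := 2 ^ (1 / d) with hcdef
  have hc : 1 ≤ c := Real.one_le_rpow (by norm_num) (by positivity)
  have hcN : 1 ≤ c ^ N := one_le_pow₀ hc
  have hcK : 1 ≤ c ^ K := Real.one_le_rpow hc hK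
  set A : ℝ := c ^ K * c ^ N
  refine ⟨A * (C₁ + B), by positivity, fun s t φ S hst hs ht hm hS => ?_⟩
  have hts : 0 < t - s := by linarith
  have ht0 : 0 < t := by linarith
  have hs0 : 0 < s := by linarith
  set W := scaledL1 K ((1 + s) ^ (1 / d)) (fun y => ‖φ y‖ₑ)
  set S' := ENNReal.ofReal (((1 + s) ^ (1 / d)) ^ N) * S
  have hm0 : 0 < (1 + s) ^ (1 / d) := by positivity
  have hqm := (continuous_dilate hq.differentiable.continuous ((t + 1) ^ (1 / d))).measurable
  have hqm' := (continuous_dilate hq.differentiable.continuous ((t - s) ^ (1 / d))).measurable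
  have hconv : Measurable fun x => ∫ y, dilate ((t - s) ^ (1 / d)) q (x - y) * φ y := by
    refine (StronglyMeasurable.integral_prod_right (f := fun x y =>
      dilate ((t - s) ^ (1 / d)) q (x - y) * φ y) ?_).measurable
    refine Measurable.stronglyMeasurable ?_
    unfold Function.uncurry
    fun_prop
  have hφW : ‖∫ z, φ z‖ₑ ≤ W :=
    (enorm_integral_le_lintegral_enorm _).trans (lintegral_le_scaledL1 hm0.le _)
  -- No cancellation is used: the two terms of the error are bounded separately. The kernel scale
  -- `(t-s)^(1/d)` may be arbitrarily small, which is why the supremum of the data has to enter.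
  calc _ ≤ scaleNorm K (t ^ (1 / d)) (fun x =>
          ‖∫ y, dilate ((t - s) ^ (1 / d)) q (x - y) * φ y‖ₑ +
          ‖∫ z, φ z‖ₑ * ‖dilate ((t + 1) ^ (1 / d)) q x‖ₑ) := by
        refine scaleNorm_mono fun x => ?_
        unfold propagationError selfSimilar
        rw [← enorm_mul]
        exact enorm_sub_le
    _ ≤ scaleNorm K (t ^ (1 / d)) (fun x =>
          ‖∫ y, dilate ((t - s) ^ (1 / d)) q (x - y) * φ y‖ₑ) +
          ‖∫ z, φ z‖ₑ * scaleNorm K (t ^ (1 / d))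
            (fun x => ‖dilate ((t + 1) ^ (1 / d)) q x‖ₑ) := by
        refine (scaleNorm_add_le hconv.enorm).trans ?_
        rw [scaleNorm_const_mul _ hqm.enorm]
    _ ≤ ENNReal.ofReal C₁ * (ENNReal.ofReal A * W + ENNReal.ofReal A * S') +
          W * (ENNReal.ofReal A * ENNReal.ofReal B) := by
        refine add_le_add ?_ ?_
        · refine (h₁ _ (t ^ (1 / d)) φ S (by positivity) (by gcongr; linarith) hm hS).trans ?_
          refine mul_le_mul_right (add_le_add ?_ ?_) _
          · refine (scaledL1_le_of_le hK (by positivity) hm0 hc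
              (rpow_inv_mul_comparable hd ht0 (by positivity) (by linarith) (by norm_num)) _).trans ?_
            gcongr
            exact le_mul_of_one_le_right (by positivity) hcN
          · simp only [S']
            rw [← mul_assoc, ← ENNReal.ofReal_mul (by positivity)]
            gcongr
            calc (t ^ (1 / d)) ^ N ≤ (c * (1 + s) ^ (1 / d)) ^ N := by
                  gcongr
                  exact rpow_inv_mul_comparable hd (by positivity) ht0.le (by linarith)
                    (by norm_num)
              _ = 1 * (c ^ N * ((1 + s) ^ (1 / d)) ^ N) := by rw [mul_pow, one_mul]
              _ ≤ c ^ K * (c ^ N * ((1 + s) ^ (1 / d)) ^ N) := by gcongr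
              _ = _ := by ring
        · gcongr
          refine (scaleNorm_le_of_le hK (by positivity)
            (by positivity : 0 < (t + 1) ^ (1 / d)) hc ?_ ?_ _).trans ?_
          · exact rpow_inv_mul_comparable hd ht0 (by positivity) (by linarith) (by norm_num)
          · exact rpow_inv_mul_comparable hd (by positivity) ht0.le (by linarith) (by norm_num)
          · rw [scaleNorm_dilate_eq (by positivity) hq.measurable]
            gcongr
    _ = ENNReal.ofReal A * (ENNReal.ofReal C₁ * (W + S') + ENNReal.ofReal B * W) := by ring
    _ ≤ ENNReal.ofReal A * (ENNReal.ofReal C₁ * (W + S') + ENNReal.ofReal B * (W + S')) := by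
        gcongr; exact le_self_add
    _ = _ := by
        rw [ENNReal.ofReal_mul (p := A) (by positivity), ENNReal.ofReal_add hC₁ hB]; ring

end IsSemigroupProfile


/-! ### Duhamel's formula -/

/-- `∫ |v| (1 + (|x| / l) ^ K) dx + l ^ N ‖v‖_∞`. -/
def profileDist (K l : ℝ) (v : E N → ℝ) : ℝ≥0∞ :=
  scaledL1 K l (fun x => ‖v x‖ₑ) + ENNReal.ofReal (l ^ N) * eLpNorm v ∞ volume

lemma profileDist_le_scaleNorm {K l : ℝ} {v : E N → ℝ} {P : E N → ℝ≥0∞}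
    (h : ∀ᵐ x, ‖v x‖ₑ ≤ P x) : profileDist K l v ≤ scaleNorm K l P := by
  unfold profileDist scaleNorm
  refine add_le_add (scaledL1_mono h) (mul_le_mul_right ?_ _)
  rw [eLpNorm_exponent_top]
  exact eLpNormEssSup_le_of_ae_enorm_bound (h.mono fun x hx => hx.trans (le_iSup P x))

/-- A source term that decays like `(1 + s) ^ (-a-1)` in the norms at scale `(1 + s) ^ (1/d)`. -/
structure SourceBound (d K a C : ℝ) (f : E N → ℝ → ℝ) : Prop where
  measurable : Measurable (Function.uncurry f)
  l1 : ∀ᵐ s ∂volume.restrict (Ioi (0 : ℝ)),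
    scaledL1 K ((1 + s) ^ (1 / d)) (fun y => ‖f y s‖ₑ) ≤ ENNReal.ofReal (C * (1 + s) ^ (-a - 1))
  sup : ∀ᵐ s ∂volume.restrict (Ioi (0 : ℝ)), ∀ᵐ y,
    ‖f y s‖ₑ ≤ ENNReal.ofReal (C * (1 + s) ^ (-a - 1) * (((1 + s) ^ (1 / d)) ^ N)⁻¹)

lemma lintegral_Ioi_rate_lt_top {a : ℝ} (ha : 0 < a) :
    ∫⁻ s in Ioi (0 : ℝ), ENNReal.ofReal ((1 + s) ^ (-a - 1)) < ∞ := by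
  have h := integrableOn_add_rpow_Ioi_of_lt (a := -a - 1) (c := 0) (m := 1) (by linarith)
    (by norm_num)
  have h2 : IntegrableOn (fun s : ℝ => (1 + s) ^ (-a - 1)) (Ioi 0) := by
    simpa only [add_comm] using h
  exact h2.lintegral_lt_top

lemma lintegral_Ioi_rate_le {a T : ℝ} (ha : 0 < a) (hT : 0 < T) :
    ∫⁻ s in Ioi T, ENNReal.ofReal ((1 + s) ^ (-a - 1)) ≤ ENNReal.ofReal (T ^ (-a) / a) := by
  have h1 : ∫⁻ s in Ioi T, ENNReal.ofReal ((1 + s) ^ (-a - 1)) ≤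
      ∫⁻ s in Ioi T, ENNReal.ofReal (s ^ (-a - 1)) := by
    refine setLIntegral_mono' measurableSet_Ioi fun s hs => ENNReal.ofReal_le_ofReal ?_
    exact Real.rpow_le_rpow_of_nonpos (hT.trans hs) (by linarith) (by linarith)
  refine h1.trans ?_
  have h2 := integrableOn_Ioi_rpow_of_lt (a := -a - 1) (by linarith) hT
  rw [← ofReal_integral_eq_lintegral_ofReal h2
    ((ae_restrict_mem measurableSet_Ioi).mono fun s hs => Real.rpow_nonneg (hT.trans hs).le _),
    integral_Ioi_rpow_of_lt (by linarith) hT]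
  apply le_of_eq
  congr 1
  rw [sub_add_cancel, neg_div_neg_eq]

lemma stronglyMeasurable_conv (d : ℝ) {f : E N → ℝ → ℝ} (hf : Measurable (Function.uncurry f))
    {q : E N → ℝ} (hq : Measurable q) (t : ℝ) :
    StronglyMeasurable fun z : E N × ℝ => ∫ y, selfSimilar d q (z.1 - y) (t - z.2) * f y z.2 := by
  refine StronglyMeasurable.integral_prod_right (f := fun (z : E N × ℝ) y =>
    selfSimilar d q (z.1 - y) (t - z.2) * f y z.2) (Measurable.stronglyMeasurable ?_)
  have h1 := (measurable_selfSimilar d hq).comp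
    (by fun_prop : Measurable fun p : (E N × ℝ) × E N => (p.1.1 - p.2, t - p.1.2))
  have h2 := hf.comp (by fun_prop : Measurable fun p : (E N × ℝ) × E N => (p.2, p.1.2))
  exact h1.mul h2

lemma measurable_selfSimilar_conv (d : ℝ) {φ : E N → ℝ} (hφ : Measurable φ)
    {q : E N → ℝ} (hq : Measurable q) (t : ℝ) :
    Measurable fun x => ∫ y, selfSimilar d q (x - y) t * φ y := by
  have h := (stronglyMeasurable_conv d (f := fun y _ => φ y) (hφ.comp measurable_fst) hq
    t).measurable.comp (measurable_prodMk_right (y := (0 : ℝ)))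
  simpa [Function.comp_def] using h

namespace SourceBound

variable {d K a C : ℝ} {f : E N → ℝ → ℝ}

lemma measurable_section (hf : SourceBound d K a C f) (s : ℝ) : Measurable fun y => f y s :=
  hf.measurable.comp measurable_prodMk_right

lemma stronglyMeasurable_integral (hf : SourceBound d K a C f) :
    StronglyMeasurable fun s => ∫ y, f y s :=
  StronglyMeasurable.integral_prod_left (f := f) hf.measurable.stronglyMeasurable

lemma enorm_integral_le (hf : SourceBound d K a C f) : ∀ᵐ s ∂volume.restrict (Ioi (0 : ℝ)),
    ‖∫ y, f y s‖ₑ ≤ ENNReal.ofReal (C * (1 + s) ^ (-a - 1)) := by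
  filter_upwards [hf.l1, ae_restrict_mem measurableSet_Ioi] with s hs hs0
  have hs1 : (0 : ℝ) < s := hs0
  exact (enorm_integral_le_lintegral_enorm _).trans
    ((lintegral_le_scaledL1 (by positivity) _).trans hs)

lemma integrableOn_integral (hf : SourceBound d K a C f) (hC : 0 ≤ C) (ha : 0 < a) :
    IntegrableOn (fun s => ∫ y, f y s) (Ioi 0) := by
  refine ⟨hf.stronglyMeasurable_integral.aestronglyMeasurable, ?_⟩
  refine (lintegral_mono_ae hf.enorm_integral_le).trans_lt ?_
  simp_rw [ENNReal.ofReal_mul hC]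
  rw [lintegral_const_mul' _ _ ENNReal.ofReal_ne_top]
  exact ENNReal.mul_lt_top ENNReal.ofReal_lt_top (lintegral_Ioi_rate_lt_top ha)

lemma measurable_error (hf : SourceBound d K a C f) {q : E N → ℝ} (hq : Measurable q) (t : ℝ) :
    Measurable fun z : E N × ℝ => propagationError d q (fun y => f y z.2) z.2 t z.1 := by
  unfold propagationError
  refine (stronglyMeasurable_conv d hf.measurable hq t).measurable.sub (Measurable.mul ?_ ?_)
  · exact hf.stronglyMeasurable_integral.measurable.comp measurable_snd
  · exact (measurable_selfSimilar d hq).comp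
      (by fun_prop : Measurable fun z : E N × ℝ => (z.1, t + 1))

/-- Duhamel's integrand is integrable in time. -/
lemma integrableOn_conv (hf : SourceBound d K a C f) (hC : 0 ≤ C) (ha : 0 < a) {L : ℝ}
    {q : E N → ℝ} (hq : IsSemigroupProfile d L q) (hL : 0 < L) (t : ℝ) (x : E N) :
    IntegrableOn (fun s => ∫ y, selfSimilar d q (x - y) (t - s) * f y s) (Ioo 0 t) := by
  have hd := hq.d_pos
  refine ⟨((stronglyMeasurable_conv d hf.measurable hq.measurable t).comp_measurable
    (measurable_prodMk_left (x := x))).aestronglyMeasurable, ?_⟩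
  have hsub : ∀ᵐ s ∂volume.restrict (Ioo 0 t), ∀ᵐ y,
      ‖f y s‖ₑ ≤ ENNReal.ofReal (C * (1 + s) ^ (-a - 1) * (((1 + s) ^ (1 / d)) ^ N)⁻¹) :=
    ae_restrict_of_ae_restrict_of_subset Ioo_subset_Ioi_self hf.sup
  have hB : ∫⁻ y, ‖q y‖ₑ < ∞ := (hq.integrable hL).2
  have hle : ∀ᵐ s ∂volume.restrict (Ioo 0 t),
      ‖∫ y, selfSimilar d q (x - y) (t - s) * f y s‖ₑ ≤ (∫⁻ y, ‖q y‖ₑ) * ENNReal.ofReal C := by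
    filter_upwards [hsub, ae_restrict_mem measurableSet_Ioo] with s hs hs0
    have hs1 : 0 < s := hs0.1
    have hts : 0 < t - s := sub_pos.2 hs0.2
    have hqm := (continuous_dilate hq.differentiable.continuous ((t - s) ^ (1 / d))).measurable
    refine (enorm_integral_le_lintegral_enorm _).trans ?_
    calc _ ≤ ∫⁻ y, ‖dilate ((t - s) ^ (1 / d)) q (x - y)‖ₑ * ENNReal.ofReal C := by
          refine lintegral_mono_ae (hs.mono fun y hy => ?_)
          rw [enorm_mul]
          refine mul_le_mul_right (hy.trans (ENNReal.ofReal_le_ofReal ?_)) _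
          rw [mul_assoc]
          refine mul_le_of_le_one_right hC (mul_le_one₀ ?_ (by positivity) ?_)
          · exact Real.rpow_le_one_of_one_le_of_nonpos (by linarith) (by linarith)
          · exact inv_le_one_of_one_le₀ (one_le_pow₀
              (Real.one_le_rpow (by linarith) (by positivity)))
      _ = _ := by
          rw [lintegral_mul_const _ (by fun_prop),
            lintegral_sub_left_eq_self (fun y => ‖dilate ((t - s) ^ (1 / d)) q y‖ₑ) x,
            lintegral_dilate_eq (by positivity) hq.measurable]
  refine (lintegral_mono_ae hle).trans_lt ?_
  rw [lintegral_const]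
  exact ENNReal.mul_lt_top (ENNReal.mul_lt_top hB ENNReal.ofReal_lt_top) (by simp)

end SourceBound

/-- The distance of a mild solution to a multiple of the kernel is controlled by propagation
errors up to time `t / 2`. -/
lemma IsSemigroupProfile.exists_profileDist_le {d L K a C₀ : ℝ} {q : E N → ℝ}
    (hq : IsSemigroupProfile d L q) (hK : 0 ≤ K) (hKL : K < L) (ha : 0 < a) (hC₀ : 0 ≤ C₀) :
    ∃ C : ℝ, 0 ≤ C ∧ ∀ (φ : E N → ℝ) (f : E N → ℝ → ℝ) (u : E N → ℝ) (t : ℝ), 1 ≤ t →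
      SourceBound d K a C₀ f → Measurable φ →
      (∀ᵐ x, u x = (∫ y, selfSimilar d q (x - y) t * φ y) +
        ∫ s in (0 : ℝ)..t, ∫ y, selfSimilar d q (x - y) (t - s) * f y s) →
      profileDist K (t ^ (1 / d)) (fun x => u x -
        ((∫ y, φ y) + ∫ s in Ioi (0 : ℝ), ∫ y, f y s) * selfSimilar d q x (t + 1)) ≤
      scaleNorm K (t ^ (1 / d)) (fun x => ‖propagationError d q φ 0 t x‖ₑ) +
      (∫⁻ s in Ioo 0 (t / 2), scaleNorm K (t ^ (1 / d))
        (fun x => ‖propagationError d q (fun y => f y s) s t x‖ₑ)) +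
      ENNReal.ofReal (C * t ^ (-a)) := by
  have hL : 0 < L := hK.trans_lt hKL
  have hd := hq.d_pos
  obtain ⟨B, hB, hqB⟩ := hq.decay.exists_scaleNorm_le hK hKL
  obtain ⟨C₁, hC₁, h₁⟩ := hq.exists_scaleNorm_error_le_of_half_le hK hKL
  set c : ℝ := 2 ^ (1 / d)
  have hc : 1 ≤ c := Real.one_le_rpow (by norm_num) (by positivity)
  -- The first summand comes from `t/2 ≤ s < t`: `2 * C₀` adds the `L^1` and the supremum bounds of
  -- the source, and `2 ^ a / a` integrates `s^(-a-1)` from `t/2`. The second comes from the mass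
  -- emitted after `t`, multiplied by the norm of `g(t)`.
  refine ⟨C₁ * (2 * C₀) * (2 ^ a / a) + C₀ * (1 / a) * (c ^ K * c ^ N * B), by positivity,
    fun φ f u t ht hf hφ hu => ?_⟩
  have ht0 : 0 < t := by linarith
  set m : ℝ → ℝ := fun s => ∫ y, f y s with hm
  have hmi : IntegrableOn m (Ioi 0) := hf.integrableOn_integral hC₀ ha
  have hmeas := hf.measurable_error hq.measurable t
  have hqm : Measurable fun x => selfSimilar d q x (t + 1) :=
    (continuous_dilate hq.differentiable.continuous ((t + 1) ^ (1 / d))).measurable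
  have hpt : ∀ᵐ x, ‖u x - ((∫ y, φ y) + ∫ s in Ioi (0 : ℝ), m s) * selfSimilar d q x (t + 1)‖ₑ ≤
      (‖propagationError d q φ 0 t x‖ₑ +
      (∫⁻ s in Ioo 0 (t / 2), ‖propagationError d q (fun y => f y s) s t x‖ₑ)) +
      ((∫⁻ s in Ico (t / 2) t, ‖propagationError d q (fun y => f y s) s t x‖ₑ) +
      (∫⁻ s in Ioi t, ‖m s‖ₑ) * ‖selfSimilar d q x (t + 1)‖ₑ) := by
    filter_upwards [hu] with x hx
    set g := selfSimilar d q x (t + 1) with hg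
    have hci := hf.integrableOn_conv hC₀ ha hq hL t x
    have hmi0 : IntegrableOn m (Ioo 0 t) := hmi.mono_set Ioo_subset_Ioi_self
    have hsplit : ∫ s in Ioi (0 : ℝ), m s = (∫ s in Ioo 0 t, m s) + ∫ s in Ioi t, m s := by
      rw [← integral_Ioc_eq_integral_Ioo, ← setIntegral_union
        (Ioc_disjoint_Ioi le_rfl) measurableSet_Ioi
        (hmi.mono_set Ioc_subset_Ioi_self) (hmi.mono_set (Ioi_subset_Ioi ht0.le)),
        Ioc_union_Ioi_eq_Ioi ht0.le]
    have herr : ∫ s in Ioo 0 t, propagationError d q (fun y => f y s) s t x =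
        (∫ s in Ioo 0 t, ∫ y, selfSimilar d q (x - y) (t - s) * f y s) -
          (∫ s in Ioo 0 t, m s) * g := by
      unfold propagationError
      rw [integral_sub hci (hmi0.mul_const _), integral_mul_const]
    -- Each slice is charged with its own share `m s * g` of the limit profile. The share of the
    -- slices `s > t`, which have not acted yet, remains as the tail.
    have hid : u x - ((∫ y, φ y) + ∫ s in Ioi (0 : ℝ), m s) * g =
        propagationError d q φ 0 t x +
        (∫ s in Ioo 0 t, propagationError d q (fun y => f y s) s t x) -
        (∫ s in Ioi t, m s) * g := by
      rw [herr, hx, hsplit, intervalIntegral.integral_of_le ht0.le, integral_Ioc_eq_integral_Ioo,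
        propagationError, sub_zero]
      ring
    rw [hid]
    have hun : Ioo 0 t = Ioo 0 (t / 2) ∪ Ico (t / 2) t :=
      (Ioo_union_Ico_eq_Ioo (by linarith) (by linarith)).symm
    calc _ ≤ ‖propagationError d q φ 0 t x‖ₑ +
          (∫⁻ s in Ioo 0 t, ‖propagationError d q (fun y => f y s) s t x‖ₑ) +
          (∫⁻ s in Ioi t, ‖m s‖ₑ) * ‖g‖ₑ := by
          refine enorm_sub_le.trans (add_le_add ((enorm_add_le _ _).trans ?_) ?_)
          · gcongr
            exact enorm_integral_le_lintegral_enorm _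
          · rw [enorm_mul]
            gcongr
            exact enorm_integral_le_lintegral_enorm _
      _ ≤ _ := by
          rw [hun]
          refine (add_le_add_left (add_le_add_right (lintegral_union_le _ _ _) _) _).trans
            (le_of_eq ?_)
          ring
  refine (profileDist_le_scaleNorm hpt).trans ?_
  have hmeas' : Measurable (Function.uncurry fun (x : E N) (s : ℝ) =>
      ‖propagationError d q (fun y => f y s) s t x‖ₑ) := hmeas.enorm
  have hφm : Measurable fun x => propagationError d q φ 0 t x := by
    have h1 := measurable_selfSimilar_conv d hφ hq.measurable t
    unfold propagationError
    simp only [sub_zero]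
    exact h1.sub (hqm.const_mul _)
  refine (scaleNorm_add_le (hφm.enorm.add hmeas'.lintegral_prod_right)).trans ?_
  refine add_le_add ((scaleNorm_add_le hφm.enorm).trans
    (add_le_add le_rfl (scaleNorm_lintegral_le _ hmeas'))) ?_
  refine (scaleNorm_add_le hmeas'.lintegral_prod_right).trans ?_
  rw [add_mul, ENNReal.ofReal_add (by positivity) (by positivity)]
  refine add_le_add ?_ ?_
  · refine (scaleNorm_lintegral_le _ hmeas').trans ?_
    have hIco : ∀ᵐ s ∂volume.restrict (Ico (t / 2) t), scaleNorm K (t ^ (1 / d))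
        (fun x => ‖propagationError d q (fun y => f y s) s t x‖ₑ) ≤
        ENNReal.ofReal (C₁ * (2 * C₀)) * ENNReal.ofReal ((1 + s) ^ (-a - 1)) := by
      have hss : Ico (t / 2) t ⊆ Ioi 0 := fun s hs => lt_of_lt_of_le (by linarith) hs.1
      filter_upwards [ae_restrict_of_ae_restrict_of_subset hss hf.l1,
        ae_restrict_of_ae_restrict_of_subset hss hf.sup, ae_restrict_mem measurableSet_Ico]
        with s h1 h2 hs
      have hs0 : 0 < s := hss hs
      refine (h₁ s t (fun y => f y s) _ hs.1 hs.2 ht (hf.measurable_section s) h2).trans ?_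
      have h3 : ENNReal.ofReal (((1 + s) ^ (1 / d)) ^ N) *
          ENNReal.ofReal (C₀ * (1 + s) ^ (-a - 1) * (((1 + s) ^ (1 / d)) ^ N)⁻¹) =
          ENNReal.ofReal (C₀ * (1 + s) ^ (-a - 1)) := by
        rw [← ENNReal.ofReal_mul (by positivity)]
        congr 1
        field_simp
      rw [h3, ← ENNReal.ofReal_mul (by positivity)]
      refine (mul_le_mul_right (add_le_add_left h1 _) _).trans (le_of_eq ?_)
      rw [← ENNReal.ofReal_add (by positivity) (by positivity), ← ENNReal.ofReal_mul hC₁]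
      congr 1
      ring
    refine (lintegral_mono_ae hIco).trans ?_
    rw [lintegral_const_mul' _ _ ENNReal.ofReal_ne_top, mul_assoc (C₁ * (2 * C₀)),
      ENNReal.ofReal_mul (p := C₁ * (2 * C₀)) (by positivity), setLIntegral_congr Ioo_ae_eq_Ico.symm]
    gcongr
    calc _ ≤ ∫⁻ s in Ioi (t / 2), ENNReal.ofReal ((1 + s) ^ (-a - 1)) :=
          lintegral_mono_set Ioo_subset_Ioi_self
      _ ≤ _ := lintegral_Ioi_rate_le ha (by linarith)
      _ = _ := by
        rw [Real.div_rpow ht0.le (by norm_num), Real.rpow_neg (by norm_num : (0 : ℝ) ≤ 2)]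
        congr 1
        field_simp
  · rw [scaleNorm_const_mul _ hqm.enorm, mul_right_comm (C₀ * (1 / a)), mul_assoc C₀,
      ENNReal.ofReal_mul (q := c ^ K * c ^ N * B) (by positivity)]
    refine mul_le_mul' ?_ ?_
    · have hm2 : ∀ᵐ s ∂volume.restrict (Ioi t), ‖m s‖ₑ ≤
          ENNReal.ofReal C₀ * ENNReal.ofReal ((1 + s) ^ (-a - 1)) := by
        filter_upwards [ae_restrict_of_ae_restrict_of_subset (Ioi_subset_Ioi ht0.le)
          hf.enorm_integral_le] with s hs
        rwa [← ENNReal.ofReal_mul hC₀]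
      refine (lintegral_mono_ae hm2).trans ?_
      rw [lintegral_const_mul' _ _ ENNReal.ofReal_ne_top, ENNReal.ofReal_mul hC₀, one_div_mul_eq_div]
      gcongr
      exact lintegral_Ioi_rate_le ha ht0
    · rw [ENNReal.ofReal_mul (by positivity)]
      refine (scaleNorm_le_of_le hK (by positivity)
        (by positivity : 0 < (t + 1) ^ (1 / d)) hc ?_ ?_ _).trans ?_
      · exact rpow_inv_mul_comparable hd ht0 (by positivity) (by linarith) (by norm_num)
      · exact rpow_inv_mul_comparable hd (by positivity) ht0.le (by linarith) (by norm_num)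
      · unfold selfSimilar
        rw [scaleNorm_dilate_eq (by positivity) hq.measurable]
        gcongr

/-! ### From the two endpoint norms to all exponents `q` and weights `ℓ`. -/

/-- Interpolation: the rescaled distance is controlled by the endpoint norms. -/
lemma ofReal_mul_eLpNorm_le_profileDist {K d t : ℝ} (ht : 1 ≤ t) {v : E N → ℝ}
    {q : ℝ≥0∞} (hq : 1 ≤ q) :
    ENNReal.ofReal (t ^ lpExponent N d q) * eLpNorm v q volume ≤
      profileDist K (t ^ (1 / d)) v := by
  have ht0 : 0 < t := by linarith
  have hl : 0 < t ^ (1 / d) := by positivity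
  have hlN : (t ^ (1 / d)) ^ N = t ^ ((N : ℝ) / d) := by
    rw [← Real.rpow_natCast, ← Real.rpow_mul ht0.le]; congr 1; ring
  set X := profileDist K (t ^ (1 / d)) v with hX
  have h1 : ∫⁻ x, ‖v x‖ₑ ≤ X := (lintegral_le_scaledL1 hl.le _).trans le_self_add
  have h2 : ENNReal.ofReal (t ^ ((N : ℝ) / d)) * eLpNorm v ∞ volume ≤ X := by
    rw [hX, profileDist, hlN]; exact le_add_self
  rcases eq_or_ne q ∞ with rfl | hqt
  · simpa [lpExponent] using h2
  have hqp : 1 ≤ q.toReal := by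
    rw [← ENNReal.toReal_one]; exact (ENNReal.toReal_le_toReal ENNReal.one_ne_top hqt).2 hq
  set p := q.toReal with hp
  have hp0 : 0 < p := by linarith
  have hq0 : q ≠ 0 := (zero_lt_one.trans_le hq).ne'
  rcases eq_or_ne X ∞ with hXt | hXt
  · rw [hXt]; exact le_top
  set S := eLpNorm v ∞ volume with hS
  have hc0 : ENNReal.ofReal (t ^ ((N : ℝ) / d)) ≠ 0 := by
    simp only [ne_eq, ENNReal.ofReal_eq_zero, not_le]; positivity
  have hSt : S ≠ ∞ := by
    intro h
    rw [h, ENNReal.mul_top hc0] at h2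
    exact hXt (top_le_iff.1 h2)
  -- Interpolation between `L^1` and `L^∞`: after the power `1/p` this becomes `S^(1-1/p) X^(1/p)`,
  -- and `t^(N/d)` raised to `1 - 1/p` completes `S` to a quantity below `X`.
  have hint : ∫⁻ x, ‖v x‖ₑ ^ p ≤ S ^ (p - 1) * X := by
    calc ∫⁻ x, ‖v x‖ₑ ^ p ≤ ∫⁻ x, S ^ (p - 1) * ‖v x‖ₑ := by
          have hess : ∀ᵐ x, ‖v x‖ₑ ≤ S := by
            rw [hS, eLpNorm_exponent_top]; exact ae_le_eLpNormEssSup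
          refine lintegral_mono_ae (hess.mono fun x hx => ?_)
          calc ‖v x‖ₑ ^ p = ‖v x‖ₑ ^ (p - 1) * ‖v x‖ₑ ^ (1 : ℝ) := by
                rw [← ENNReal.rpow_add_of_nonneg _ _ (by linarith) zero_le_one, sub_add_cancel]
            _ ≤ _ := by
                rw [ENNReal.rpow_one]
                gcongr
      _ = S ^ (p - 1) * ∫⁻ x, ‖v x‖ₑ :=
          lintegral_const_mul' _ _ (ENNReal.rpow_ne_top_of_nonneg (by linarith) hSt)
      _ ≤ _ := by gcongr
  have hexp : lpExponent N d q = (N : ℝ) / d * (1 - 1 / p) := by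
    rw [lpExponent, ENNReal.toReal_inv, one_div]
  have hθ : 0 ≤ 1 - 1 / p := by
    rw [sub_nonneg, div_le_one hp0]; exact hqp
  rw [eLpNorm_eq_lintegral_rpow_enorm_toReal hq0 hqt, hexp, Real.rpow_mul ht0.le,
    ← ENNReal.ofReal_rpow_of_nonneg (by positivity) hθ]
  calc _ ≤ ENNReal.ofReal (t ^ ((N : ℝ) / d)) ^ (1 - 1 / p) * (S ^ (p - 1) * X) ^ (1 / p) := by
        gcongr
    _ = (ENNReal.ofReal (t ^ ((N : ℝ) / d)) * S) ^ (1 - 1 / p) * X ^ (1 / p) := by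
        rw [ENNReal.mul_rpow_of_nonneg _ _ (by positivity), ← ENNReal.rpow_mul,
          ENNReal.mul_rpow_of_nonneg _ _ hθ, mul_assoc]
        congr 4
        field_simp
    _ ≤ X ^ (1 - 1 / p) * X ^ (1 / p) := by gcongr
    _ = X := by
        rw [← ENNReal.rpow_add_of_nonneg _ _ hθ (by positivity), sub_add_cancel, ENNReal.rpow_one]

/-- With `ρ = |x| / t^(1/d)` and `t ≥ 1`, the weight satisfies `t^(-ℓ/d)(1+|x|^ℓ) ≤ 1 + ρ^ℓ ≤ 2 +
ρ^K`, which is at most twice `1 + ρ^K`. -/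
lemma ofReal_mul_weightedNorm_le_profileDist {K d t ℓ : ℝ} (hd : 0 < d) (ht : 1 ≤ t)
    (hℓ : 0 ≤ ℓ) (hℓK : ℓ ≤ K) (v : E N → ℝ) :
    ENNReal.ofReal (t ^ (-(ℓ / d))) * weightedNorm ℓ v ≤
      ENNReal.ofReal 2 * profileDist K (t ^ (1 / d)) v := by
  have ht0 : 0 < t := by linarith
  have hl : 0 < t ^ (1 / d) := by positivity
  refine le_trans ?_ (mul_le_mul_right (le_self_add : scaledL1 K (t ^ (1 / d)) _ ≤ _) _)
  unfold weightedNorm scaledL1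
  rw [← lintegral_const_mul' _ _ ENNReal.ofReal_ne_top,
    ← lintegral_const_mul' _ _ ENNReal.ofReal_ne_top]
  refine lintegral_mono fun x => ?_
  simp only
  rw [mul_left_comm, mul_left_comm (ENNReal.ofReal 2), ← ENNReal.ofReal_mul (by positivity),
    ← ENNReal.ofReal_mul (by norm_num)]
  refine mul_le_mul_right (ENNReal.ofReal_le_ofReal ?_) _
  set ρ := (t ^ (1 / d))⁻¹ * ‖x‖ with hρ
  have hρ0 : 0 ≤ ρ := by positivity
  have h1 : t ^ (-(ℓ / d)) * ‖x‖ ^ ℓ = ρ ^ ℓ := by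
    rw [hρ, Real.mul_rpow (by positivity) (norm_nonneg x), ← Real.rpow_neg ht0.le,
      ← Real.rpow_mul ht0.le]
    congr 2; ring
  have h2 : t ^ (-(ℓ / d)) ≤ 1 :=
    Real.rpow_le_one_of_one_le_of_nonpos ht (by have : 0 ≤ ℓ / d := by positivity
                                                linarith)
  have h3 : ρ ^ ℓ ≤ 1 + ρ ^ K := by
    have := Real.rpow_nonneg hρ0 K
    rcases le_total ρ 1 with h | h
    · exact (Real.rpow_le_one hρ0 h hℓ).trans (by linarith)
    · exact (Real.rpow_le_rpow_of_exponent_le h hℓK).trans (by linarith)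
  have := Real.rpow_nonneg hρ0 K
  rw [mul_add, mul_one, h1, scaledWeight, ← hρ]
  linarith

lemma rescaledDist_le {G : E N → ℝ → ℝ} {d K M t ℓ : ℝ} {u : E N → ℝ → ℝ} (hd : 0 < d)
    (ht : 1 ≤ t) {q : ℝ≥0∞} (hq : 1 ≤ q) (hℓ : 0 ≤ ℓ) (hℓK : ℓ ≤ K) :
    rescaledDist G d u M q ℓ t ≤ ENNReal.ofReal 3 *
      profileDist K (t ^ (1 / d)) (fun x => u x t - M * shiftedKernel G x t) := by
  have h := add_le_add (ofReal_mul_eLpNorm_le_profileDist (K := K) (d := d) ht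
    (v := fun x => u x t - M * shiftedKernel G x t) hq)
    (ofReal_mul_weightedNorm_le_profileDist hd ht hℓ hℓK
      (fun x => u x t - M * shiftedKernel G x t))
  refine h.trans (le_of_eq ?_)
  rw [show (3 : ℝ) = 1 + 2 by norm_num, ENNReal.ofReal_add zero_le_one (by norm_num),
    ENNReal.ofReal_one]
  ring


/-! ### Rates -/

lemma lintegral_Ioo_rpow_eq {b T : ℝ} (hT : 0 ≤ T) :
    ∫⁻ s in Ioo 0 T, ENNReal.ofReal ((1 + s) ^ (b - 1)) =
      ENNReal.ofReal (∫ s in (1 : ℝ)..1 + T, s ^ (b - 1)) := by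
  have hcont : ContinuousOn (fun s : ℝ => (1 + s) ^ (b - 1)) (Icc 0 T) := by
    refine ContinuousOn.rpow_const (by fun_prop) fun s hs => Or.inl ?_
    linarith [hs.1]
  have hint : IntegrableOn (fun s : ℝ => (1 + s) ^ (b - 1)) (Ioo 0 T) :=
    (hcont.integrableOn_Icc).mono_set Ioo_subset_Icc_self
  rw [← ofReal_integral_eq_lintegral_ofReal hint ((ae_restrict_mem measurableSet_Ioo).mono
    fun s hs => Real.rpow_nonneg (by linarith [hs.1]) _), ← integral_Ioc_eq_integral_Ioo,
    ← intervalIntegral.integral_of_le hT]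
  have := intervalIntegral.integral_comp_add_left (fun x : ℝ => x ^ (b - 1)) (a := 0) (b := T) 1
  rw [this, add_zero]

/-- For `b < 0` the integral converges and `1` bounds it up to a constant; for `b > 0` it grows like
`t^b`. The sum serves both signs, and only `b = 0` produces a logarithm. -/
lemma exists_lintegral_Ioo_rpow_le {b : ℝ} (hb : b ≠ 0) :
    ∃ C : ℝ, 0 ≤ C ∧ ∀ t : ℝ, 1 ≤ t →
      ∫⁻ s in Ioo 0 (t / 2), ENNReal.ofReal ((1 + s) ^ (b - 1)) ≤ ENNReal.ofReal (C * (1 + t ^ b)) := by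
  rcases lt_or_gt_of_ne hb with h | h
  · have hfin := lintegral_Ioi_rate_lt_top (a := -b) (by linarith)
    rw [neg_neg] at hfin
    refine ⟨(∫⁻ s in Ioi (0 : ℝ), ENNReal.ofReal ((1 + s) ^ (b - 1))).toReal,
      ENNReal.toReal_nonneg, fun t ht => ?_⟩
    calc _ ≤ ∫⁻ s in Ioi (0 : ℝ), ENNReal.ofReal ((1 + s) ^ (b - 1)) :=
          lintegral_mono_set Ioo_subset_Ioi_self
      _ = _ := (ENNReal.ofReal_toReal hfin.ne).symm
      _ ≤ _ := ENNReal.ofReal_le_ofReal (le_mul_of_one_le_right ENNReal.toReal_nonneg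
          (by have : 0 ≤ t ^ b := by positivity
              linarith))
  · refine ⟨2 ^ b / b, by positivity, fun t ht => ?_⟩
    rw [lintegral_Ioo_rpow_eq (by linarith), integral_rpow (Or.inl (by linarith)), sub_add_cancel,
      Real.one_rpow]
    apply ENNReal.ofReal_le_ofReal
    rw [div_mul_eq_mul_div]
    gcongr
    have h1 : (1 + t / 2) ^ b ≤ 2 ^ b * t ^ b := by
      rw [← Real.mul_rpow (by norm_num) (by linarith)]
      exact Real.rpow_le_rpow (by linarith) (by linarith) h.le
    have : (0 : ℝ) < 2 ^ b := by positivity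
    linarith

lemma lintegral_Ioo_inv_le {t : ℝ} (ht : 1 ≤ t) :
    ∫⁻ s in Ioo 0 (t / 2), ENNReal.ofReal ((1 + s) ^ ((0 : ℝ) - 1)) ≤
      ENNReal.ofReal (1 + Real.log t) := by
  rw [lintegral_Ioo_rpow_eq (by linarith)]
  apply ENNReal.ofReal_le_ofReal
  simp_rw [zero_sub, Real.rpow_neg_one]
  rw [integral_inv_of_pos one_pos (by linarith), div_one]
  calc Real.log (1 + t / 2) ≤ Real.log (2 * t) :=
        Real.log_le_log (by linarith) (by linarith)
    _ = Real.log 2 + Real.log t := Real.log_mul (by norm_num) (by linarith)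
    _ ≤ _ := by linarith [Real.log_two_lt_d9]

/-! ### The source up to time `t / 2`: powers, logarithm, vanishing, first moments. -/

/-- The contribution of a source up to time `t / 2`. -/
def nearError (d K : ℝ) (q : E N → ℝ) (f : E N → ℝ → ℝ) (t : ℝ) : ℝ≥0∞ :=
  ∫⁻ s in Ioo 0 (t / 2), scaleNorm K (t ^ (1 / d))
    (fun x => ‖propagationError d q (fun y => f y s) s t x‖ₑ)

namespace IsSemigroupProfile

variable {d L : ℝ} {q : E N → ℝ}

lemma exists_nearError_le (hq : IsSemigroupProfile d L q) {K κ : ℝ} (hK : 0 ≤ K)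
    (hKL : K < L) (hκ : 0 ≤ κ) (hκ1 : κ ≤ 1) (hκK : κ ≤ K) :
    ∃ C : ℝ, 0 ≤ C ∧ ∀ (f : E N → ℝ → ℝ) (c : ℝ → ℝ) (t : ℝ), 1 ≤ t →
      Measurable (Function.uncurry f) →
      (∀ᵐ s ∂volume.restrict (Ioi (0 : ℝ)), scaledL1 K ((1 + s) ^ (1 / d)) (fun y => ‖f y s‖ₑ) ≤
        ENNReal.ofReal (c s)) →
      nearError d K q f t ≤ ENNReal.ofReal (C * t ^ (-(κ / d))) *
        ∫⁻ s in Ioo 0 (t / 2), ENNReal.ofReal ((1 + s) ^ (κ / d) * c s) := by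
  obtain ⟨C, hC, h⟩ := hq.exists_scaleNorm_error_le hK hKL hκ hκ1 hκK
  refine ⟨C, hC, fun f c t ht hf hc => ?_⟩
  have ht0 : 0 < t := by linarith
  unfold nearError
  rw [← lintegral_const_mul' _ _ ENNReal.ofReal_ne_top]
  refine lintegral_mono_ae ?_
  filter_upwards [ae_restrict_of_ae_restrict_of_subset Ioo_subset_Ioi_self hc,
    ae_restrict_mem measurableSet_Ioo] with s hs hs0
  have hs1 : 0 < s := hs0.1
  have hfm : Measurable fun y => f y s := hf.comp measurable_prodMk_right
  have hi : Integrable fun y => f y s := integrable_of_scaledL1 (K := K)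
    (l := (1 + s) ^ (1 / d)) (by positivity) hfm (hs.trans_lt ENNReal.ofReal_lt_top)
  refine (h s t _ hs1.le hs0.2.le ht hfm hi).trans ?_
  refine (mul_le_mul_right hs _).trans (le_of_eq ?_)
  rw [← ENNReal.ofReal_mul (by positivity), Real.div_rpow (by positivity) ht0.le,
    Real.rpow_neg ht0.le, ← ENNReal.ofReal_mul (by positivity)]
  congr 1
  ring

/-- The time integral has exponent `b = κ/d - a`, and `t^(-κ/d)(1 + t^b) = t^(-κ/d) + t^(-a)`. -/
lemma exists_nearError_le_of_ne (hq : IsSemigroupProfile d L q) {K κ a C₀ : ℝ} (hK : 0 ≤ K)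
    (hKL : K < L) (hκ : 0 ≤ κ) (hκ1 : κ ≤ 1) (hκK : κ ≤ K) (hC₀ : 0 ≤ C₀) (ha : a ≠ κ / d)
    {f : E N → ℝ → ℝ} (hf : SourceBound d K a C₀ f) :
    ∃ C : ℝ, 0 ≤ C ∧ ∀ t : ℝ, 1 ≤ t →
      nearError d K q f t ≤ ENNReal.ofReal (C * (t ^ (-(κ / d)) + t ^ (-a))) := by
  obtain ⟨C, hC, h⟩ := hq.exists_nearError_le hK hKL hκ hκ1 hκK
  obtain ⟨C', hC', h'⟩ := exists_lintegral_Ioo_rpow_le (b := κ / d - a)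
    (sub_ne_zero.2 ha.symm)
  refine ⟨C * C₀ * C', by positivity, fun t ht => ?_⟩
  have ht0 : 0 < t := by linarith
  refine (h f _ t ht hf.measurable hf.l1).trans ?_
  have h1 : ∫⁻ s in Ioo 0 (t / 2), ENNReal.ofReal ((1 + s) ^ (κ / d) * (C₀ * (1 + s) ^ (-a - 1))) =
      ENNReal.ofReal C₀ * ∫⁻ s in Ioo 0 (t / 2), ENNReal.ofReal ((1 + s) ^ (κ / d - a - 1)) := by
    rw [← lintegral_const_mul' _ _ ENNReal.ofReal_ne_top]
    refine setLIntegral_congr_fun measurableSet_Ioo fun s hs => ?_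
    rw [← ENNReal.ofReal_mul hC₀, mul_left_comm, ← Real.rpow_add (by linarith [hs.1])]
    congr 3; ring
  rw [h1]
  refine (mul_le_mul_right (mul_le_mul_right (h' t ht) _) _).trans (le_of_eq ?_)
  rw [← ENNReal.ofReal_mul hC₀, ← ENNReal.ofReal_mul (by positivity)]
  congr 1
  have : t ^ (-a) = t ^ (-(κ / d)) * t ^ (κ / d - a) := by
    rw [← Real.rpow_add ht0]; congr 1; ring
  rw [this]; ring

lemma exists_nearError_le_of_eq (hq : IsSemigroupProfile d L q) {K κ a C₀ : ℝ} (hK : 0 ≤ K)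
    (hKL : K < L) (hκ : 0 ≤ κ) (hκ1 : κ ≤ 1) (hκK : κ ≤ K) (hC₀ : 0 ≤ C₀) (ha : a = κ / d)
    {f : E N → ℝ → ℝ} (hf : SourceBound d K a C₀ f) :
    ∃ C : ℝ, 0 ≤ C ∧ ∀ t : ℝ, 1 ≤ t →
      nearError d K q f t ≤ ENNReal.ofReal (C * (t ^ (-(κ / d)) * (1 + Real.log t))) := by
  obtain ⟨C, hC, h⟩ := hq.exists_nearError_le hK hKL hκ hκ1 hκK
  refine ⟨C * C₀, by positivity, fun t ht => ?_⟩
  have ht0 : 0 < t := by linarith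
  have hlog := Real.log_nonneg ht
  refine (h f _ t ht hf.measurable hf.l1).trans ?_
  have h1 : ∫⁻ s in Ioo 0 (t / 2), ENNReal.ofReal ((1 + s) ^ (κ / d) * (C₀ * (1 + s) ^ (-a - 1))) =
      ENNReal.ofReal C₀ * ∫⁻ s in Ioo 0 (t / 2), ENNReal.ofReal ((1 + s) ^ ((0 : ℝ) - 1)) := by
    rw [← lintegral_const_mul' _ _ ENNReal.ofReal_ne_top]
    refine setLIntegral_congr_fun measurableSet_Ioo fun s hs => ?_
    rw [← ENNReal.ofReal_mul hC₀, mul_left_comm, ← Real.rpow_add (by linarith [hs.1]), ha]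
    congr 3; ring
  rw [h1]
  refine (mul_le_mul_right (mul_le_mul_right (lintegral_Ioo_inv_le ht) _) _).trans (le_of_eq ?_)
  rw [← ENNReal.ofReal_mul hC₀, ← ENNReal.ofReal_mul (by positivity)]
  congr 1
  ring

/-- For `K < 1` and integrable moments of order `K` the contribution of the source is
`o(t ^ (-K/d))`. -/
lemma tendsto_nearError (hq : IsSemigroupProfile d L q) {K a C₀ : ℝ} (hK : 0 ≤ K) (hK1 : K < 1)
    (hKL : K < L) (hC₀ : 0 ≤ C₀) (ha : K / d < a) {f : E N → ℝ → ℝ}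
    (hf : SourceBound d K a C₀ f) :
    Tendsto (fun t => ENNReal.ofReal (t ^ (K / d)) * nearError d K q f t) atTop (𝓝 0) := by
  have hd := hq.d_pos
  obtain ⟨C₁, hC₁, h₁⟩ := hq.exists_scaleNorm_error_le_modulusIntegral hK hKL
  obtain ⟨C₂, hC₂, h₂⟩ := hq.exists_modulusIntegral_le hK hKL hK hK1.le le_rfl
  have hpos : ∀ᵐ s ∂volume.restrict (Ioi (0 : ℝ)), s ∈ Ioi (0 : ℝ) :=
    ae_restrict_mem measurableSet_Ioi
  set J : ℝ → ℝ → ℝ≥0∞ := fun t s => (Ioo 0 (t / 2)).indicator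
    (fun s => ENNReal.ofReal C₁ * (ENNReal.ofReal (t ^ (K / d)) *
      modulusIntegral d K q (fun y => f y s) s t)) s with hJ
  have hmeas : ∀ t, Measurable fun s => modulusIntegral d K q (fun y => f y s) s t := by
    intro t
    unfold modulusIntegral
    refine Measurable.lintegral_prod_right' (f := fun z : ℝ × E N =>
      ENNReal.ofReal (modulus 1 K (((t - z.1) ^ (1 / d))⁻¹ * ‖z.2‖)) *
        ‖centred d q (fun y => f y z.1) z.1 z.2‖ₑ) (Measurable.mul ?_ (Measurable.enorm ?_))
    · unfold modulus; fun_prop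
    · unfold centred
      refine (hf.measurable.comp measurable_swap).sub (Measurable.mul ?_ ?_)
      · exact hf.stronglyMeasurable_integral.measurable.comp measurable_fst
      · exact (measurable_selfSimilar d hq.measurable).comp
          (by fun_prop : Measurable fun z : ℝ × E N => (z.2, z.1 + 1))
  have hlim : Tendsto (fun t => ∫⁻ s in Ioi (0 : ℝ), J t s) atTop
      (𝓝 (∫⁻ _ in Ioi (0 : ℝ), 0)) := by
    -- For fixed `s` the integrand vanishes by `tendsto_modulusIntegral`. The majorant
    -- `(1+s)^(-(a-K/d)-1)` is integrable precisely because `a > K/d`.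
    refine tendsto_lintegral_filter_of_dominated_convergence
      (fun s => ENNReal.ofReal (C₁ * (C₂ * C₀)) * ENNReal.ofReal ((1 + s) ^ (-(a - K / d) - 1)))
      (.of_forall fun t => ?_) ?_ ?_ ?_
    · exact (((hmeas t).const_mul _).const_mul _).indicator measurableSet_Ioo
    · filter_upwards [eventually_ge_atTop 1] with t ht
      filter_upwards [hf.l1, hpos] with s hs hs0
      have hs1 : 0 < s := hs0
      have ht0 : 0 < t := by linarith
      refine indicator_apply_le' (fun hst => ?_) (fun _ => zero_le)
      have h3 := h₂ s t (fun y => f y s) hs1.le hst.2.le ht (hf.measurable_section s)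
      refine (mul_le_mul_right (mul_le_mul_right (h3.trans (mul_le_mul_right hs _)) _) _).trans
        (le_of_eq ?_)
      rw [← ENNReal.ofReal_mul (by positivity), ← ENNReal.ofReal_mul (by positivity),
        ← ENNReal.ofReal_mul hC₁, ← ENNReal.ofReal_mul (by positivity),
        Real.div_rpow (by positivity) ht0.le]
      congr 1
      have : (1 + s) ^ (-(a - K / d) - 1) = (1 + s) ^ (K / d) * (1 + s) ^ (-a - 1) := by
        rw [← Real.rpow_add (by positivity)]; congr 1; ring
      rw [this]
      have : 0 < t ^ (K / d) := by positivity
      field_simp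
    · rw [lintegral_const_mul' _ _ ENNReal.ofReal_ne_top]
      exact ENNReal.mul_ne_top ENNReal.ofReal_ne_top (lintegral_Ioi_rate_lt_top (by linarith)).ne
    · filter_upwards [hf.l1, hpos] with s hs hs0
      have h3 := ENNReal.Tendsto.const_mul (hq.tendsto_modulusIntegral hK hK1 hKL (le_of_lt hs0)
        (hf.measurable_section s) (hs.trans_lt ENNReal.ofReal_lt_top))
        (a := ENNReal.ofReal C₁) (Or.inr ENNReal.ofReal_ne_top)
      rw [mul_zero] at h3
      refine tendsto_of_tendsto_of_tendsto_of_le_of_le tendsto_const_nhds h3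
        (fun _ => zero_le) fun t => ?_
      exact indicator_le_self _ _ s
  rw [lintegral_zero] at hlim
  refine tendsto_of_tendsto_of_tendsto_of_le_of_le' tendsto_const_nhds hlim
    (.of_forall fun _ => zero_le) ?_
  filter_upwards [eventually_ge_atTop 1] with t ht
  have ht0 : 0 < t := by linarith
  rw [nearError, ← lintegral_const_mul' _ _ ENNReal.ofReal_ne_top]
  simp only [hJ]
  rw [setLIntegral_indicator measurableSet_Ioo,
    inter_eq_left.2 (Ioo_subset_Ioi_self : Ioo 0 (t / 2) ⊆ Ioi 0)]
  refine lintegral_mono_ae ?_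
  filter_upwards [ae_restrict_of_ae_restrict_of_subset Ioo_subset_Ioi_self hf.l1,
    ae_restrict_mem measurableSet_Ioo] with s hs hs0
  have hs1 : 0 < s := hs0.1
  have hi : Integrable fun y => f y s := integrable_of_scaledL1 (K := K)
    (l := (1 + s) ^ (1 / d)) (by positivity) (hf.measurable_section s)
    (hs.trans_lt ENNReal.ofReal_lt_top)
  rw [mul_left_comm]
  gcongr
  exact h₁ s t _ hs1.le hs0.2.le ht0 (hf.measurable_section s) hi

lemma propagationError_add (hq : IsSemigroupProfile d L q) (hL : 0 < L) {φ ψ : E N → ℝ}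
    (hφ : Integrable φ) (hψ : Integrable ψ) {s t : ℝ} (hst : s < t) (x : E N) :
    propagationError d q (fun y => φ y + ψ y) s t x =
      propagationError d q φ s t x + propagationError d q ψ s t x := by
  have hr : 0 < (t - s) ^ (1 / d) := by have := sub_pos.2 hst; positivity
  have h1 := hq.decay.integrable_dilate_mul hL.le hq.differentiable.continuous hr hφ x
  have h2 := hq.decay.integrable_dilate_mul hL.le hq.differentiable.continuous hr hψ x
  unfold propagationError selfSimilar
  simp_rw [mul_add]
  rw [integral_add h1 h2, integral_add hφ hψ]
  ring

/-- Splitting off a part of the source. -/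
lemma exists_nearError_add_le (hq : IsSemigroupProfile d L q) {K κ : ℝ} (hK : 0 ≤ K)
    (hKL : K < L) (hκ : 0 ≤ κ) (hκ1 : κ ≤ 1) (hκK : κ ≤ K) :
    ∃ C : ℝ, 0 ≤ C ∧ ∀ (f₁ f₂ : E N → ℝ → ℝ) (c : ℝ → ℝ) (t : ℝ), 1 ≤ t → Measurable c →
      Measurable (Function.uncurry f₁) → Measurable (Function.uncurry f₂) →
      (∀ᵐ s ∂volume.restrict (Ioi (0 : ℝ)), scaledL1 K ((1 + s) ^ (1 / d)) (fun y => ‖f₁ y s‖ₑ) ≤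
        ENNReal.ofReal (c s)) →
      (∀ᵐ s ∂volume.restrict (Ioi (0 : ℝ)),
        scaledL1 K ((1 + s) ^ (1 / d)) (fun y => ‖f₂ y s‖ₑ) < ∞) →
      nearError d K q (fun y s => f₁ y s + f₂ y s) t ≤ ENNReal.ofReal (C * t ^ (-(κ / d))) *
        (∫⁻ s in Ioo 0 (t / 2), ENNReal.ofReal ((1 + s) ^ (κ / d) * c s)) +
        nearError d K q f₂ t := by
  obtain ⟨C, hC, h⟩ := hq.exists_scaleNorm_error_le hK hKL hκ hκ1 hκK
  refine ⟨C, hC, fun f₁ f₂ c t ht hcm hf₁ hf₂ hc₁ hc₂ => ?_⟩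
  have ht0 : 0 < t := by linarith
  have hL : 0 < L := hK.trans_lt hKL
  unfold nearError
  -- Splitting the integral needs measurability of one summand only; it is supplied by the explicit
  -- bound `c`.
  rw [← lintegral_const_mul' _ _ ENNReal.ofReal_ne_top, ← lintegral_add_left (by fun_prop)]
  refine lintegral_mono_ae ?_
  filter_upwards [ae_restrict_of_ae_restrict_of_subset Ioo_subset_Ioi_self hc₁,
    ae_restrict_of_ae_restrict_of_subset Ioo_subset_Ioi_self hc₂,
    ae_restrict_mem measurableSet_Ioo] with s hs hs2 hs0
  have hs1 : 0 < s := hs0.1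
  have hl : 0 ≤ (1 + s) ^ (1 / d) := by positivity
  have hm₁ : Measurable fun y => f₁ y s := hf₁.comp measurable_prodMk_right
  have hm₂ : Measurable fun y => f₂ y s := hf₂.comp measurable_prodMk_right
  have hi₁ := integrable_of_scaledL1 hl hm₁ (hs.trans_lt ENNReal.ofReal_lt_top)
  have hi₂ := integrable_of_scaledL1 hl hm₂ hs2
  have hem : Measurable fun x => propagationError d q (fun y => f₁ y s) s t x :=
    (measurable_selfSimilar_conv d hm₁ hq.measurable _).sub
      ((continuous_dilate hq.differentiable.continuous _).measurable.const_mul _)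
  simp_rw [hq.propagationError_add hL hi₁ hi₂ (by linarith [hs0.2] : s < t)]
  refine (scaleNorm_mono fun x => enorm_add_le _ _).trans ((scaleNorm_add_le hem.enorm).trans ?_)
  refine add_le_add ((h s t _ hs1.le hs0.2.le ht hm₁ hi₁).trans ?_) le_rfl
  refine (mul_le_mul_right hs _).trans (le_of_eq ?_)
  rw [← ENNReal.ofReal_mul (by positivity), Real.div_rpow (by positivity) ht0.le,
    Real.rpow_neg ht0.le, ← ENNReal.ofReal_mul (by positivity)]
  congr 1
  ring

/-- The contribution of a source whose centred first moments are integrable in time. -/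
lemma exists_nearError_le_of_moment (hq : IsSemigroupProfile d L q)
    (hq2 : Differentiable ℝ (fderiv ℝ q)) (hq2' : PolyDecay (N + L) (fderiv ℝ (fderiv ℝ q)))
    {K K' a C₀ κ : ℝ} (hK : 1 ≤ K) (hKK' : K ≤ K') (hKL : K' < L) (hκ : 1 < κ) (hκ2 : κ ≤ 2)
    (hκK : κ ≤ K') (hC₀ : 0 ≤ C₀) (ha : a = 1 / d) {f : E N → ℝ → ℝ}
    (hf : SourceBound d K' a C₀ f)
    (hmom : ∫⁻ s in Ioi (0 : ℝ), ‖∫ y, centred d q (fun y => f y s) s y • y‖ₑ < ∞) :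
    ∃ C : ℝ, 0 ≤ C ∧ ∀ t : ℝ, 1 ≤ t →
      nearError d K q f t ≤ ENNReal.ofReal (C * t ^ (-(1 / d))) := by
  have hd := hq.d_pos
  obtain ⟨C₁, hC₁, h₁⟩ := hq.exists_scaleNorm_error_le_of_moment hq2 hq2' hK hKK' hKL
    (by linarith) hκ2 hκK
  -- This is where `κ > 1` removes the logarithm: the time integral grows like the positive power
  -- `t^(κ/d-1/d)`, and the prefactor `t^(-κ/d)` turns it into `t^(-1/d)`.
  have hb : 0 < κ / d - a := by
    rw [ha, ← sub_div]; exact div_pos (by linarith) hd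
  obtain ⟨C₂, hC₂, h₂⟩ := exists_lintegral_Ioo_rpow_le hb.ne'
  set m := (∫⁻ s in Ioi (0 : ℝ), ‖∫ y, centred d q (fun y => f y s) s y • y‖ₑ).toReal with hm
  have hm' : ∫⁻ s in Ioi (0 : ℝ), ‖∫ y, centred d q (fun y => f y s) s y • y‖ₑ =
    ENNReal.ofReal m := (ENNReal.ofReal_toReal hmom.ne).symm
  have hm0 : 0 ≤ m := ENNReal.toReal_nonneg
  refine ⟨C₁ * C₀ * C₂ * 2 + C₁ * m, by positivity, fun t ht => ?_⟩
  have ht0 : 0 < t := by linarith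
  have hae : ∀ᵐ s ∂volume.restrict (Ioo 0 (t / 2)), scaleNorm K (t ^ (1 / d))
      (fun x => ‖propagationError d q (fun y => f y s) s t x‖ₑ) ≤
      ENNReal.ofReal (C₁ * t ^ (-(κ / d)) * C₀) * ENNReal.ofReal ((1 + s) ^ (κ / d - a - 1)) +
      ENNReal.ofReal (C₁ * t ^ (-(1 / d))) *
        ‖∫ y, centred d q (fun y => f y s) s y • y‖ₑ := by
    filter_upwards [ae_restrict_of_ae_restrict_of_subset Ioo_subset_Ioi_self hf.l1,
      ae_restrict_mem measurableSet_Ioo] with s hs hs0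
    have hs1 : 0 < s := hs0.1
    refine (h₁ s t _ hs1.le hs0.2.le ht (hf.measurable_section s)
      (hs.trans_lt ENNReal.ofReal_lt_top)).trans ?_
    refine add_le_add ?_ le_rfl
    refine (mul_le_mul_right hs _).trans (le_of_eq ?_)
    rw [← ENNReal.ofReal_mul (by positivity), ← ENNReal.ofReal_mul (by positivity),
      Real.div_rpow (by positivity) ht0.le, Real.rpow_neg ht0.le]
    congr 1
    have : (1 + s) ^ (κ / d - a - 1) = (1 + s) ^ (κ / d) * (1 + s) ^ (-a - 1) := by
      rw [← Real.rpow_add (by positivity)]; congr 1; ring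
    rw [this]; ring
  refine (lintegral_mono_ae hae).trans ?_
  rw [lintegral_add_left (by fun_prop), lintegral_const_mul' _ _ ENNReal.ofReal_ne_top,
    lintegral_const_mul' _ _ ENNReal.ofReal_ne_top, add_mul,
    ENNReal.ofReal_add (by positivity) (by positivity)]
  refine add_le_add ?_ ?_
  · refine (mul_le_mul_right (h₂ t ht) _).trans ?_
    rw [← ENNReal.ofReal_mul (by positivity)]
    apply ENNReal.ofReal_le_ofReal
    have h3 : t ^ (-(1 / d)) = t ^ (-(κ / d)) * t ^ (κ / d - a) := by
      rw [← Real.rpow_add ht0, ha]; congr 1; ring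
    have h4 : 1 ≤ t ^ (κ / d - a) := Real.one_le_rpow ht hb.le
    rw [h3]
    calc _ = C₁ * C₀ * C₂ * t ^ (-(κ / d)) * (1 + t ^ (κ / d - a)) := by ring
      _ ≤ C₁ * C₀ * C₂ * t ^ (-(κ / d)) * (2 * t ^ (κ / d - a)) := by
        gcongr; linarith
      _ = _ := by ring
  · calc _ ≤ ENNReal.ofReal (C₁ * t ^ (-(1 / d))) * ENNReal.ofReal m := by
          rw [← hm']
          gcongr
          exact Ioo_subset_Ioi_self
      _ = _ := by rw [← ENNReal.ofReal_mul (by positivity)]; congr 1; ring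

end IsSemigroupProfile


/-! ### The kernel condition -/

namespace KernelCondition

variable {γ : ℕ} {d L : ℝ} {G : E N → ℝ → ℝ}

lemma eq_selfSimilar (hG : KernelCondition G γ d L) {t : ℝ} (ht : 0 < t) (x : E N) :
    G x t = selfSimilar d (fun y => G y 1) x t := by
  rw [hG.scaling x t ht, selfSimilar, dilate, ← Real.rpow_natCast, ← Real.rpow_mul ht.le,
    one_div_mul_eq_div, Real.rpow_neg ht.le]

lemma contDiff_profile (hG : KernelCondition G γ d L) : ContDiff ℝ γ (fun y => G y 1) := by
  rw [← contDiffOn_univ]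
  have h : ContDiffOn ℝ γ (fun y : E N => (y, (1 : ℝ))) univ :=
    (contDiff_prodMk_left 1).contDiffOn
  exact hG.contDiff.comp h fun y _ => ⟨mem_univ _, (one_pos : (0 : ℝ) < 1)⟩

/-- The additional `j` powers of decay of the derivatives are given up: one exponent `N + L` for all
orders is enough. -/
lemma polyDecay_iteratedFDeriv (hG : KernelCondition G γ d L) {j : ℕ} (hj : j ≤ γ) :
    ∃ C : ℝ, 0 ≤ C ∧ ∀ x, ‖iteratedFDeriv ℝ j (fun y => G y 1) x‖ ≤
      C * (1 + ‖x‖) ^ (-((N : ℝ) + L)) := by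
  obtain ⟨C, hC⟩ := hG.decay j hj
  refine ⟨|C|, abs_nonneg C, fun x => ?_⟩
  have h1 : 1 ≤ 1 + ‖x‖ := by linarith [norm_nonneg x]
  have h0 : 0 < 1 + ‖x‖ := by linarith
  rw [Real.rpow_neg h0.le, ← div_eq_mul_inv, le_div_iff₀ (by positivity), mul_comm]
  refine le_trans ?_ ((hC x).trans (le_abs_self C))
  exact mul_le_mul_of_nonneg_right (Real.rpow_le_rpow_of_exponent_le h1 (by simp))
    (norm_nonneg _)

lemma polyDecay (hG : KernelCondition G γ d L) : PolyDecay (N + L) (fun y => G y 1) := by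
  obtain ⟨C, hC, h⟩ := hG.polyDecay_iteratedFDeriv (Nat.zero_le γ)
  exact ⟨C, hC, fun x => by simpa using h x⟩

lemma polyDecay_fderiv (hG : KernelCondition G γ d L) :
    PolyDecay (N + L) (fderiv ℝ fun y => G y 1) := by
  obtain ⟨C, hC, h⟩ := hG.polyDecay_iteratedFDeriv hG.gamma_pos
  exact ⟨C, hC, fun x => by simpa using h x⟩

lemma polyDecay_fderiv_fderiv (hG : KernelCondition G γ d L) (hγ : 2 ≤ γ) :
    PolyDecay (N + L) (fderiv ℝ (fderiv ℝ fun y => G y 1)) := by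
  obtain ⟨C, hC, h⟩ := hG.polyDecay_iteratedFDeriv hγ
  refine ⟨C, hC, fun x => ?_⟩
  rw [← norm_iteratedFDeriv_one, norm_iteratedFDeriv_fderiv]
  exact h x

lemma differentiable_profile (hG : KernelCondition G γ d L) : Differentiable ℝ (fun y => G y 1) :=
  hG.contDiff_profile.differentiable (by simpa using (Nat.one_le_iff_ne_zero.1 hG.gamma_pos))

lemma differentiable_fderiv_profile (hG : KernelCondition G γ d L) (hγ : 2 ≤ γ) :
    Differentiable ℝ (fderiv ℝ fun y => G y 1) := by
  have h1 : ContDiff ℝ 1 (fderiv ℝ fun y => G y 1) :=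
    hG.contDiff_profile.fderiv_right (by norm_cast)
  exact h1.differentiable one_ne_zero

/-- The profile has unit integral unless it vanishes. -/
lemma profile_mul_eq_zero (hG : KernelCondition G γ d L) (x : E N) :
    G x 1 * (1 - ∫ y, G y 1) = 0 := by
  have hd := hG.d_pos
  set q : E N → ℝ := fun y => G y 1 with hqdef
  have hint : Integrable q := by
    obtain ⟨B, hB, h⟩ := hG.polyDecay.exists_scaleNorm_le le_rfl hG.L_pos
    exact integrable_of_scaledL1 zero_le_one hG.differentiable_profile.continuous.measurable
      ((le_self_add.trans h).trans_lt ENNReal.ofReal_lt_top)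
  obtain ⟨C, hC, hb⟩ := hG.polyDecay.exists_bound hG.L_pos.le
  have hGc : ContinuousOn (fun z : E N × ℝ => G z.1 z.2) (univ ×ˢ Ioi 0) :=
    hG.contDiff.continuousOn
  -- The semigroup law at time one after the substitution `y = s^(1/d) z`. Letting `s → 0`
  -- concentrates the second factor, so that `q(x) = q(x) ∫ q`.
  have hrep : ∀ s ∈ Ioo (0 : ℝ) (1 / 2),
      ∫ z, G (x - s ^ (1 / d) • z) (1 - s) * q z = q x := by
    intro s hs
    have hl : 0 < s ^ (1 / d) := by have := hs.1; positivity
    have h1 := hG.semigroup x s 1 hs.1 (by linarith [hs.2])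
    have h2 := Measure.integral_comp_inv_smul_of_nonneg (volume : Measure (E N))
      (fun z => G (x - s ^ (1 / d) • z) (1 - s) * q z) hl.le
    simp only [smul_inv_smul₀ hl.ne', finrank_euclideanSpace_fin, smul_eq_mul] at h2
    have h3 : q x = ∫ y, ((s ^ (1 / d)) ^ N)⁻¹ *
        (G (x - y) (1 - s) * q ((s ^ (1 / d))⁻¹ • y)) := by
      refine h1.trans (integral_congr_ae (.of_forall fun y => ?_))
      simp only
      rw [hG.eq_selfSimilar hs.1 y, selfSimilar, dilate, mul_left_comm]
    rw [h3, integral_const_mul, h2, ← mul_assoc, inv_mul_cancel₀ (by positivity), one_mul]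
  have hlim : Tendsto (fun s : ℝ => ∫ z, G (x - s ^ (1 / d) • z) (1 - s) * q z) (𝓝[>] 0)
      (𝓝 (∫ z, q x * q z)) := by
    refine tendsto_integral_filter_of_dominated_convergence
      -- The kernel is evaluated at times `1 - s ≥ 1/2`, where scaling bounds it by a fixed multiple
      -- of the supremum `C` of the profile.
      (fun z => (((1 / 2 : ℝ) ^ (1 / d)) ^ N)⁻¹ * C * ‖q z‖) ?_ ?_ (hint.norm.const_mul _) ?_
    · filter_upwards [Ioo_mem_nhdsGT (show (0 : ℝ) < 1 / 2 by norm_num)] with s hs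
      have h1s : 0 < 1 - s := by linarith [hs.2]
      have hm : Measurable fun z => G (x - s ^ (1 / d) • z) (1 - s) := by
        simp_rw [hG.eq_selfSimilar h1s]
        exact (measurable_selfSimilar d hG.differentiable_profile.continuous.measurable).comp
          (by fun_prop : Measurable fun z : E N => (x - s ^ (1 / d) • z, 1 - s))
      exact hm.aestronglyMeasurable.mul hint.1
    · filter_upwards [Ioo_mem_nhdsGT (show (0 : ℝ) < 1 / 2 by norm_num)] with s hs
      refine .of_forall fun z => ?_
      have h1s : 0 < 1 - s := by linarith [hs.2]
      rw [norm_mul, hG.eq_selfSimilar h1s, selfSimilar, dilate, norm_mul,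
        Real.norm_of_nonneg (by positivity)]
      gcongr
      · linarith [hs.2]
      · exact hb _
    · refine .of_forall fun z => ?_
      have hc : ContinuousAt (fun z : E N × ℝ => G z.1 z.2) (x, 1) :=
        hGc.continuousAt (prod_mem_nhds univ_mem (Ioi_mem_nhds one_pos))
      have hc2 : Tendsto (fun s : ℝ => (x - s ^ (1 / d) • z, 1 - s)) (𝓝[>] 0) (𝓝 (x, 1)) := by
        have h1 : Tendsto (fun s : ℝ => s ^ (1 / d)) (𝓝[>] 0) (𝓝 0) := by
          have := (Real.continuousAt_rpow_const 0 (1 / d) (Or.inr (by positivity))).tendsto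
          rw [Real.zero_rpow (by positivity)] at this
          exact this.mono_left nhdsWithin_le_nhds
        have h2 : Tendsto (fun s : ℝ => 1 - s) (𝓝[>] 0) (𝓝 1) := by
          have : Tendsto (fun s : ℝ => 1 - s) (𝓝 0) (𝓝 (1 - 0)) :=
            (continuous_const.sub continuous_id).tendsto 0
          rw [sub_zero] at this
          exact this.mono_left nhdsWithin_le_nhds
        have h3 := (tendsto_const_nhds (x := x)).sub (h1.smul_const z)
        rw [zero_smul, sub_zero] at h3
        exact h3.prodMk_nhds h2
      exact (hc.tendsto.comp hc2).mul_const _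
  have h1 : Tendsto (fun s : ℝ => ∫ z, G (x - s ^ (1 / d) • z) (1 - s) * q z) (𝓝[>] 0)
      (𝓝 (q x)) := by
    refine tendsto_const_nhds.congr' ?_
    filter_upwards [Ioo_mem_nhdsGT (show (0 : ℝ) < 1 / 2 by norm_num)] with s hs
    exact (hrep s hs).symm
  have h2 := tendsto_nhds_unique h1 hlim
  rw [integral_const_mul] at h2
  have h3 : q x * (1 - ∫ y, q y) = 0 := by rw [mul_sub, mul_one, ← h2, sub_self]
  exact h3

lemma mul_eq_zero (hG : KernelCondition G γ d L) (x : E N) {t : ℝ} (ht : 0 < t) :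
    G x t * (1 - ∫ y, G y 1) = 0 := by
  rw [hG.scaling x t ht, mul_assoc, hG.profile_mul_eq_zero, mul_zero]

lemma isSemigroupProfile (hG : KernelCondition G γ d L) :
    IsSemigroupProfile d L (fun y => G y 1) where
  d_pos := hG.d_pos
  differentiable := hG.differentiable_profile
  decay := hG.polyDecay
  decay_fderiv := hG.polyDecay_fderiv
  semigroup := by
    intro x s t hs hst
    simp_rw [← hG.eq_selfSimilar (hs.trans hst), ← hG.eq_selfSimilar (sub_pos.2 hst),
      ← hG.eq_selfSimilar hs]
    exact hG.semigroup x s t hs hst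
  normalized := by
    intro x t ht
    rw [← hG.eq_selfSimilar ht]
    exact hG.mul_eq_zero x ht

end KernelCondition


/-! ### The nonlinearity -/

/-- Allows `F(y,s,u(y,s))` to be exchanged for a Borel representative inside the iterated integrals.
-/
lemma ae_slice_of_ae {P : E N × ℝ → Prop}
    (h : ∀ᵐ z ∂(volume : Measure (E N × ℝ)).restrict (univ ×ˢ Ioi (0 : ℝ)), P z) :
    ∀ᵐ s ∂volume.restrict (Ioi (0 : ℝ)), ∀ᵐ y : E N, P (y, s) := by
  rw [Measure.volume_eq_prod, ← Measure.prod_restrict, Measure.restrict_univ] at h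
  have h2 := (Measure.measurePreserving_swap (μ := volume.restrict (Ioi (0 : ℝ)))
    (ν := (volume : Measure (E N)))).quasiMeasurePreserving.ae h
  exact Measure.ae_ae_of_ae_prod h2

namespace NonlinearityCondition

variable {F : E N → ℝ → ℝ → ℝ} {Cs A p : ℝ}

lemma continuous (hF : NonlinearityCondition F Cs A p) (x : E N) {t : ℝ} (ht : 0 < t) :
    Continuous (F x t) := by
  rw [continuous_iff_continuousAt]
  intro v
  rw [ContinuousAt, tendsto_iff_dist_tendsto_zero]
  have hpow : Continuous fun w : ℝ => |w| ^ (p - 1) :=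
    continuous_abs.rpow_const fun _ => Or.inr (by linarith [hF.one_le_p])
  have hc : Continuous fun w : ℝ =>
      Cs * (1 + t) ^ A * max (|w| ^ (p - 1)) (|v| ^ (p - 1)) * |w - v| := by fun_prop
  have h := hc.tendsto v
  rw [sub_self, abs_zero, mul_zero] at h
  exact squeeze_zero (fun _ => dist_nonneg)
    (fun w => by rw [Real.dist_eq]; exact hF.lipschitz x t ht w v) h

/-- Superposition with a measurable function is measurable. -/
lemma aestronglyMeasurable_comp (hF : NonlinearityCondition F Cs A p) {w : E N → ℝ → ℝ}
    (hw : AEStronglyMeasurable (fun z : E N × ℝ => w z.1 z.2)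
      (volume.restrict (univ ×ˢ Ioi (0 : ℝ)))) :
    AEStronglyMeasurable (fun z : E N × ℝ => F z.1 z.2 (w z.1 z.2))
      (volume.restrict (univ ×ˢ Ioi (0 : ℝ))) := by
  set μ : Measure (E N × ℝ) := volume.restrict (univ ×ˢ Ioi (0 : ℝ)) with hμ
  -- Carathéodory's argument: outside one common null set, all `F(·,·,r)` with rational `r` agree
  -- with Borel functions, and continuity in `v` carries this over to every real `v`.
  have hgood : ∀ᵐ z ∂μ, (∀ r : ℚ, F z.1 z.2 r = (hF.measurable r).mk _ z) ∧ 0 < z.2 := by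
    refine (ae_all_iff.2 fun r : ℚ => (hF.measurable r).ae_eq_mk).and ?_
    filter_upwards [ae_restrict_mem (MeasurableSet.univ.prod measurableSet_Ioi)] with z hz
    exact hz.2
  obtain ⟨T, hT, hTm, hT0⟩ := exists_measurable_superset_of_null (ae_iff.1 hgood)
  have hS : ∀ z ∈ Tᶜ, (∀ r : ℚ, F z.1 z.2 r = (hF.measurable r).mk _ z) ∧ 0 < z.2 := by
    intro z hz
    by_contra hcon
    exact hz (hT hcon)
  set Φ : ℝ → E N × ℝ → ℝ := fun v => Tᶜ.indicator fun z => F z.1 z.2 v with hΦ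
  have hcont : ∀ z, Continuous fun v => Φ v z := by
    intro z
    by_cases hz : z ∈ Tᶜ
    · simp only [hΦ, indicator_of_mem hz]
      exact hF.continuous z.1 (hS z hz).2
    · simp only [hΦ, indicator_of_notMem hz]
      exact continuous_const
  have hrat : ∀ r : ℚ, Measurable (Φ r) := by
    intro r
    have : Φ r = Tᶜ.indicator ((hF.measurable r).mk _) := by
      ext z
      by_cases hz : z ∈ Tᶜ
      · simp only [hΦ, indicator_of_mem hz]
        exact (hS z hz).1 r
      · simp only [hΦ, indicator_of_notMem hz]
    rw [this]
    exact (hF.measurable r).stronglyMeasurable_mk.measurable.indicator hTm.compl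
  have hall : ∀ v, Measurable (Φ v) := by
    intro v
    obtain ⟨r, -, hr⟩ := Real.exists_seq_rat_strictMono_tendsto v
    refine measurable_of_tendsto_metrizable (fun n => hrat (r n)) (tendsto_pi_nhds.2 fun z => ?_)
    exact ((hcont z).tendsto v).comp hr.2
  have hunc := measurable_uncurry_of_continuous_of_measurable hcont hall
  have hmk := hw.stronglyMeasurable_mk.measurable
  refine ⟨fun z => Φ (hw.mk _ z) z, (hunc.comp (hmk.prodMk measurable_id)).stronglyMeasurable, ?_⟩
  have hTae : ∀ᵐ z ∂μ, z ∈ Tᶜ := by rw [ae_iff]; simpa using hT0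
  filter_upwards [hw.ae_eq_mk, hTae] with z hz hzT
  simp only [hΦ, indicator_of_mem hzT, ← hz]

/-- The origin of `A_p`: along functions of size `(1+t)^(-N/d)` the Lipschitz constant is of order
`(1+t)^(A - N(p-1)/d) = (1+t)^(-A_p-1)`. -/
lemma abs_sub_le (hF : NonlinearityCondition F Cs A p) {d a c t v₁ v₂ : ℝ}
    (ha : a = -A + N * (p - 1) / d - 1) (ht : 0 < t) (hc : 0 ≤ c)
    (h₁ : |v₁| ≤ c * (1 + t) ^ (-((N : ℝ) / d))) (h₂ : |v₂| ≤ c * (1 + t) ^ (-((N : ℝ) / d)))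
    (x : E N) :
    |F x t v₁ - F x t v₂| ≤ Cs * c ^ (p - 1) * (1 + t) ^ (-a - 1) * |v₁ - v₂| := by
  have hp : 0 ≤ p - 1 := by linarith [hF.one_le_p]
  have hCs := hF.Cs_pos
  have h1t : 0 < 1 + t := by linarith
  refine (hF.lipschitz x t ht v₁ v₂).trans ?_
  refine mul_le_mul_of_nonneg_right ?_ (abs_nonneg _)
  calc _ ≤ Cs * (1 + t) ^ A * (c * (1 + t) ^ (-((N : ℝ) / d))) ^ (p - 1) := by
        gcongr
        exact max_le (Real.rpow_le_rpow (abs_nonneg _) h₁ hp)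
          (Real.rpow_le_rpow (abs_nonneg _) h₂ hp)
    _ = Cs * c ^ (p - 1) * ((1 + t) ^ A * (1 + t) ^ (-((N : ℝ) / d) * (p - 1))) := by
        rw [Real.mul_rpow hc (by positivity), ← Real.rpow_mul h1t.le]; ring
    _ = _ := by
        rw [← Real.rpow_add h1t, ha]; congr 2; ring

end NonlinearityCondition

lemma inv_rpow_pow_eq {d s : ℝ} (hs : 0 < s) :
    (((1 + s) ^ (1 / d)) ^ N)⁻¹ = (1 + s) ^ (-((N : ℝ) / d)) := by
  have : 0 < 1 + s := by linarith
  rw [← Real.rpow_natCast, ← Real.rpow_mul this.le, one_div_mul_eq_div, Real.rpow_neg this.le]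

/-- Bounds at the parabolic scale: `w(t)` is bounded in `scaledL1` and `(1 + t) ^ (N/d) w(t)` is
bounded. -/
structure ParabolicBound (d K c : ℝ) (w : E N → ℝ → ℝ) : Prop where
  measurable : AEStronglyMeasurable (fun z : E N × ℝ => w z.1 z.2)
    (volume.restrict (univ ×ˢ Ioi (0 : ℝ)))
  nonneg : 0 ≤ c
  l1 : ∀ s : ℝ, 0 < s → scaledL1 K ((1 + s) ^ (1 / d)) (fun y => ‖w y s‖ₑ) ≤ ENNReal.ofReal c
  sup : ∀ s : ℝ, 0 < s → ∀ᵐ y, |w y s| ≤ c * (1 + s) ^ (-((N : ℝ) / d))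

lemma ParabolicBound.mono {d K c c' : ℝ} {w : E N → ℝ → ℝ} (hw : ParabolicBound d K c w)
    (h : c ≤ c') : ParabolicBound d K c' w where
  measurable := hw.measurable
  nonneg := hw.nonneg.trans h
  l1 s hs := (hw.l1 s hs).trans (ENNReal.ofReal_le_ofReal h)
  sup s hs := (hw.sup s hs).mono fun y hy => hy.trans (by gcongr)

lemma NonlinearityCondition.scaledL1_sub_le {F : E N → ℝ → ℝ → ℝ} {Cs A p : ℝ}
    (hF : NonlinearityCondition F Cs A p) {d a c K l s : ℝ}
    (ha : a = -A + N * (p - 1) / d - 1) (hs : 0 < s) (hc : 0 ≤ c) {v₁ v₂ : E N → ℝ}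
    (h₁ : ∀ᵐ y, |v₁ y| ≤ c * (1 + s) ^ (-((N : ℝ) / d)))
    (h₂ : ∀ᵐ y, |v₂ y| ≤ c * (1 + s) ^ (-((N : ℝ) / d))) :
    scaledL1 K l (fun y => ‖F y s (v₁ y) - F y s (v₂ y)‖ₑ) ≤
      ENNReal.ofReal (Cs * c ^ (p - 1) * (1 + s) ^ (-a - 1)) *
        scaledL1 K l (fun y => ‖v₁ y - v₂ y‖ₑ) := by
  have hCs := hF.Cs_pos
  unfold scaledL1
  rw [← lintegral_const_mul' _ _ ENNReal.ofReal_ne_top]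
  refine lintegral_mono_ae ?_
  filter_upwards [h₁, h₂] with y hy₁ hy₂
  rw [← mul_assoc]
  refine mul_le_mul_left ?_ _
  rw [← ofReal_norm, ← ofReal_norm, ← ENNReal.ofReal_mul (by positivity), Real.norm_eq_abs,
    Real.norm_eq_abs]
  exact ENNReal.ofReal_le_ofReal (hF.abs_sub_le ha hs hc hy₁ hy₂ y)

/-- The nonlinearity maps parabolic bounds to source bounds. -/
lemma ParabolicBound.exists_source {F : E N → ℝ → ℝ → ℝ} {Cs A p : ℝ}
    (hF : NonlinearityCondition F Cs A p) {d a c K : ℝ}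
    (ha : a = -A + N * (p - 1) / d - 1) {w : E N → ℝ → ℝ} (hw : ParabolicBound d K c w) :
    ∃ f : E N → ℝ → ℝ, SourceBound d K a (Cs * c ^ (p - 1) * c) f ∧
      (fun z : E N × ℝ => F z.1 z.2 (w z.1 z.2)) =ᵐ[volume.restrict (univ ×ˢ Ioi (0 : ℝ))]
        fun z => f z.1 z.2 := by
  have hm := hF.aestronglyMeasurable_comp hw.measurable
  have hCs := hF.Cs_pos
  have hc := hw.nonneg
  have hslice := ae_slice_of_ae hm.ae_eq_mk
  refine ⟨fun x t => hm.mk _ (x, t), ⟨hm.stronglyMeasurable_mk.measurable, ?_, ?_⟩, hm.ae_eq_mk⟩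
  · filter_upwards [hslice, ae_restrict_mem measurableSet_Ioi] with s hs hs0
    -- Comparison with `v₂ = 0`, where `F` vanishes, turns the Lipschitz estimate into a size
    -- estimate.
    have h0 : ∀ᵐ y : E N, |(fun _ => (0 : ℝ)) y| ≤ c * (1 + s) ^ (-((N : ℝ) / d)) :=
      .of_forall fun y => by
        have : (0 : ℝ) < s := hs0
        rw [abs_zero]; positivity
    have h1 := hF.scaledL1_sub_le (K := K) (l := (1 + s) ^ (1 / d)) ha hs0 hc (hw.sup s hs0) h0
    simp_rw [hF.zero _ s hs0, sub_zero] at h1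
    have h2 : scaledL1 K ((1 + s) ^ (1 / d)) (fun y => ‖hm.mk _ (y, s)‖ₑ) ≤
        scaledL1 K ((1 + s) ^ (1 / d)) (fun y => ‖F y s (w y s)‖ₑ) :=
      scaledL1_mono (hs.mono fun y hy => by rw [← hy])
    refine h2.trans (h1.trans ((mul_le_mul_right (hw.l1 s hs0) _).trans (le_of_eq ?_)))
    have : (0 : ℝ) < s := hs0
    rw [← ENNReal.ofReal_mul (by positivity)]
    congr 1; ring
  · filter_upwards [hslice, ae_restrict_mem measurableSet_Ioi] with s hs hs0
    have hs1 : (0 : ℝ) < s := hs0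
    filter_upwards [hs, hw.sup s hs0] with y hy hwy
    rw [← hy, ← ofReal_norm, Real.norm_eq_abs]
    have h1 := hF.abs_sub_le ha hs0 hc hwy (v₂ := 0)
      (by rw [abs_zero]; positivity) y
    rw [hF.zero y s hs0, sub_zero, sub_zero] at h1
    refine ENNReal.ofReal_le_ofReal (h1.trans ?_)
    rw [inv_rpow_pow_eq hs1]
    calc _ ≤ Cs * c ^ (p - 1) * (1 + s) ^ (-a - 1) * (c * (1 + s) ^ (-((N : ℝ) / d))) := by gcongr
      _ = _ := by ring

lemma HasDecayBound.exists_parabolicBound {d K : ℝ} (hK : 0 ≤ K)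
    {u : E N → ℝ → ℝ} (hu : HasDecayBound d K u)
    (hm : AEStronglyMeasurable (fun z : E N × ℝ => u z.1 z.2)
      (volume.restrict (univ ×ˢ Ioi (0 : ℝ))))
    (hms : ∀ s : ℝ, 0 < s → AEStronglyMeasurable (fun x => u x s) volume) :
    ∃ c : ℝ, ParabolicBound d K c u := by
  -- Three of the suprema suffice: `q = ∞` for the pointwise bound, and `ℓ = 0` together with `ℓ =
  -- K` for the weighted one, because the scaled weight is at most the sum of these two rescaled
  -- weights.
  have h0 := hu ∞ 0 le_top le_rfl hK
  have hK' := hu ∞ K le_top hK le_rfl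
  set S₁ := ⨆ t ∈ Ioi (0 : ℝ),
    ENNReal.ofReal ((1 + t) ^ lpExponent N d ∞) * eLpNorm (fun x => u x t) ∞ volume with hS₁
  set S₂ := ⨆ t ∈ Ioi (0 : ℝ),
    ENNReal.ofReal ((1 + t) ^ (-((0 : ℝ) / d))) * weightedNorm 0 (fun x => u x t) with hS₂
  set S₃ := ⨆ t ∈ Ioi (0 : ℝ),
    ENNReal.ofReal ((1 + t) ^ (-(K / d))) * weightedNorm K (fun x => u x t) with hS₃
  have hfin : S₁ + S₂ + S₃ ≠ ∞ := by
    refine (ENNReal.add_lt_top.2 ⟨h0, lt_of_le_of_lt le_add_self hK'⟩).ne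
  have hle : ∀ X, X ≤ S₁ + S₂ + S₃ → X ≤ ENNReal.ofReal (S₁ + S₂ + S₃).toReal := fun X hX => by
    rwa [ENNReal.ofReal_toReal hfin]
  refine ⟨(S₁ + S₂ + S₃).toReal, hm, ENNReal.toReal_nonneg, fun s hs => hle _ ?_, fun s hs => ?_⟩
  · have e₂ : ENNReal.ofReal ((1 + s) ^ (-((0 : ℝ) / d))) * weightedNorm 0 (fun x => u x s) ≤ S₂ :=
      le_iSup₂_of_le s hs le_rfl
    have e₃ : ENNReal.ofReal ((1 + s) ^ (-(K / d))) * weightedNorm K (fun x => u x s) ≤ S₃ :=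
      le_iSup₂_of_le s hs le_rfl
    have h1s : 0 < 1 + s := by linarith
    have hpt : ∀ x : E N, ENNReal.ofReal (scaledWeight K ((1 + s) ^ (1 / d)) x) ≤
        ENNReal.ofReal ((1 + s) ^ (-((0 : ℝ) / d))) * ENNReal.ofReal (1 + ‖x‖ ^ (0 : ℝ)) +
        ENNReal.ofReal ((1 + s) ^ (-(K / d))) * ENNReal.ofReal (1 + ‖x‖ ^ K) := by
      intro x
      rw [← ENNReal.ofReal_mul (by positivity), ← ENNReal.ofReal_mul (by positivity),
        ← ENNReal.ofReal_add (by positivity) (by positivity)]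
      apply ENNReal.ofReal_le_ofReal
      have h4 : (((1 + s) ^ (1 / d))⁻¹ * ‖x‖) ^ K = (1 + s) ^ (-(K / d)) * ‖x‖ ^ K := by
        rw [Real.mul_rpow (by positivity) (norm_nonneg x), ← Real.rpow_neg h1s.le,
          ← Real.rpow_mul h1s.le]
        congr 2; ring
      have h5 : 0 ≤ (1 + s) ^ (-(K / d)) := by positivity
      rw [scaledWeight, h4, zero_div, neg_zero, Real.rpow_zero, Real.rpow_zero]
      linarith
    calc _ ≤ ∫⁻ x, (ENNReal.ofReal ((1 + s) ^ (-((0 : ℝ) / d))) *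
            (‖u x s‖ₑ * ENNReal.ofReal (1 + ‖x‖ ^ (0 : ℝ))) +
          ENNReal.ofReal ((1 + s) ^ (-(K / d))) * (‖u x s‖ₑ * ENNReal.ofReal (1 + ‖x‖ ^ K))) := by
          refine lintegral_mono fun x => (mul_le_mul_right (hpt x) _).trans (le_of_eq ?_)
          ring
      _ ≤ ENNReal.ofReal ((1 + s) ^ (-((0 : ℝ) / d))) * weightedNorm 0 (fun x => u x s) +
          ENNReal.ofReal ((1 + s) ^ (-(K / d))) * weightedNorm K (fun x => u x s) := by
          have hmw : AEMeasurable fun x => ENNReal.ofReal ((1 + s) ^ (-((0 : ℝ) / d))) *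
              (‖u x s‖ₑ * ENNReal.ofReal (1 + ‖x‖ ^ (0 : ℝ))) :=
            ((hms s hs).enorm.mul (by fun_prop)).const_mul _
          rw [lintegral_add_left' hmw, lintegral_const_mul' _ _ ENNReal.ofReal_ne_top,
            lintegral_const_mul' _ _ ENNReal.ofReal_ne_top]
          rfl
      _ ≤ S₂ + S₃ := add_le_add e₂ e₃
      _ ≤ _ := by rw [add_assoc]; exact le_add_self
  · have e₁ : ENNReal.ofReal ((1 + s) ^ lpExponent N d ∞) * eLpNorm (fun x => u x s) ∞ volume ≤
      ENNReal.ofReal (S₁ + S₂ + S₃).toReal := hle _ ((le_iSup₂_of_le s hs le_rfl :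
        _ ≤ S₁).trans (by rw [add_assoc]; exact le_self_add))
    have h1s : 0 < 1 + s := by linarith
    have hexp : lpExponent N d ∞ = (N : ℝ) / d := by simp [lpExponent]
    rw [hexp, eLpNorm_exponent_top] at e₁
    have hess : ∀ᵐ y, ‖u y s‖ₑ ≤ eLpNormEssSup (fun x => u x s) volume := ae_le_eLpNormEssSup
    filter_upwards [hess] with y hy
    have h2 := (mul_le_mul_right hy _).trans e₁
    rw [← ofReal_norm, ← ENNReal.ofReal_mul (by positivity),
      ENNReal.ofReal_le_ofReal_iff ENNReal.toReal_nonneg, Real.norm_eq_abs] at h2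
    rw [Real.rpow_neg h1s.le, ← div_eq_mul_inv, le_div_iff₀ (by positivity), mul_comm]
    exact h2


/-! ### First modified moments -/

lemma Iio_pi_single {i : Fin N} : Finset.Iio (Pi.single i 1 : Fin N → ℕ) = {0} := by
  ext β
  rw [Finset.mem_Iio, Finset.mem_singleton]
  constructor
  · intro h
    have h1 : ∑ j, β j < ∑ j, (Pi.single i 1 : Fin N → ℕ) j := Fintype.sum_strictMono h
    rw [Finset.sum_pi_single' i 1 Finset.univ, if_pos (Finset.mem_univ i)] at h1
    have h2 : ∑ j, β j = 0 := by omega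
    ext j
    exact Finset.sum_eq_zero_iff.1 h2 j (Finset.mem_univ j)
  · rintro rfl
    refine lt_of_le_of_ne (fun j => Nat.zero_le _) fun h => ?_
    have := congrFun h i
    simp at this

lemma multiDeriv_zero (f : E N → ℝ) : multiDeriv (0 : Fin N → ℕ) f = f := by
  unfold multiDeriv
  generalize List.finRange N = l
  induction l with
  | nil => rfl
  | cons a l ih => simp

lemma modifiedMoment_zero (G : E N → ℝ → ℝ) (f : E N → ℝ) (t : ℝ) :
    modifiedMoment G f t 0 = ∫ x, f x := by
  rw [modifiedMoment]
  have : (Finset.Iio (0 : Fin N → ℕ)) = ∅ := by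
    ext β
    simp only [Finset.mem_Iio, Finset.notMem_empty, iff_false]
    exact not_lt_of_ge fun j => Nat.zero_le _
  rw [this]
  simp [monomialFun]

/-- Only `β = 0` lies strictly below a unit multi-index, and `g_0 = g`; the recursion stops after
one step. -/
lemma modifiedMoment_single (G : E N → ℝ → ℝ) (f : E N → ℝ) (t : ℝ) (i : Fin N) :
    modifiedMoment G f t (Pi.single i 1) =
      (∫ x : E N, f x * x i) - (∫ x, f x) * ∫ x : E N, shiftedKernel G x t * x i := by
  have hmon : ∀ x : E N, monomialFun (Pi.single i 1 : Fin N → ℕ) x = x i := by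
    intro x
    unfold monomialFun
    rw [Finset.prod_eq_single i]
    · simp
    · intro j _ hj; simp [hj]
    · simp
  have hker : ∀ x : E N, kernelDeriv G 0 x t = shiftedKernel G x t := by
    intro x
    simp [kernelDeriv, multiDeriv_zero]
  rw [modifiedMoment, Finset.sum_attach (Finset.Iio (Pi.single i 1 : Fin N → ℕ)) (fun β =>
    modifiedMoment G f t β * ∫ x : E N, monomialFun (Pi.single i 1) x * kernelDeriv G β x t),
    Iio_pi_single, Finset.sum_singleton, modifiedMoment_zero]
  simp_rw [hmon, hker]
  congr 1
  · exact integral_congr_ae (.of_forall fun x => mul_comm _ _)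
  · congr 1
    exact integral_congr_ae (.of_forall fun x => mul_comm _ _)

lemma enorm_le_sum_enorm (V : E N) : ‖V‖ₑ ≤ ∑ i, ‖V i‖ₑ := by
  have h : V = ∑ i, V i • EuclideanSpace.single i (1 : ℝ) := by
    ext j
    simp [Finset.sum_apply, Pi.single_apply]
  calc ‖V‖ₑ = ‖∑ i, V i • EuclideanSpace.single i (1 : ℝ)‖ₑ := by rw [← h]
    _ ≤ ∑ i, ‖V i • EuclideanSpace.single i (1 : ℝ)‖ₑ := enorm_sum_le _ _
    _ = _ := Finset.sum_congr rfl fun i _ => by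
      rw [enorm_smul, ← ofReal_norm (EuclideanSpace.single i (1 : ℝ))]; simp

/-- Centring removes `(∫ φ) g(s)`, so the coordinates of the first moment of the centred part are
the first modified moments of `φ`. This links the Taylor term to the hypothesis of part (ii). -/
lemma IsSemigroupProfile.enorm_integral_centred_smul_le {d L K : ℝ} {q : E N → ℝ}
    (hq : IsSemigroupProfile d L q) (hK : 1 ≤ K) (hKL : K < L) {s : ℝ} (hs : 0 < s)
    {φ : E N → ℝ} (hm : Measurable φ)
    (hfin : scaledL1 K ((1 + s) ^ (1 / d)) (fun y => ‖φ y‖ₑ) < ∞) :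
    ‖∫ y, centred d q φ s y • y‖ₑ ≤ ∑ i, ‖(∫ y : E N, φ y * y i) -
      (∫ y, φ y) * ∫ y : E N, selfSimilar d q y (s + 1) * y i‖ₑ := by
  have hK0 : 0 ≤ K := by linarith
  have h1s : 0 < s + 1 := by linarith
  have hl : 0 < (s + 1) ^ (1 / d) := by positivity
  have hqm : Measurable fun y => selfSimilar d q y (s + 1) :=
    (continuous_dilate hq.differentiable.continuous ((s + 1) ^ (1 / d))).measurable
  have hi1 : Integrable (fun y => φ y • y) :=
    integrable_smul_of_scaledL1 hK (by positivity : 0 < (1 + s) ^ (1 / d)) hm hfin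
  have hi2 : Integrable (fun y => selfSimilar d q y (s + 1) • y) := by
    obtain ⟨B, hB, h⟩ := hq.decay.exists_scaleNorm_le hK0 hKL
    refine integrable_smul_of_scaledL1 hK hl hqm ?_
    unfold selfSimilar
    rw [scaledL1_dilate_eq hl hq.measurable]
    exact (le_self_add.trans h).trans_lt ENNReal.ofReal_lt_top
  refine (enorm_le_sum_enorm _).trans (Finset.sum_le_sum fun i _ => le_of_eq ?_)
  congr 1
  have hV : ∫ y, centred d q φ s y • y =
      (∫ y, φ y • y) - (∫ z, φ z) • ∫ y, selfSimilar d q y (s + 1) • y := by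
    unfold centred
    simp_rw [sub_smul, mul_smul]
    have hi3 : Integrable fun y => (∫ z, φ z) • selfSimilar d q y (s + 1) • y :=
      (hi2.smul (∫ z, φ z)).congr (.of_forall fun _ => rfl)
    rw [integral_sub hi1 hi3, integral_smul]
  have hcoord : ∀ g : E N → ℝ, Integrable (fun y => g y • y) →
      (∫ y, g y • y) i = ∫ y : E N, g y * y i := by
    intro g hg
    have := (EuclideanSpace.proj (𝕜 := ℝ) i).integral_comp_comm hg
    simpa using this.symm
  rw [hV, PiLp.sub_apply, PiLp.smul_apply, hcoord _ hi1, hcoord _ hi2, smul_eq_mul]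


/-! ### Asymptotic profile of a solution -/

lemma isBigORate_of_le {D X : ℝ → ℝ≥0∞} {h : ℝ → ℝ} {B C : ℝ} (hB : 0 ≤ B) (hC : 0 ≤ C)
    (hD : ∀ᶠ t in atTop, D t ≤ ENNReal.ofReal B * X t)
    (hX : ∀ᶠ t in atTop, X t ≤ ENNReal.ofReal (C * h t)) (hh : ∀ᶠ t in atTop, 0 ≤ h t) :
    IsBigORate D h := by
  have hle : ∀ᶠ t in atTop, D t ≤ ENNReal.ofReal (B * C * h t) := by
    filter_upwards [hD, hX] with t h1 h2
    rw [mul_assoc, ENNReal.ofReal_mul hB]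
    exact h1.trans (mul_le_mul_right h2 _)
  refine ⟨hle.mono fun t ht => ht.trans_lt ENNReal.ofReal_lt_top, ?_⟩
  refine IsBigO.of_bound (B * C) ?_
  filter_upwards [hle, hh] with t ht hht
  rw [Real.norm_of_nonneg ENNReal.toReal_nonneg, Real.norm_of_nonneg hht]
  exact ENNReal.toReal_le_of_le_ofReal (by positivity) ht

lemma isBigOAddBigORate_of_le {D X : ℝ → ℝ≥0∞} {h₁ h₂ : ℝ → ℝ} {B C : ℝ} (hB : 0 ≤ B)
    (hC : 0 ≤ C) (hD : ∀ᶠ t in atTop, D t ≤ ENNReal.ofReal B * X t)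
    (hX : ∀ᶠ t in atTop, X t ≤ ENNReal.ofReal (C * (h₁ t + h₂ t)))
    (hh₁ : ∀ᶠ t in atTop, 0 ≤ h₁ t) (hh₂ : ∀ᶠ t in atTop, 0 ≤ h₂ t) :
    IsBigOAddBigORate D h₁ h₂ := by
  have hle : ∀ᶠ t in atTop, D t ≤ ENNReal.ofReal (B * C * (h₁ t + h₂ t)) := by
    filter_upwards [hD, hX] with t h1 h2
    rw [mul_assoc, ENNReal.ofReal_mul hB]
    exact h1.trans (mul_le_mul_right h2 _)
  refine ⟨hle.mono fun t ht => ht.trans_lt ENNReal.ofReal_lt_top,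
    -- The first summand is `D` capped at its share `B C h₁`. What exceeds the cap is then at most
    -- `B C h₂`.
    fun t => min (D t).toReal (B * C * h₁ t), fun t => (D t).toReal -
      min (D t).toReal (B * C * h₁ t), ?_, ?_, .of_forall fun t => by simp only; ring⟩
  · refine IsBigO.of_bound (B * C) ?_
    filter_upwards [hh₁] with t h1
    have : 0 ≤ B * C * h₁ t := by positivity
    rw [Real.norm_of_nonneg (le_min ENNReal.toReal_nonneg this), Real.norm_of_nonneg h1]
    exact min_le_right _ _
  · refine IsBigO.of_bound (B * C) ?_
    filter_upwards [hle, hh₁, hh₂] with t ht h1 h2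
    have h3 : (D t).toReal ≤ B * C * (h₁ t + h₂ t) :=
      ENNReal.toReal_le_of_le_ofReal (by positivity) ht
    have h4 : 0 ≤ B * C * h₂ t := by positivity
    rw [Real.norm_of_nonneg (sub_nonneg.2 (min_le_left _ _)), Real.norm_of_nonneg h2]
    rcases min_cases (D t).toReal (B * C * h₁ t) with h | h <;> rw [h.1] <;> linarith

/-- The little-o summand is taken to be zero; this serves `A_p < K/d`, where `t^(-A_p)` dominates.
In the complementary range the big-O summand is zero instead. -/
lemma isLittleOAddBigORate_of_le {D X : ℝ → ℝ≥0∞} {h₁ h₂ : ℝ → ℝ} {B C : ℝ} (hB : 0 ≤ B)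
    (hC : 0 ≤ C) (hD : ∀ᶠ t in atTop, D t ≤ ENNReal.ofReal B * X t)
    (hX : ∀ᶠ t in atTop, X t ≤ ENNReal.ofReal (C * h₂ t)) (hh₂ : ∀ᶠ t in atTop, 0 ≤ h₂ t) :
    IsLittleOAddBigORate D h₁ h₂ := by
  obtain ⟨h1, h2⟩ := isBigORate_of_le hB hC hD hX hh₂
  exact ⟨h1, fun _ => 0, _, isLittleO_zero _ _, h2, .of_forall fun t => by simp⟩

lemma isLittleOAddBigORate_of_tendsto {D X : ℝ → ℝ≥0∞} {h₂ : ℝ → ℝ} {B κ : ℝ}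
    (hD : ∀ᶠ t in atTop, D t ≤ ENNReal.ofReal B * X t)
    (hX : Tendsto (fun t : ℝ => ENNReal.ofReal (t ^ κ) * X t) atTop (𝓝 0)) :
    IsLittleOAddBigORate D (fun t => t ^ (-κ)) h₂ := by
  have hlim := ENNReal.Tendsto.const_mul hX (a := ENNReal.ofReal B) (Or.inr ENNReal.ofReal_ne_top)
  rw [mul_zero] at hlim
  have hDlim : Tendsto (fun t : ℝ => ENNReal.ofReal (t ^ κ) * D t) atTop (𝓝 0) := by
    refine tendsto_of_tendsto_of_tendsto_of_le_of_le' tendsto_const_nhds hlim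
      (.of_forall fun _ => zero_le) ?_
    filter_upwards [hD] with t ht
    rw [mul_left_comm]
    gcongr
  have hfin : ∀ᶠ t in atTop, D t < ∞ := by
    filter_upwards [hDlim.eventually_lt_const ENNReal.zero_lt_top, eventually_gt_atTop 0]
      with t ht ht0
    rcases ENNReal.mul_lt_top_iff.1 ht with h | h | h
    · exact h.2
    · exact absurd h (by simp only [ENNReal.ofReal_eq_zero, not_le]; positivity)
    · rw [h]; exact ENNReal.zero_lt_top
  refine ⟨hfin, fun t => (D t).toReal, fun _ => 0, ?_, isBigO_zero _ _,
    .of_forall fun t => by simp⟩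
  have hreal := (ENNReal.tendsto_toReal ENNReal.zero_ne_top).comp hDlim
  refine (isLittleO_iff_tendsto' ?_).2 ?_
  · filter_upwards [eventually_gt_atTop 0] with t ht h
    exact absurd h (by positivity)
  · refine hreal.congr' ?_
    filter_upwards [eventually_gt_atTop 0] with t ht
    simp only [Function.comp_apply, ENNReal.toReal_mul]
    rw [ENNReal.toReal_ofReal (by positivity), Real.rpow_neg ht.le, div_inv_eq_mul, mul_comm]

/-! ### Solutions with Borel representatives of data and source, and their distance to `M g`. -/

section Solution

variable {γ : ℕ} {d L Cs A p a K : ℝ} {G : E N → ℝ → ℝ} {F : E N → ℝ → ℝ → ℝ} {φ ψ : E N → ℝ}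
  {u f : E N → ℝ → ℝ}

lemma IsGlobalSolution.equation_of_ae_eq (hG : KernelCondition G γ d L)
    (hu : IsGlobalSolution G F φ u) (hφ : φ =ᵐ[volume] ψ)
    (hf : (fun z : E N × ℝ => F z.1 z.2 (u z.1 z.2))
      =ᵐ[volume.restrict (univ ×ˢ Ioi (0 : ℝ))] fun z => f z.1 z.2) {t : ℝ} (ht : 0 < t) :
    ∀ᵐ x, u x t = (∫ y, selfSimilar d (fun y => G y 1) (x - y) t * ψ y) +
      ∫ s in (0 : ℝ)..t, ∫ y, selfSimilar d (fun y => G y 1) (x - y) (t - s) * f y s := by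
  filter_upwards [hu.equation t ht] with x hx
  rw [hx]
  congr 1
  · refine integral_congr_ae (hφ.mono fun y hy => ?_)
    simp only [hy, hG.eq_selfSimilar ht]
  · rw [intervalIntegral.integral_of_le ht.le, intervalIntegral.integral_of_le ht.le,
      -- The endpoint `s = t` is dropped: the kernel would be taken at time zero, where the
      -- self-similar formula is not available.
      integral_Ioc_eq_integral_Ioo, integral_Ioc_eq_integral_Ioo]
    refine integral_congr_ae ?_
    filter_upwards [ae_restrict_of_ae_restrict_of_subset Ioo_subset_Ioi_self (ae_slice_of_ae hf),
      ae_restrict_mem measurableSet_Ioo] with s hs hs0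
    refine integral_congr_ae (hs.mono fun y hy => ?_)
    simp only [hG.eq_selfSimilar (sub_pos.2 hs0.2)]
    rw [hy]

/-- Joint measurability alone controls almost every time. The integral equation represents `u(t)` by
a measurable function at every `t > 0`. -/
lemma IsGlobalSolution.aestronglyMeasurable_slice (hG : KernelCondition G γ d L)
    (hF : NonlinearityCondition F Cs A p) (hu : IsGlobalSolution G F φ u)
    (hφ : AEStronglyMeasurable φ volume) {t : ℝ} (ht : 0 < t) :
    AEStronglyMeasurable (fun x => u x t) volume := by
  have hm := hF.aestronglyMeasurable_comp hu.measurable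
  have hq := hG.isSemigroupProfile.measurable
  have hfm : Measurable (Function.uncurry fun x t => hm.mk _ (x, t)) :=
    hm.stronglyMeasurable_mk.measurable
  have heq := hu.equation_of_ae_eq (ψ := hφ.mk φ) (f := fun x t => hm.mk _ (x, t)) hG hφ.ae_eq_mk
    hm.ae_eq_mk ht
  refine ⟨_, StronglyMeasurable.add (measurable_selfSimilar_conv d
    hφ.stronglyMeasurable_mk.measurable hq t).stronglyMeasurable ?_, heq⟩
  simp_rw [intervalIntegral.integral_of_le ht.le]
  exact StronglyMeasurable.integral_prod_right (stronglyMeasurable_conv d hfm hq t)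

/-- The multiple of the kernel that describes the large-time behaviour. -/
def asymptoticMass (G : E N → ℝ → ℝ) (F : E N → ℝ → ℝ → ℝ) (φ : E N → ℝ) (u : E N → ℝ → ℝ) : ℝ :=
  ((∫ x, φ x) + ∫ t in Ioi (0 : ℝ), ∫ x, F x t (u x t)) * ∫ x, G x 1

/-- The factor `∫ G(·,1)` in `asymptoticMass` makes it zero for `G ≡ 0` and is one otherwise.
Against `G` it can be dropped in either case. -/
lemma KernelCondition.asymptoticMass_mul (hG : KernelCondition G γ d L) {t : ℝ} (ht : 0 < t)
    (hφ : φ =ᵐ[volume] ψ)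
    (hf : (fun z : E N × ℝ => F z.1 z.2 (u z.1 z.2))
      =ᵐ[volume.restrict (univ ×ˢ Ioi (0 : ℝ))] fun z => f z.1 z.2) (x : E N) :
    asymptoticMass G F φ u * shiftedKernel G x t =
      ((∫ x, ψ x) + ∫ t in Ioi (0 : ℝ), ∫ x, f x t) *
        selfSimilar d (fun y => G y 1) x (t + 1) := by
  have h1 : ∫ x, φ x = ∫ x, ψ x := integral_congr_ae hφ
  have h2 : ∫ t in Ioi (0 : ℝ), ∫ x, F x t (u x t) = ∫ t in Ioi (0 : ℝ), ∫ x, f x t :=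
    integral_congr_ae ((ae_slice_of_ae hf).mono fun s hs => integral_congr_ae hs)
  have h3 := hG.mul_eq_zero x (by linarith : 0 < t + 1)
  rw [asymptoticMass, h1, h2, shiftedKernel, ← hG.eq_selfSimilar (by linarith : 0 < t + 1)]
  linear_combination (-((∫ x, ψ x) + ∫ t in Ioi (0 : ℝ), ∫ x, f x t)) * h3

/-- The solution represented by measurable data and a measurable source. -/
structure SourceRepresentation (G : E N → ℝ → ℝ) (F : E N → ℝ → ℝ → ℝ) (φ : E N → ℝ)
    (u : E N → ℝ → ℝ) (d K a c C : ℝ) (ψ : E N → ℝ) (f : E N → ℝ → ℝ) : Prop where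
  bound : ParabolicBound d K c u
  nonneg : 0 ≤ C
  source : SourceBound d K a C f
  source_eq : (fun z : E N × ℝ => F z.1 z.2 (u z.1 z.2))
      =ᵐ[volume.restrict (univ ×ˢ Ioi (0 : ℝ))] fun z => f z.1 z.2
  data_measurable : Measurable ψ
  data_eq : φ =ᵐ[volume] ψ
  data_l1 : scaledL1 K 1 (fun x => ‖ψ x‖ₑ) < ∞
  slice_measurable : ∀ t : ℝ, 0 < t → AEStronglyMeasurable (fun x => u x t) volume

lemma exists_sourceRepresentation (hG : KernelCondition G γ d L) (hK : 0 ≤ K)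
    (hφ : AEStronglyMeasurable φ volume) (hφK : weightedNorm K φ < ∞)
    (hF : NonlinearityCondition F Cs A p) (ha : a = -A + N * (p - 1) / d - 1)
    (hu : IsGlobalSolution G F φ u) (hub : HasDecayBound d K u) :
    ∃ (c C : ℝ) (ψ : E N → ℝ) (f : E N → ℝ → ℝ), SourceRepresentation G F φ u d K a c C ψ f := by
  have hs : ∀ t : ℝ, 0 < t → AEStronglyMeasurable (fun x => u x t) volume := fun t ht =>
    hu.aestronglyMeasurable_slice hG hF hφ ht
  obtain ⟨c, hc⟩ := hub.exists_parabolicBound hK hu.measurable hs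
  obtain ⟨f, hf, hfeq⟩ := hc.exists_source hF ha
  have hCs := hF.Cs_pos
  have hc0 := hc.nonneg
  refine ⟨c, _, hφ.mk φ, f, hc, by positivity, hf, hfeq, hφ.stronglyMeasurable_mk.measurable,
    hφ.ae_eq_mk, ?_, hs⟩
  rw [weightedNorm_eq_scaledL1] at hφK
  exact (scaledL1_mono (hφ.ae_eq_mk.mono fun x hx => by rw [← hx])).trans_lt hφK

namespace SourceRepresentation

variable {c C : ℝ}

lemma exists_profileDist_le (h : SourceRepresentation G F φ u d K a c C ψ f)
    (hG : KernelCondition G γ d L) (hK : 0 ≤ K) (hKL : K < L) (ha : 0 < a)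
    (hu : IsGlobalSolution G F φ u) :
    ∃ B : ℝ, 0 ≤ B ∧ ∀ t : ℝ, 1 ≤ t → profileDist K (t ^ (1 / d))
      (fun x => u x t - asymptoticMass G F φ u * shiftedKernel G x t) ≤
        scaleNorm K (t ^ (1 / d)) (fun x => ‖propagationError d (fun y => G y 1) ψ 0 t x‖ₑ) +
        nearError d K (fun y => G y 1) f t + ENNReal.ofReal (B * t ^ (-a)) := by
  obtain ⟨B, hB, hle⟩ := hG.isSemigroupProfile.exists_profileDist_le hK hKL ha h.nonneg
  refine ⟨B, hB, fun t ht => ?_⟩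
  have ht0 : 0 < t := by linarith
  simp_rw [hG.asymptoticMass_mul ht0 h.data_eq h.source_eq]
  exact hle ψ f (fun x => u x t) t ht h.source h.data_measurable
    (hu.equation_of_ae_eq hG h.data_eq h.source_eq ht0)

lemma exists_data_le (h : SourceRepresentation G F φ u d K a c C ψ f)
    (hG : KernelCondition G γ d L) (hK : 0 ≤ K) (hKL : K < L) {κ : ℝ} (hκ : 0 ≤ κ) (hκ1 : κ ≤ 1)
    (hκK : κ ≤ K) :
    ∃ B : ℝ, 0 ≤ B ∧ ∀ t : ℝ, 1 ≤ t → scaleNorm K (t ^ (1 / d))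
      (fun x => ‖propagationError d (fun y => G y 1) ψ 0 t x‖ₑ) ≤
        ENNReal.ofReal (B * t ^ (-(κ / d))) := by
  obtain ⟨B, hB, hle⟩ := hG.isSemigroupProfile.exists_scaleNorm_error_le hK hKL hκ hκ1 hκK
  refine ⟨B * (scaledL1 K 1 (fun x => ‖ψ x‖ₑ)).toReal, by positivity, fun t ht => ?_⟩
  have ht0 : 0 < t := by linarith
  have h1 := hle 0 t ψ le_rfl (by linarith) ht h.data_measurable
    (integrable_of_scaledL1 zero_le_one h.data_measurable h.data_l1)
  rw [add_zero, Real.one_rpow] at h1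
  refine h1.trans (le_of_eq ?_)
  rw [mul_right_comm B, ENNReal.ofReal_mul (p := B * t ^ (-(κ / d))) (by positivity),
    ENNReal.ofReal_toReal h.data_l1.ne,
    one_div, Real.inv_rpow ht0.le, Real.rpow_neg ht0.le]

lemma tendsto_data (h : SourceRepresentation G F φ u d K a c C ψ f)
    (hG : KernelCondition G γ d L) (hK : 0 ≤ K) (hKL : K < L) (hK1 : K < 1) :
    Tendsto (fun t : ℝ => ENNReal.ofReal (t ^ (K / d)) * scaleNorm K (t ^ (1 / d))
      (fun x => ‖propagationError d (fun y => G y 1) ψ 0 t x‖ₑ)) atTop (𝓝 0) := by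
  have hq := hG.isSemigroupProfile
  obtain ⟨B, hB, hle⟩ := hq.exists_scaleNorm_error_le_modulusIntegral hK hKL
  have h1 := hq.tendsto_modulusIntegral hK hK1 hKL le_rfl h.data_measurable
    (by rw [add_zero, Real.one_rpow]; exact h.data_l1)
  have h2 := ENNReal.Tendsto.const_mul h1 (a := ENNReal.ofReal B) (Or.inr ENNReal.ofReal_ne_top)
  rw [mul_zero] at h2
  refine tendsto_of_tendsto_of_tendsto_of_le_of_le' tendsto_const_nhds h2
    (.of_forall fun _ => zero_le) ?_
  filter_upwards [eventually_gt_atTop 0] with t ht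
  rw [mul_left_comm]
  gcongr
  exact hle 0 t ψ le_rfl (by linarith) ht h.data_measurable
    (integrable_of_scaledL1 zero_le_one h.data_measurable h.data_l1)

/-- For `K < 1` and `K / d < a` the distance is `o(t ^ (-K/d))`. -/
lemma tendsto_profileDist (h : SourceRepresentation G F φ u d K a c C ψ f)
    (hG : KernelCondition G γ d L) (hK : 0 ≤ K) (hKL : K < L) (hK1 : K < 1) (ha : 0 < a)
    (haK : K / d < a) (hu : IsGlobalSolution G F φ u) :
    Tendsto (fun t : ℝ => ENNReal.ofReal (t ^ (K / d)) * profileDist K (t ^ (1 / d))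
      (fun x => u x t - asymptoticMass G F φ u * shiftedKernel G x t)) atTop (𝓝 0) := by
  obtain ⟨B, hB, hle⟩ := h.exists_profileDist_le hG hK hKL ha hu
  have h1 := h.tendsto_data hG hK hKL hK1
  have h2 := hG.isSemigroupProfile.tendsto_nearError hK hK1 hKL h.nonneg haK h.source
  have h3 : Tendsto (fun t : ℝ => ENNReal.ofReal (B * t ^ (-(a - K / d)))) atTop (𝓝 0) := by
    have := ENNReal.tendsto_ofReal ((tendsto_rpow_neg_atTop (sub_pos.2 haK)).const_mul B)
    simpa using this
  have h4 := (h1.add h2).add h3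
  simp only [add_zero] at h4
  refine tendsto_of_tendsto_of_tendsto_of_le_of_le' tendsto_const_nhds h4
    (.of_forall fun _ => zero_le) ?_
  filter_upwards [eventually_ge_atTop 1] with t ht
  have ht0 : 0 < t := by linarith
  refine (mul_le_mul_right (hle t ht) _).trans (le_of_eq ?_)
  rw [mul_add, mul_add, ← ENNReal.ofReal_mul (by positivity)]
  congr 2
  rw [mul_left_comm, ← Real.rpow_add ht0]
  congr 2; ring

/-- The distance is `O(t ^ (-κ/d)) + O(t ^ (-a))` off resonance. -/
lemma exists_profileDist_le_of_ne (h : SourceRepresentation G F φ u d K a c C ψ f)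
    (hG : KernelCondition G γ d L) (hK : 0 ≤ K) (hKL : K < L) {κ : ℝ} (hκ : 0 ≤ κ) (hκ1 : κ ≤ 1)
    (hκK : κ ≤ K) (ha : 0 < a) (hne : a ≠ κ / d) (hu : IsGlobalSolution G F φ u) :
    ∃ B : ℝ, 0 ≤ B ∧ ∀ t : ℝ, 1 ≤ t → profileDist K (t ^ (1 / d))
      (fun x => u x t - asymptoticMass G F φ u * shiftedKernel G x t) ≤
        ENNReal.ofReal (B * (t ^ (-(κ / d)) + t ^ (-a))) := by
  obtain ⟨B₁, hB₁, h₁⟩ := h.exists_profileDist_le hG hK hKL ha hu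
  obtain ⟨B₂, hB₂, h₂⟩ := h.exists_data_le hG hK hKL hκ hκ1 hκK
  obtain ⟨B₃, hB₃, h₃⟩ := hG.isSemigroupProfile.exists_nearError_le_of_ne hK hKL hκ hκ1 hκK
    h.nonneg hne h.source
  refine ⟨B₁ + B₂ + B₃, by positivity, fun t ht => ?_⟩
  have ht0 : 0 < t := by linarith
  refine (h₁ t ht).trans ((add_le_add_left (add_le_add (h₂ t ht) (h₃ t ht)) _).trans ?_)
  rw [← ENNReal.ofReal_add (by positivity) (by positivity),
    ← ENNReal.ofReal_add (by positivity) (by positivity)]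
  apply ENNReal.ofReal_le_ofReal
  have e1 : 0 ≤ t ^ (-(κ / d)) := by positivity
  have e2 : 0 ≤ t ^ (-a) := by positivity
  nlinarith [mul_nonneg hB₁ e1, mul_nonneg hB₂ e2]

/-- The distance is `O(t ^ (-κ/d) (1 + log t))` at resonance. -/
lemma exists_profileDist_le_of_eq (h : SourceRepresentation G F φ u d K a c C ψ f)
    (hG : KernelCondition G γ d L) (hK : 0 ≤ K) (hKL : K < L) {κ : ℝ} (hκ : 0 ≤ κ) (hκ1 : κ ≤ 1)
    (hκK : κ ≤ K) (ha : 0 < a) (heq : a = κ / d) (hu : IsGlobalSolution G F φ u) :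
    ∃ B : ℝ, 0 ≤ B ∧ ∀ t : ℝ, 1 ≤ t → profileDist K (t ^ (1 / d))
      (fun x => u x t - asymptoticMass G F φ u * shiftedKernel G x t) ≤
        ENNReal.ofReal (B * (t ^ (-(κ / d)) * (1 + Real.log t))) := by
  obtain ⟨B₁, hB₁, h₁⟩ := h.exists_profileDist_le hG hK hKL ha hu
  obtain ⟨B₂, hB₂, h₂⟩ := h.exists_data_le hG hK hKL hκ hκ1 hκK
  obtain ⟨B₃, hB₃, h₃⟩ := hG.isSemigroupProfile.exists_nearError_le_of_eq hK hKL hκ hκ1 hκK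
    h.nonneg heq h.source
  refine ⟨B₁ + B₂ + B₃, by positivity, fun t ht => ?_⟩
  have ht0 : 0 < t := by linarith
  have hlog := Real.log_nonneg ht
  refine (h₁ t ht).trans ((add_le_add_left (add_le_add (h₂ t ht) (h₃ t ht)) _).trans ?_)
  rw [← ENNReal.ofReal_add (by positivity) (by positivity),
    ← ENNReal.ofReal_add (by positivity) (by positivity)]
  apply ENNReal.ofReal_le_ofReal
  have e1 : 0 ≤ t ^ (-(κ / d)) * Real.log t := by positivity
  rw [heq]
  nlinarith [mul_nonneg hB₁ e1, mul_nonneg hB₂ e1]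

end SourceRepresentation

end Solution


/-! ### The resonant case under a moment condition -/

/-- Valid for every order below `L`, including orders above that of the moments assumed for `u`;
this is the advantage of `M g` over `u` at resonance. -/
lemma KernelCondition.exists_parabolicBound {γ : ℕ} {d L K : ℝ} {G : E N → ℝ → ℝ}
    (hG : KernelCondition G γ d L) (hK : 0 ≤ K) (hKL : K < L) (M : ℝ) :
    ∃ c : ℝ, ParabolicBound d K c (fun x t => M * shiftedKernel G x t) := by
  have hq := hG.isSemigroupProfile
  obtain ⟨B, hB, hqB⟩ := hq.decay.exists_scaleNorm_le hK hKL
  obtain ⟨C, hC, hb⟩ := hq.decay.exists_bound (hK.trans hKL.le)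
  have heq : ∀ (s : ℝ), 0 < s → ∀ x, shiftedKernel G x s =
      dilate ((1 + s) ^ (1 / d)) (fun y => G y 1) x := fun s hs x => by
    rw [shiftedKernel, hG.eq_selfSimilar (by linarith), selfSimilar, add_comm]
  refine ⟨|M| * (B + C), ?_, by positivity, fun s hs => ?_, fun s hs => ?_⟩
  · refine ⟨fun z => M * selfSimilar d (fun y => G y 1) z.1 (z.2 + 1), ?_, ?_⟩
    · exact (((measurable_selfSimilar d hq.measurable).comp
        (by fun_prop : Measurable fun z : E N × ℝ => (z.1, z.2 + 1))).const_mul M).stronglyMeasurable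
    · filter_upwards [ae_restrict_mem (MeasurableSet.univ.prod measurableSet_Ioi)] with z hz
      have hz2 : 0 < z.2 := hz.2
      rw [shiftedKernel, hG.eq_selfSimilar (by linarith)]
  · have hl : 0 < (1 + s) ^ (1 / d) := by positivity
    simp_rw [heq s hs, enorm_mul]
    rw [scaledL1_const_mul _ (continuous_dilate hq.differentiable.continuous _).measurable.enorm,
      scaledL1_dilate_eq hl hq.measurable, ← ofReal_norm, Real.norm_eq_abs,
      ENNReal.ofReal_mul (abs_nonneg M)]
    gcongr
    exact (le_self_add.trans hqB).trans (ENNReal.ofReal_le_ofReal (by linarith))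
  · refine .of_forall fun y => ?_
    rw [heq s hs, dilate, inv_rpow_pow_eq hs, abs_mul, abs_mul, mul_assoc,
      abs_of_nonneg (by positivity : 0 ≤ (1 + s) ^ (-((N : ℝ) / d))),
      mul_comm ((1 + s) ^ (-((N : ℝ) / d)))]
    gcongr
    exact (hb _).trans (by linarith)

lemma profileDist_scaledL1_le {K d : ℝ} (hK : 0 ≤ K) (hd : 0 < d) {s : ℝ} (hs : 0 < s)
    (v : E N → ℝ) :
    scaledL1 K ((1 + s) ^ (1 / d)) (fun y => ‖v y‖ₑ) ≤ profileDist K (s ^ (1 / d)) v := by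
  refine le_trans ?_ le_self_add
  exact scaledL1_anti hK (by positivity) (by gcongr; linarith) _

/-- A logarithmic rate at scale `t` gives a power rate of half the exponent for all times. -/
lemma exists_rpow_bound_of_log {d B c : ℝ} (hd : 0 < d) (hB : 0 ≤ B) (hc : 0 ≤ c) {X : ℝ → ℝ≥0∞}
    (h₁ : ∀ s, 0 < s → X s ≤ ENNReal.ofReal c)
    (h₂ : ∀ s, 1 ≤ s → X s ≤ ENNReal.ofReal (B * (s ^ (-(1 / d)) * (1 + Real.log s)))) :
    ∃ C : ℝ, 0 ≤ C ∧ ∀ s, 0 < s → X s ≤ ENNReal.ofReal (C * (1 + s) ^ (-(1 / (2 * d)))) := by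
  -- Half of the exponent `1/d` is sacrificed to absorb the logarithm via `log s ≤ s^δ / δ`, and
  -- `t^(-1/d) t^δ = t^(-δ)`. The factors `2 ^ δ` in the constant replace `s` by `1 + s`.
  set δ := 1 / (2 * d) with hδ
  have hδ0 : 0 < δ := by positivity
  refine ⟨max (c * 2 ^ δ) (B * (1 + 1 / δ) * 2 ^ δ), by positivity, fun s hs => ?_⟩
  rcases le_total s 1 with h | h
  · refine (h₁ s hs).trans (ENNReal.ofReal_le_ofReal ?_)
    calc c = c * 2 ^ δ * 2 ^ (-δ) := by
          rw [mul_assoc, ← Real.rpow_add (by norm_num)]; simp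
      _ ≤ max (c * 2 ^ δ) (B * (1 + 1 / δ) * 2 ^ δ) * (1 + s) ^ (-δ) := by
          refine mul_le_mul (le_max_left _ _) ?_ (by positivity) (by positivity)
          exact Real.rpow_le_rpow_of_nonpos (by linarith) (by linarith) (by linarith)
  · refine (h₂ s h).trans (ENNReal.ofReal_le_ofReal ?_)
    have hlog : 1 + Real.log s ≤ (1 + 1 / δ) * s ^ δ := by
      have h3 := Real.log_le_rpow_div hs.le hδ0
      have h4 : 1 ≤ s ^ δ := Real.one_le_rpow h hδ0.le
      calc _ ≤ s ^ δ + s ^ δ / δ := add_le_add h4 h3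
        _ = _ := by ring
    have h5 : s ^ (-δ) ≤ 2 ^ δ * (1 + s) ^ (-δ) := by
      calc s ^ (-δ) ≤ ((1 + s) / 2) ^ (-δ) :=
            Real.rpow_le_rpow_of_nonpos (by positivity) (by linarith) (by linarith)
        _ = _ := by
          rw [Real.div_rpow (by positivity) (by norm_num), Real.rpow_neg (by norm_num : (0:ℝ) ≤ 2)]
          field_simp
    calc B * (s ^ (-(1 / d)) * (1 + Real.log s))
        ≤ B * (s ^ (-(1 / d)) * ((1 + 1 / δ) * s ^ δ)) := by gcongr
      _ = B * (1 + 1 / δ) * (s ^ (-(1 / d)) * s ^ δ) := by ring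
      _ = B * (1 + 1 / δ) * s ^ (-δ) := by
          rw [← Real.rpow_add hs]; congr 2; rw [hδ]; field_simp; ring
      _ ≤ B * (1 + 1 / δ) * (2 ^ δ * (1 + s) ^ (-δ)) := by gcongr
      _ = (B * (1 + 1 / δ) * 2 ^ δ) * (1 + s) ^ (-δ) := by ring
      _ ≤ _ := by gcongr; exact le_max_right _ _

/-! ### Removing the logarithm at resonance. -/

section Moment

variable {γ : ℕ} {d L Cs A p a K c C : ℝ} {G : E N → ℝ → ℝ} {F : E N → ℝ → ℝ → ℝ}
  {φ ψ : E N → ℝ} {u f : E N → ℝ → ℝ}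

lemma lintegral_moment_lt_top (hG : KernelCondition G γ d L) (hK : 1 ≤ K) (hKL : K < L)
    {w : E N → ℝ → ℝ} (hf : SourceBound d K a C f)
    (hfw : (fun z : E N × ℝ => w z.1 z.2)
      =ᵐ[volume.restrict (univ ×ˢ Ioi (0 : ℝ))] fun z => f z.1 z.2)
    (hmom : ∀ α : Fin N → ℕ, ∑ i, α i = 1 →
      IntegrableOn (fun t : ℝ => modifiedMoment G (fun x => w x t) t α) (Ioi 0) volume) :
    ∫⁻ s in Ioi (0 : ℝ), ‖∫ y, centred d (fun y => G y 1) (fun y => f y s) s y • y‖ₑ < ∞ := by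
  have hmi : ∀ i : Fin N, IntegrableOn
      (fun t : ℝ => modifiedMoment G (fun x => w x t) t (Pi.single i 1)) (Ioi 0) volume :=
    fun i => hmom _ (by rw [Finset.sum_pi_single' i 1 Finset.univ, if_pos (Finset.mem_univ i)])
  have hle : ∀ᵐ s ∂volume.restrict (Ioi (0 : ℝ)),
      ‖∫ y, centred d (fun y => G y 1) (fun y => f y s) s y • y‖ₑ ≤
      ∑ i, ‖modifiedMoment G (fun x => w x s) s (Pi.single i 1)‖ₑ := by
    filter_upwards [hf.l1, ae_slice_of_ae hfw, ae_restrict_mem measurableSet_Ioi] with s hs hs2 hs0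
    have hs1 : 0 < s := hs0
    refine (hG.isSemigroupProfile.enorm_integral_centred_smul_le hK hKL hs0
      (hf.measurable_section s) (hs.trans_lt ENNReal.ofReal_lt_top)).trans (le_of_eq ?_)
    refine Finset.sum_congr rfl fun i _ => ?_
    rw [modifiedMoment_single]
    have e1 : ∫ x, w x s = ∫ x, f x s := integral_congr_ae hs2
    have e2 : ∫ x : E N, w x s * x i = ∫ x : E N, f x s * x i :=
      integral_congr_ae (hs2.mono fun y hy => by simp only at hy ⊢; rw [hy])
    have e3 : ∫ x : E N, shiftedKernel G x s * x i =
        ∫ x : E N, selfSimilar d (fun y => G y 1) x (s + 1) * x i :=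
      integral_congr_ae (.of_forall fun x => by
        simp only [shiftedKernel, hG.eq_selfSimilar (by linarith : 0 < s + 1)])
    rw [e1, e2, e3]
  refine (lintegral_mono_ae hle).trans_lt ?_
  rw [lintegral_finsetSum' _ fun i _ => (hmi i).1.enorm]
  exact ENNReal.sum_lt_top.2 fun i _ => (hmi i).2

/-- At resonance the logarithm is absent when the first modified moments of the nonlinearity along
the asymptotic profile are integrable in time. -/
lemma SourceRepresentation.exists_profileDist_le_of_moment
    (h : SourceRepresentation G F φ u d K a c C ψ f) (hG : KernelCondition G γ d L) (hγ : 2 ≤ γ)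
    (hF : NonlinearityCondition F Cs A p) (haA : a = -A + N * (p - 1) / d - 1)
    (hK : 1 ≤ K) (hKL : K < L) (ha : a = 1 / d) (hu : IsGlobalSolution G F φ u)
    (hmom : ∀ α : Fin N → ℕ, ∑ i, α i = 1 → IntegrableOn (fun t : ℝ => modifiedMoment G
      (fun x => F x t (asymptoticMass G F φ u * shiftedKernel G x t)) t α) (Ioi 0) volume) :
    ∃ B : ℝ, 0 ≤ B ∧ ∀ t : ℝ, 1 ≤ t → profileDist K (t ^ (1 / d))
      (fun x => u x t - asymptoticMass G F φ u * shiftedKernel G x t) ≤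
        ENNReal.ofReal (B * t ^ (-(1 / d))) := by
  have hK0 : 0 ≤ K := by linarith
  have hq := hG.isSemigroupProfile
  have hd := hG.d_pos
  have ha0 : 0 < a := by rw [ha]; positivity
  have hCs := hF.Cs_pos
  set M := asymptoticMass G F φ u with hM
  -- Any exponent in `(1, 2]` below `L` would do; since `1 ≤ K < L`, the midpoint of `1` and `L`
  -- lies strictly between them.
  set κ := min 2 ((1 + L) / 2) with hκ
  have hκ1 : 1 < κ := lt_min (by norm_num) (by linarith)
  have hκL : κ < L := (min_le_right _ _).trans_lt (by linarith)
  have hK'L : max K κ < L := max_lt hKL hκL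
  have hK'1 : 1 ≤ max K κ := hK.trans (le_max_left _ _)
  obtain ⟨c₁, hw₁⟩ := hG.exists_parabolicBound hK0 hKL M
  obtain ⟨c₂, hw₂⟩ := hG.exists_parabolicBound (by linarith : 0 ≤ max K κ) hK'L M
  obtain ⟨f₂, hf₂, hf₂eq⟩ := hw₂.exists_source hF haA
  have hc₂ := hw₂.nonneg
  obtain ⟨B₁, hB₁, h₁⟩ := h.exists_profileDist_le hG hK0 hKL ha0 hu
  obtain ⟨B₂, hB₂, h₂⟩ := h.exists_data_le hG hK0 hKL zero_le_one le_rfl hK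
  -- Bootstrap: the rate with logarithm from part (i) is the a priori estimate for `u - M g`.
  obtain ⟨B₃, hB₃, h₃⟩ := h.exists_profileDist_le_of_eq hG hK0 hKL zero_le_one le_rfl hK ha0 ha hu
  obtain ⟨B₄, hB₄, h₄⟩ := hq.exists_nearError_le_of_moment (hG.differentiable_fderiv_profile hγ)
    (hG.polyDecay_fderiv_fderiv hγ) hK (le_max_left K κ) hK'L hκ1 (min_le_left _ _)
    (le_max_right K κ) (by positivity) ha hf₂
    (lintegral_moment_lt_top hG hK'1 hK'L hf₂ hf₂eq hmom)
  obtain ⟨B₅, hB₅, h₅⟩ := hq.exists_nearError_add_le hK0 hKL zero_le_one le_rfl hK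
  have hgm : ∀ s : ℝ, 0 < s → Measurable fun x => M * shiftedKernel G x s := by
    intro s hs
    simp_rw [shiftedKernel, hG.eq_selfSimilar (by linarith : 0 < s + 1)]
    exact (continuous_dilate hq.differentiable.continuous _).measurable.const_mul M
  obtain ⟨D, hD, hdiff⟩ := exists_rpow_bound_of_log hd hB₃ (add_nonneg h.bound.nonneg hw₁.nonneg)
    (X := fun s => scaledL1 K ((1 + s) ^ (1 / d)) (fun x => ‖u x s - M * shiftedKernel G x s‖ₑ))
    (fun s hs => by
      rw [ENNReal.ofReal_add h.bound.nonneg hw₁.nonneg]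
      refine le_trans ?_ (add_le_add (h.bound.l1 s hs) (hw₁.l1 s hs))
      rw [add_comm (scaledL1 _ _ _), ← scaledL1_add (hgm s hs).enorm]
      exact scaledL1_mono (.of_forall fun x => enorm_sub_le.trans (le_of_eq (add_comm _ _))))
    (fun s hs => (profileDist_scaledL1_le hK0 hd (by linarith) _).trans (h₃ s hs))
  set c' := max c c₂
  have hc' : 0 ≤ c' := hc₂.trans (le_max_right _ _)
  set δ := 1 / (2 * d) with hδ
  have hδ0 : 0 < δ := by positivity
  set E₁ := Cs * c' ^ (p - 1) * D with hE₁
  have hE₁0 : 0 ≤ E₁ := by positivity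
  -- The Lipschitz bound turns the rate of `u - M g` into an additional factor `(1+s)^(-δ)` for the
  -- difference of the sources.
  have hf₁ : ∀ᵐ s ∂volume.restrict (Ioi (0 : ℝ)),
      scaledL1 K ((1 + s) ^ (1 / d)) (fun y => ‖f y s - f₂ y s‖ₑ) ≤
        ENNReal.ofReal (E₁ * (1 + s) ^ (-a - 1 - δ)) := by
    filter_upwards [ae_slice_of_ae h.source_eq, ae_slice_of_ae hf₂eq,
      ae_restrict_mem measurableSet_Ioi] with s e1 e2 hs0
    have hs1 : 0 < s := hs0
    have h6 : scaledL1 K ((1 + s) ^ (1 / d)) (fun y => ‖f y s - f₂ y s‖ₑ) ≤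
        scaledL1 K ((1 + s) ^ (1 / d))
          (fun y => ‖F y s (u y s) - F y s (M * shiftedKernel G y s)‖ₑ) := by
      refine scaledL1_mono ?_
      filter_upwards [e1, e2] with y hy1 hy2
      rw [← hy1, ← hy2]
    refine h6.trans ((hF.scaledL1_sub_le haA hs0 hc' ((h.bound.mono (le_max_left _ _)).sup s hs0)
      ((hw₂.mono (le_max_right _ _)).sup s hs0)).trans ?_)
    refine (mul_le_mul_right (hdiff s hs0) _).trans (le_of_eq ?_)
    rw [← ENNReal.ofReal_mul (by positivity)]
    congr 1
    have : (1 + s) ^ (-a - 1 - δ) = (1 + s) ^ (-a - 1) * (1 + s) ^ (-δ) := by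
      rw [← Real.rpow_add (by positivity)]; congr 1
    rw [this]; ring
  have hf₂fin : ∀ᵐ s ∂volume.restrict (Ioi (0 : ℝ)),
      scaledL1 K ((1 + s) ^ (1 / d)) (fun y => ‖f₂ y s‖ₑ) < ∞ := by
    filter_upwards [hf₁, h.source.l1] with s e1 e2
    have : scaledL1 K ((1 + s) ^ (1 / d)) (fun y => ‖f₂ y s‖ₑ) ≤
        scaledL1 K ((1 + s) ^ (1 / d)) (fun y => ‖f y s‖ₑ) +
        scaledL1 K ((1 + s) ^ (1 / d)) (fun y => ‖f y s - f₂ y s‖ₑ) := by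
      rw [← scaledL1_add (h.source.measurable_section s).enorm]
      refine scaledL1_mono (.of_forall fun y => ?_)
      calc ‖f₂ y s‖ₑ = ‖f y s - (f y s - f₂ y s)‖ₑ := by rw [sub_sub_cancel]
        _ ≤ _ := enorm_sub_le
    exact this.trans_lt (ENNReal.add_lt_top.2
      ⟨e2.trans_lt ENNReal.ofReal_lt_top, e1.trans_lt ENNReal.ofReal_lt_top⟩)
  have hI : ∫⁻ s in Ioi (0 : ℝ), ENNReal.ofReal ((1 + s) ^ (-δ - 1)) ≠ ∞ :=
    (lintegral_Ioi_rate_lt_top hδ0).ne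
  set I := (∫⁻ s in Ioi (0 : ℝ), ENNReal.ofReal ((1 + s) ^ (-δ - 1))).toReal with hIdef
  have hI0 : 0 ≤ I := ENNReal.toReal_nonneg
  refine ⟨B₁ + B₂ + B₅ * (E₁ * I) + B₄, by positivity, fun t ht => ?_⟩
  have ht0 : 0 < t := by linarith
  have hnear : nearError d K (fun y => G y 1) f t ≤
      ENNReal.ofReal (B₅ * (E₁ * I) * t ^ (-(1 / d))) + ENNReal.ofReal (B₄ * t ^ (-(1 / d))) := by
    -- The source is split as `(f - f₂) + f₂`. Since `a = 1/d`, the first part leads to the time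
    -- integral of `(1+s)^(-1-δ)`, which converges; the second is covered by its moments.
    have h7 := h₅ (fun y s => f y s - f₂ y s) f₂ (fun s => E₁ * (1 + s) ^ (-a - 1 - δ)) t ht
      (by fun_prop) (h.source.measurable.sub hf₂.measurable) hf₂.measurable hf₁ hf₂fin
    simp only [sub_add_cancel] at h7
    refine h7.trans (add_le_add ?_ (h₄ t ht))
    have h8 : ∫⁻ s in Ioo 0 (t / 2),
        ENNReal.ofReal ((1 + s) ^ (1 / d) * (E₁ * (1 + s) ^ (-a - 1 - δ))) ≤
        ENNReal.ofReal (E₁ * I) := by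
      rw [ENNReal.ofReal_mul hE₁0, hIdef, ENNReal.ofReal_toReal hI,
        ← lintegral_const_mul' _ _ ENNReal.ofReal_ne_top]
      refine (setLIntegral_mono' measurableSet_Ioo fun s hs => le_of_eq ?_).trans
        (lintegral_mono_set Ioo_subset_Ioi_self)
      have h1s : 0 < 1 + s := by linarith [hs.1]
      rw [← ENNReal.ofReal_mul hE₁0, mul_left_comm, ← Real.rpow_add h1s, ha]
      congr 3; ring
    refine (mul_le_mul_right h8 _).trans (le_of_eq ?_)
    rw [← ENNReal.ofReal_mul (by positivity)]
    congr 1; ring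
  refine (h₁ t ht).trans ((add_le_add_left (add_le_add (h₂ t ht) hnear) _).trans (le_of_eq ?_))
  rw [ha, ← ENNReal.ofReal_add (by positivity) (by positivity),
    ← ENNReal.ofReal_add (by positivity) (by positivity),
    ← ENNReal.ofReal_add (by positivity) (by positivity)]
  congr 1
  ring

end Moment

/-! ### Mass and integrability -/

namespace SourceRepresentation

variable {γ : ℕ} {d L a K c C : ℝ} {G : E N → ℝ → ℝ} {F : E N → ℝ → ℝ → ℝ} {φ ψ : E N → ℝ}
  {u f : E N → ℝ → ℝ}

lemma integrable_slice (h : SourceRepresentation G F φ u d K a c C ψ f) {t : ℝ} (ht : 0 < t) :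
    Integrable (fun x => u x t) :=
  ⟨h.slice_measurable t ht, (lintegral_le_scaledL1 (by positivity) _).trans_lt
    ((h.bound.l1 t ht).trans_lt ENNReal.ofReal_lt_top)⟩

lemma integrableOn_source (h : SourceRepresentation G F φ u d K a c C ψ f) (ha : 0 < a) :
    IntegrableOn (fun z : E N × ℝ => F z.1 z.2 (u z.1 z.2)) (univ ×ˢ Ioi (0 : ℝ)) volume := by
  have hf : Measurable fun z : E N × ℝ => f z.1 z.2 := h.source.measurable
  refine Integrable.congr ⟨hf.aestronglyMeasurable, ?_⟩ h.source_eq.symm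
  rw [hasFiniteIntegral_iff_enorm, Measure.volume_eq_prod, ← Measure.prod_restrict,
    Measure.restrict_univ, lintegral_prod_symm _ hf.enorm.aemeasurable]
  calc ∫⁻ s in Ioi (0 : ℝ), ∫⁻ x, ‖f x s‖ₑ
      ≤ ∫⁻ s in Ioi (0 : ℝ), ENNReal.ofReal C * ENNReal.ofReal ((1 + s) ^ (-a - 1)) := by
        refine lintegral_mono_ae ?_
        filter_upwards [h.source.l1, ae_restrict_mem measurableSet_Ioi] with s hs hs0
        have hs1 : 0 < s := hs0
        rw [← ENNReal.ofReal_mul h.nonneg]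
        exact (lintegral_le_scaledL1 (by positivity) _).trans hs
    _ < ∞ := by
        rw [lintegral_const_mul' _ _ ENNReal.ofReal_ne_top]
        exact ENNReal.mul_lt_top ENNReal.ofReal_lt_top (lintegral_Ioi_rate_lt_top ha)

/-- As `∫ M g(t) = M`, the difference `∫ u(t) - M` is at most the `L^1` norm of `u(t) - M g(t)`. The
weight exponent `0` is chosen because there the `o(t^(-K/d))` estimate reads `o(1)` and holds for
every `a > 0`. -/
lemma tendsto_integral (h : SourceRepresentation G F φ u d 0 a c C ψ f)
    (hG : KernelCondition G γ d L) (ha : 0 < a) (hu : IsGlobalSolution G F φ u) :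
    Tendsto (fun t : ℝ => ∫ x, u x t) atTop (𝓝 (asymptoticMass G F φ u)) := by
  set M := asymptoticMass G F φ u with hM
  have hq := hG.isSemigroupProfile
  have hL := hG.L_pos
  have hg : ∀ t : ℝ, 0 < t → Integrable (fun x => M * shiftedKernel G x t) ∧
      ∫ x, M * shiftedKernel G x t = M := by
    intro t ht
    simp_rw [shiftedKernel, hG.eq_selfSimilar (by linarith : 0 < t + 1)]
    refine ⟨(hq.integrable_selfSimilar hL (by linarith)).const_mul M, ?_⟩
    rw [integral_const_mul, IsSemigroupProfile.integral_selfSimilar (by linarith : 0 < t + 1)]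
    -- If the profile does not have unit mass, it vanishes identically, and then so does `M`.
    by_cases h1 : ∫ x, G x 1 = 1
    · rw [h1, mul_one]
    · have h2 : ∀ x, G x 1 = 0 := fun x =>
        (mul_eq_zero.1 (hG.profile_mul_eq_zero x)).resolve_right (sub_ne_zero.2 (Ne.symm h1))
      have h3 : M = 0 := by rw [hM, asymptoticMass]; simp [h2]
      rw [h3, zero_mul]
  have h0 := h.tendsto_profileDist hG le_rfl hL zero_lt_one ha (by simpa using ha) hu
  have h1 : Tendsto (fun t : ℝ => ∫⁻ x, ‖u x t - M * shiftedKernel G x t‖ₑ) atTop (𝓝 0) := by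
    refine tendsto_of_tendsto_of_tendsto_of_le_of_le' tendsto_const_nhds h0
      (.of_forall fun _ => zero_le) ?_
    filter_upwards [eventually_gt_atTop 0] with t ht
    rw [zero_div, Real.rpow_zero, ENNReal.ofReal_one, one_mul]
    exact (lintegral_le_scaledL1 (by positivity) _).trans le_self_add
  rw [tendsto_iff_edist_tendsto_0]
  refine tendsto_of_tendsto_of_tendsto_of_le_of_le' tendsto_const_nhds h1
    (.of_forall fun _ => zero_le) ?_
  filter_upwards [eventually_gt_atTop 0] with t ht
  obtain ⟨hi, he⟩ := hg t ht
  nth_rw 1 [← he]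
  rw [edist_eq_enorm_sub, ← integral_sub (h.integrable_slice ht) hi]
  exact enorm_integral_le_lintegral_enorm _

end SourceRepresentation

lemma KernelCondition.asymptoticMass_eq {γ : ℕ} {d L : ℝ} {G : E N → ℝ → ℝ}
    (hG : KernelCondition G γ d L) (hne : ∃ (x : E N) (t : ℝ), 0 < t ∧ G x t ≠ 0)
    (F : E N → ℝ → ℝ → ℝ) (φ : E N → ℝ) (u : E N → ℝ → ℝ) :
    asymptoticMass G F φ u = (∫ x, φ x) + ∫ t in Ioi (0 : ℝ), ∫ x, F x t (u x t) := by
  obtain ⟨x, t, ht, hx⟩ := hne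
  have h1 := (_root_.mul_eq_zero.1 (hG.mul_eq_zero x ht)).resolve_left hx
  rw [asymptoticMass, ← sub_eq_zero.1 h1, mul_one]

lemma HasDecayBound.mono {d K K' : ℝ} {u : E N → ℝ → ℝ} (h : HasDecayBound d K u) (hK : K' ≤ K) :
    HasDecayBound d K' u :=
  fun q ℓ hq h0 hℓ => h q ℓ hq h0 (hℓ.trans hK)

lemma weightedNorm_zero_le {K : ℝ} (φ : E N → ℝ) :
    weightedNorm 0 φ ≤ ENNReal.ofReal 2 * weightedNorm K φ := by
  unfold weightedNorm
  rw [← lintegral_const_mul' _ _ ENNReal.ofReal_ne_top]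
  refine lintegral_mono fun x => ?_
  simp only
  rw [mul_left_comm, Real.rpow_zero, ← ENNReal.ofReal_mul zero_le_two]
  gcongr
  have : 0 ≤ ‖x‖ ^ K := by positivity
  linarith

/-- From `t = e` on, `1 ≤ log t`, so that `1 + log t ≤ 2 log t`. -/
lemma eventually_ofReal_one_add_log_le {B e : ℝ} (hB : 0 ≤ B) {X : ℝ → ℝ≥0∞}
    (hX : ∀ t, 1 ≤ t → X t ≤ ENNReal.ofReal (B * (t ^ e * (1 + Real.log t)))) :
    ∀ᶠ t in atTop, X t ≤ ENNReal.ofReal (2 * B * (t ^ e * Real.log t)) := by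
  filter_upwards [eventually_ge_atTop (Real.exp 1)] with t ht
  have h1 : 1 ≤ Real.exp 1 := Real.one_le_exp zero_le_one
  have h2 : 1 ≤ Real.log t := (Real.le_log_iff_exp_le (by linarith)).2 ht
  have h3 : 0 < t := by linarith
  refine (hX t (h1.trans ht)).trans (ENNReal.ofReal_le_ofReal ?_)
  calc B * (t ^ e * (1 + Real.log t)) ≤ B * (t ^ e * (Real.log t + Real.log t)) := by gcongr
    _ = _ := by ring

end IntegralAsymptotics

end

/-! ### The theorem: all cases from the distance estimates. -/

open IntegralAsymptotics

theorem corollary5p1 (N : ℕ) (hN : 1 ≤ N) (γ : ℕ) (d L : ℝ)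
    (G : IntegralAsymptotics.E N → ℝ → ℝ)
    (hG : IntegralAsymptotics.KernelCondition G γ d L)
    (K : ℝ) (hK0 : 0 ≤ K) (hKL : K < L) (hKγ : ⌊K⌋₊ + 1 ≤ γ)
    (φ : IntegralAsymptotics.E N → ℝ) (hφ : MemLp φ ∞ volume)
    (hφK : IntegralAsymptotics.weightedNorm K φ < ∞)
    (Cs A p Ap : ℝ) (F : IntegralAsymptotics.E N → ℝ → ℝ → ℝ)
    (hF : IntegralAsymptotics.NonlinearityCondition F Cs A p)
    (hAp : Ap = -A + N * (p - 1) / d - 1) (hAp_pos : 0 < Ap)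
    (u : IntegralAsymptotics.E N → ℝ → ℝ)
    (hu : IntegralAsymptotics.IsGlobalSolution G F φ u)
    (hu_bound : IntegralAsymptotics.HasDecayBound d K u) :
    ∃ M : ℝ,
      -- the limit defining `M` exists
      (∀ t : ℝ, 0 < t → Integrable (fun x => u x t) volume) ∧
      Tendsto (fun t : ℝ => ∫ x, u x t) atTop (𝓝 M) ∧
      -- the second expression for `M`
      IntegrableOn (fun z : IntegralAsymptotics.E N × ℝ => F z.1 z.2 (u z.1 z.2))
        (univ ×ˢ Ioi (0 : ℝ)) volume ∧
      ((∃ (x : IntegralAsymptotics.E N) (t : ℝ), 0 < t ∧ G x t ≠ 0) →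
        M = (∫ x, φ x) + ∫ t in Ioi (0 : ℝ), ∫ x, F x t (u x t)) ∧
      -- (i)
      (∀ (q : ℝ≥0∞) (ℓ : ℝ), 1 ≤ q → 0 ≤ ℓ → ℓ ≤ K →
        (K < 1 → Ap ≠ K / d →
          IntegralAsymptotics.IsLittleOAddBigORate
            (IntegralAsymptotics.rescaledDist G d u M q ℓ)
            (fun t => t ^ (-(K / d))) (fun t => t ^ (-Ap))) ∧
        (K < 1 → Ap = K / d →
          IntegralAsymptotics.IsBigORate (IntegralAsymptotics.rescaledDist G d u M q ℓ)
            (fun t => t ^ (-(K / d)) * Real.log t)) ∧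
        (1 ≤ K → Ap ≠ 1 / d →
          IntegralAsymptotics.IsBigOAddBigORate
            (IntegralAsymptotics.rescaledDist G d u M q ℓ)
            (fun t => t ^ (-(1 / d))) (fun t => t ^ (-Ap))) ∧
        (1 ≤ K → Ap = 1 / d →
          IntegralAsymptotics.IsBigORate (IntegralAsymptotics.rescaledDist G d u M q ℓ)
            (fun t => t ^ (-(1 / d)) * Real.log t))) ∧
      -- (ii)
      (1 ≤ K →
        (∀ α : Fin N → ℕ, ∑ i, α i = 1 →
          IntegrableOn
            (fun t : ℝ => IntegralAsymptotics.modifiedMoment G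
              (fun x => F x t (M * IntegralAsymptotics.shiftedKernel G x t)) t α)
            (Ioi (0 : ℝ)) volume) →
        ∀ (q : ℝ≥0∞) (ℓ : ℝ), 1 ≤ q → 0 ≤ ℓ → ℓ ≤ K →
          IntegralAsymptotics.IsBigOAddBigORate
            (IntegralAsymptotics.rescaledDist G d u M q ℓ)
            (fun t => t ^ (-(1 / d))) (fun t => t ^ (-Ap))) := by
  have hd := hG.d_pos
  obtain ⟨c, C, ψ, f, h⟩ := exists_sourceRepresentation hG hK0 hφ.1 hφK hF hAp hu hu_bound
  -- A second representation with weight exponent `0` is used for the convergence of the mass;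
  -- `asymptoticMass` does not depend on the representation, so both concern the same `M`.
  obtain ⟨c₀, C₀, ψ₀, f₀, h₀⟩ := exists_sourceRepresentation hG le_rfl hφ.1
    ((weightedNorm_zero_le φ).trans_lt (ENNReal.mul_lt_top ENNReal.ofReal_lt_top hφK)) hF hAp hu
    (hu_bound.mono hK0)
  set M := asymptoticMass G F φ u with hM
  set X : ℝ → ℝ≥0∞ := fun t => profileDist K (t ^ (1 / d))
    (fun x => u x t - M * shiftedKernel G x t) with hX
  have hD : ∀ (q : ℝ≥0∞) (ℓ : ℝ), 1 ≤ q → 0 ≤ ℓ → ℓ ≤ K → ∀ᶠ t in atTop,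
      rescaledDist G d u M q ℓ t ≤ ENNReal.ofReal 3 * X t := fun q ℓ hq hℓ hℓK => by
    filter_upwards [eventually_ge_atTop 1] with t ht
    exact rescaledDist_le hd ht hq hℓ hℓK
  have hpow : ∀ e : ℝ, ∀ᶠ t : ℝ in atTop, 0 ≤ t ^ e := fun e => by
    filter_upwards [eventually_ge_atTop 0] with t ht
    positivity
  have hlog : ∀ e : ℝ, ∀ᶠ t : ℝ in atTop, 0 ≤ t ^ e * Real.log t := fun e => by
    filter_upwards [eventually_ge_atTop 1] with t ht
    have := Real.log_nonneg ht
    positivity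
  have hne : ∀ (q : ℝ≥0∞) (ℓ : ℝ), 1 ≤ q → 0 ≤ ℓ → ℓ ≤ K → 1 ≤ K → Ap ≠ 1 / d →
      IsBigOAddBigORate (rescaledDist G d u M q ℓ)
        (fun t => t ^ (-(1 / d))) (fun t => t ^ (-Ap)) := by
    intro q ℓ hq hℓ hℓK hK1 hA
    obtain ⟨B, hB, hle⟩ := h.exists_profileDist_le_of_ne hG hK0 hKL zero_le_one le_rfl hK1
      hAp_pos hA hu
    refine isBigOAddBigORate_of_le zero_le_three hB (hD q ℓ hq hℓ hℓK) ?_ (hpow _) (hpow _)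
    filter_upwards [eventually_ge_atTop 1] with t ht using hle t ht
  refine ⟨M, fun t ht => h.integrable_slice ht, h₀.tendsto_integral hG hAp_pos hu,
    h.integrableOn_source hAp_pos, fun hne => hG.asymptoticMass_eq hne F φ u,
    fun q ℓ hq hℓ hℓK => ⟨fun hK1 hA => ?_, fun hK1 hA => ?_, hne q ℓ hq hℓ hℓK,
      fun hK1 hA => ?_⟩, fun hK1 hmom q ℓ hq hℓ hℓK => ?_⟩
  · rcases lt_or_gt_of_ne hA with hA | hA
    -- For `A_p < K/d` both powers are at most `t^(-A_p)`, and no smallness is needed.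
    · obtain ⟨B, hB, hle⟩ := h.exists_profileDist_le_of_ne hG hK0 hKL hK0 hK1.le le_rfl
        hAp_pos hA.ne hu
      refine isLittleOAddBigORate_of_le zero_le_three (C := 2 * B) (by positivity)
        (hD q ℓ hq hℓ hℓK) ?_ (hpow _)
      filter_upwards [eventually_ge_atTop 1] with t ht
      refine (hle t ht).trans (ENNReal.ofReal_le_ofReal ?_)
      have : t ^ (-(K / d)) ≤ t ^ (-Ap) := Real.rpow_le_rpow_of_exponent_le ht (by linarith)
      calc B * (t ^ (-(K / d)) + t ^ (-Ap)) ≤ B * (t ^ (-Ap) + t ^ (-Ap)) := by gcongr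
        _ = _ := by ring
    · exact isLittleOAddBigORate_of_tendsto (hD q ℓ hq hℓ hℓK)
        (h.tendsto_profileDist hG hK0 hKL hK1 hAp_pos hA hu)
  · obtain ⟨B, hB, hle⟩ := h.exists_profileDist_le_of_eq hG hK0 hKL hK0 hK1.le le_rfl
      hAp_pos hA hu
    exact isBigORate_of_le zero_le_three (by positivity : 0 ≤ 2 * B) (hD q ℓ hq hℓ hℓK)
      (eventually_ofReal_one_add_log_le hB hle) (hlog _)
  · obtain ⟨B, hB, hle⟩ := h.exists_profileDist_le_of_eq hG hK0 hKL zero_le_one le_rfl hK1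
      hAp_pos hA hu
    exact isBigORate_of_le zero_le_three (by positivity : 0 ≤ 2 * B) (hD q ℓ hq hℓ hℓK)
      (eventually_ofReal_one_add_log_le hB hle) (hlog _)
  -- Only resonance needs the moment hypothesis; otherwise part (i) already gives the rate.
  · by_cases hA : Ap = 1 / d
    -- Two derivatives of the kernel are available because `1 ≤ K` gives `⌊K⌋ + 1 ≥ 2`.
    · have hγ : 2 ≤ γ := by
        have : 1 ≤ ⌊K⌋₊ := Nat.one_le_floor_iff _ |>.2 hK1
        omega
      obtain ⟨B, hB, hle⟩ := h.exists_profileDist_le_of_moment hG hγ hF hAp hK1 hKL hA hu hmom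
      refine isBigOAddBigORate_of_le zero_le_three hB (hD q ℓ hq hℓ hℓK) ?_ (hpow _) (hpow _)
      filter_upwards [eventually_ge_atTop 1] with t ht
      refine (hle t ht).trans (ENNReal.ofReal_le_ofReal ?_)
      gcongr
      have : 0 ≤ t ^ (-Ap) := by positivity
      linarith
    · exact hne q ℓ hq hℓ hℓK hK1 hA
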